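/- A Lévy process is identified with its family of one-dimensional distributions: a weakly continuous convolution semigroup $(p_t)_{t\ge 0}$ of probability measures on $\mathbb R^d$, $d\ge 1$, with $p_0=\delta_0$. A Borel measure on $\mathbb R^d$ is isotropic unimodal if on $\mathbb R^d\setminus\{0\}$ it has a finite radial nonincreasing density with respect to Lebesgue measure (an atom at $0$ is allowed); the Lévy process is isotropic unimodal if every $p_t$ is. Its characteristic exponent is the radial function $\psi\ge0$ with $\int e^{i\langle\xi,x\rangle}p_t(dx)=e^{-t\psi(|\xi|)}$, and its Lévy measure is the symmetric measure $\nu$ with $\nu(\{0\})=0$, $\int(|x|^2\wedge1)\,\nu(dx)<\infty$ and, for some $\sigma\ge0$, $\psi(|\xi|)=\sigma|\xi|^2+\int(1-\cos\langle\xi,x\rangle)\,\nu(dx)$. A complete subordinate Brownian motion is a process $Z_t=B_{2S_t}$, where $B$ is the standard Brownian motion in $\mathbb R^d$ and $S$ is an independent subordinator with $\mathbb E e^{-\lambda S_t}=e^{-t\varphi(\lambda)}$, $\lambda>0$, whose Laplace exponent $\varphi$ is a complete Bernstein function, i.e. $\varphi(\lambda)=a+b\lambda+\int_0^\infty(1-e^{-\lambda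 u})m(u)\,du$ with $a,b\ge0$, $m$ completely monotone on $(0,\infty)$ and $\int_0^\infty (u\wedge 1)m(u)\,du<\infty$. **Corollary.** Let $X$ be an isotropic unimodal Lévy process in $\mathbb R^d$ with characteristic exponent $\psi$ and nonzero Lévy measure $\nu$. Suppose that there are $0<\alpha\le\beta<2$, $c\in(0,1]$ and $C\ge1$ such that $$c\,\lambda^{\alpha}\psi(\theta)\le\psi(\lambda\theta)\le C\,\lambda^{\beta}\psi(\theta)\qquad\text{for all }\lambda\ge1,\ \theta>0 .$$ Then there is a complete subordinate Brownian motion $Z$ in $\mathbb R^d$, with characteristic exponent $\psi^Z$ and Lévy measure $\nu^Z$, such that the following hold for some constant $K\ge 1$. 1. $K^{-1}\psi(u)\le\psi^Z(u)\le K\psi(u)$ for all $u\ge0$. 2. $\nu$ and $\nu^Z$ have radial nonincreasing densities on $\mathbb R^d\setminus\{0\}$ with $K^{-1}\nu(x)\le\nu^Z(x)\le K\nu(x)$ for all $x\ne0$. 3. For every $t>0$ the distributions of $X_t$ and $Z_t$ have continuous densities $p_t$ and $p^Z_t$ on $\mathbb R^d$, and $K^{-1}p_t(x)\le p^Z_t(x)\le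 Kp_t(x)$ for all $t>0$ and $x\in\mathbb R^d$. -/

import Mathlib

open MeasureTheory ProbabilityTheory Set Filter Topology
open scoped NNReal ENNReal ContDiff RealInnerProductSpace BoundedContinuousFunction

noncomputable section

/-! ### Convolution semigroups (families of one-dimensional distributions of Lévy processes) -/

/-- `p` is a weakly continuous convolution semigroup of probability measures on `E`, that is,
the family of the laws `p t` of `X t` for a Lévy process `X` in `E` started from `0`. -/
structure IsConvolutionSemigroup {E : Type*} [NormedAddCommGroup E] [MeasurableSpace E]
    (p : ℝ≥0 → Measure E) : Prop where
  prob : ∀ t, IsProbabilityMeasure (p t)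
  zero : p 0 = Measure.dirac 0
  add : ∀ s t, p (s + t) = p s ∗ p t
  cont : ∀ f : E →ᵇ ℝ, Tendsto (fun t => ∫ x, f x ∂(p t)) (𝓝 0) (𝓝 (f 0))

section LevyProcesses

variable {E : Type*} [NormedAddCommGroup E] [InnerProductSpace ℝ E] [MeasurableSpace E]

/-- `ψ` is the (real-valued) characteristic exponent of the convolution semigroup `p`:
`∫ exp (i ⟪ξ, x⟫) p_t(dx) = exp (-t ψ(ξ))`. -/
def IsCharExponent (p : ℝ≥0 → Measure E) (ψ : E → ℝ) : Prop :=
  ∀ (t : ℝ≥0) (ξ : E), charFun (p t) ξ = Complex.exp (-((t * ψ ξ : ℝ) : ℂ))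

/-- `ν` is a Lévy measure: it does not charge the origin and `∫ (‖x‖² ∧ 1) ν(dx) < ∞`. -/
structure IsLevyMeasure (ν : Measure E) : Prop where
  zero : ν {0} = 0
  lintegral_lt_top : ∫⁻ x, ENNReal.ofReal (min (‖x‖ ^ 2) 1) ∂ν < (⊤ : ℝ≥0∞)

/-- `ν` is the Lévy measure of the rotation invariant convolution semigroup with characteristic
exponent `ψ`: it is a symmetric Lévy measure and the Lévy-Khintchine formula
`ψ(ξ) = σ ‖ξ‖² + ∫ (1 - cos ⟪ξ, x⟫) ν(dx)` holds for some Gaussian coefficient `σ ≥ 0`. -/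
def HasLevyMeasure (ψ : E → ℝ) (ν : Measure E) : Prop :=
  IsLevyMeasure ν ∧ ν.map (fun x => -x) = ν ∧
    ∃ σ : ℝ, 0 ≤ σ ∧ ∀ ξ, ψ ξ = σ * ‖ξ‖ ^ 2 + ∫ x, (1 - Real.cos ⟪ξ, x⟫) ∂ν

end LevyProcesses

section Unimodality

variable {d : ℕ}

/-- On `ℝ^d ∖ {0}` the measure `μ` is absolutely continuous with respect to the Lebesgue measure,
with the finite radial nonincreasing density `x ↦ f ‖x‖`. -/
def IsRadialNonincreasingDensity (f : ℝ → ℝ) (μ : Measure (EuclideanSpace ℝ (Fin d))) : Prop :=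
  (∀ r, 0 < r → 0 ≤ f r) ∧ AntitoneOn f (Ioi 0) ∧
    μ.restrict {0}ᶜ = (volume.restrict {0}ᶜ).withDensity (fun x => ENNReal.ofReal (f ‖x‖))

/-- Isotropic unimodal measure on `ℝ^d` (an atom at the origin is allowed). -/
def IsIsotropicUnimodal (μ : Measure (EuclideanSpace ℝ (Fin d))) : Prop :=
  ∃ f : ℝ → ℝ, IsRadialNonincreasingDensity f μ

/-- For every `t > 0` the function `k t` is a continuous density on the whole of `ℝ^d` of the
law `p t`; such a function `k t` is unique. -/
def IsContinuousTransitionDensity (p : ℝ≥0 → Measure (EuclideanSpace ℝ (Fin d)))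
    (k : ℝ≥0 → EuclideanSpace ℝ (Fin d) → ℝ) : Prop :=
  ∀ t, 0 < t → Continuous (k t) ∧ (∀ x, 0 ≤ k t x) ∧
    p t = volume.withDensity (fun x => ENNReal.ofReal (k t x))

end Unimodality

/-! ### Weak scaling and comparability -/

/-- Weak lower scaling condition with exponent `α`, threshold `θ` and constant `c`. -/
def WLSC (α θ c : ℝ) (φ : ℝ → ℝ) : Prop :=
  ∀ l u : ℝ, 1 ≤ l → θ < u → c * l ^ α * φ u ≤ φ (l * u)

/-- Weak upper scaling condition with exponent `α`, threshold `θ` and constant `C`. -/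
def WUSC (α θ C : ℝ) (φ : ℝ → ℝ) : Prop :=
  ∀ l u : ℝ, 1 ≤ l → θ < u → φ (l * u) ≤ C * l ^ α * φ u

/-- `f ≈ g` on the set `S`. -/
def ComparableOn {ι : Type*} (S : Set ι) (f g : ι → ℝ) : Prop :=
  ∃ K : ℝ, 0 < K ∧ ∀ x ∈ S, 0 ≤ f x ∧ 0 ≤ g x ∧ K⁻¹ * f x ≤ g x ∧ g x ≤ K * f x

/-! ### Complete subordinate Brownian motions -/

/-- `m` is completely monotone on `(0, ∞)`: it is smooth and `(-1)^n m^(n) ≥ 0` for all `n`. -/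
def IsCompletelyMonotone (m : ℝ → ℝ) : Prop :=
  ContDiffOn ℝ ∞ m (Ioi 0) ∧
    ∀ (n : ℕ) (u : ℝ), 0 < u → 0 ≤ (-1) ^ n * iteratedDerivWithin n m (Ioi 0) u

/-- `φ` is a complete Bernstein function: a Bernstein function
`φ(l) = a + b l + ∫₀^∞ (1 - exp (-l u)) m(u) du` whose Lévy measure has a completely monotone
density `m`. -/
def IsCompleteBernstein (φ : ℝ → ℝ) : Prop :=
  ∃ (a b : ℝ) (m : ℝ → ℝ), 0 ≤ a ∧ 0 ≤ b ∧ IsCompletelyMonotone m ∧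
    IntegrableOn (fun u => min u 1 * m u) (Ioi 0) ∧
    ∀ l, 0 < l → φ l = a + b * l + ∫ u in Ioi 0, (1 - Real.exp (-(l * u))) * m u

/-- `η` is the family of laws of a subordinator: a convolution semigroup of probability measures
concentrated on `[0, ∞)`. -/
def IsSubordinator (η : ℝ≥0 → Measure ℝ) : Prop :=
  IsConvolutionSemigroup η ∧ ∀ t, η t (Iio 0) = 0

/-- `φ` is the Laplace exponent of the subordinator `η`. -/
def IsLaplaceExponent (η : ℝ≥0 → Measure ℝ) (φ : ℝ → ℝ) : Prop :=
  ∀ (t : ℝ≥0) (l : ℝ), 0 < l → ∫ s, Real.exp (-(l * s)) ∂(η t) = Real.exp (-(t * φ l))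

/-- The law of `B_{2s}`, where `B` is the standard Brownian motion in `ℝ^d`: the centred normal
law with covariance matrix `2s` times the identity. -/
def heatMeasure (d : ℕ) (s : ℝ) : Measure (EuclideanSpace ℝ (Fin d)) :=
  (stdGaussian (EuclideanSpace ℝ (Fin d))).map (fun x => √(2 * s) • x)

/-- `q` is the family of laws `q t` of `Z t = B_{2 S_t}`, where `B` is the standard Brownian motion
in `ℝ^d` and `S` is an independent complete subordinator, i.e. one whose Laplace exponent is a
complete Bernstein function: `q_t(A) = ∫ P(B_{2s} ∈ A) P(S_t ∈ ds)`. -/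
def IsCompleteSubordinateBrownianMotion {d : ℕ}
    (q : ℝ≥0 → Measure (EuclideanSpace ℝ (Fin d))) : Prop :=
  ∃ (η : ℝ≥0 → Measure ℝ) (φ : ℝ → ℝ), IsSubordinator η ∧ IsLaplaceExponent η φ ∧
    IsCompleteBernstein φ ∧
    ∀ (t : ℝ≥0) (A : Set (EuclideanSpace ℝ (Fin d))), MeasurableSet A →
      q t A = ∫⁻ s, heatMeasure d s A ∂(η t)

end

/-! ### Functions with global weak scaling -/

/-! Under global scaling with exponents in `(0, 2)`, the exponent alone determines the Lévy density
and the transition density up to constants. Hence it suffices to build a complete subordinate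
Brownian motion whose exponent is comparable with `ψ`.

Density bounds. Let `μ` have symbol `Ψ(|ξ|) = ∫ (1 - cos⟨ξ,x⟩) μ(dx)`. Averaging over a Gaussian `ξ`
of scale `1/r` replaces `1 - cos` by `1 - exp(-|x|²/(2r²))` (`HasSymbol.lintegral_one_sub_exp`), a
smooth version of the truncated second moment of `μ` at scale `r`. If `Ψ` is of order `κψ`, scaling
makes this quantity of order `κψ(1/r)`. It dominates the tail of `μ`, and together with monotonicity
this bounds the radial density `f(r)` from above by a multiple of `κψ(1/r)/r^d`
(`exists_density_le`). For the reverse bound (`exists_le_density`), `β < 2` makes the contribution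
near the origin negligible and `α > 0` does the same for the far tail, so a fixed share of the mass
sits in an annulus where the density is at most `f(r)`.

The bounds are used twice. For `p_t`, with `Ψ = 1 - exp(-tψ)` and `κ = t`, they hold outside radius
`1/h`, where `tψ(h) ≈ 1`; inside that radius Fourier inversion and monotonicity give order `h^d`
(`exists_transition_density_bounds`). For `ν`, with `Ψ = ψ` and `κ = 1`, they give `ν(x) ≈
ψ(1/|x|)/|x|^d` (`exists_levy_density_bounds`). That `ν` has a monotone density at all follows by a
Helly limit of the densities of `p_t/t`, identified through uniqueness of the symmetric measure with
symbol `ψ` (`HasSymbol.restrict_unique`).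

Construction. Set `m(u) = ∫ exp(-uv²) 2vψ(v) dv`, which is completely monotone. Its Bernstein
function satisfies `φ(s²) = ∫ 2ψ(v) s²/(v(v²+s²)) dv`, and the scaling of `ψ` makes this comparable
with `ψ(s)` (`exists_isCompletelyMonotone_comparable`). The subordinator is a weak limit of compound
Poisson laws (`exists_subordinator`). -/

/-- `ψ` is continuous on `[0, ∞)`, vanishes only at the origin, and has global weak lower and upper
scaling with exponents `0 < α` and `0 < β < 2`. -/
structure HasWeakScaling (α β c C : ℝ) (ψ : ℝ → ℝ) : Prop where
  alpha_pos : 0 < α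
  beta_pos : 0 < β
  beta_lt : β < 2
  c_pos : 0 < c
  C_pos : 0 < C
  zero : ψ 0 = 0
  pos : ∀ u, 0 < u → 0 < ψ u
  lower : WLSC α 0 c ψ
  upper : WUSC β 0 C ψ
  cont : ContinuousOn ψ (Ici 0)

namespace HasWeakScaling

variable {α β c C : ℝ} {ψ : ℝ → ℝ}

lemma nonneg (h : HasWeakScaling α β c C ψ) {u : ℝ} (hu : 0 ≤ u) : 0 ≤ ψ u := by
  rcases hu.eq_or_lt with rfl | hu
  · exact h.zero.ge
  · exact (h.pos u hu).le

lemma le_of_one_le (h : HasWeakScaling α β c C ψ) {u v : ℝ} (hu : 0 < u) (hv : 1 ≤ v) :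
    ψ (v * u) ≤ C * v ^ β * ψ u :=
  h.upper v u hv hu

lemma ge_of_one_le (h : HasWeakScaling α β c C ψ) {u v : ℝ} (hu : 0 < u) (hv : 1 ≤ v) :
    c * v ^ α * ψ u ≤ ψ (v * u) :=
  h.lower v u hv hu

lemma le_of_le_one (h : HasWeakScaling α β c C ψ) {u v : ℝ} (hu : 0 < u) (hv0 : 0 < v)
    (hv : v ≤ 1) : ψ (v * u) ≤ c⁻¹ * v ^ α * ψ u := by
  have := h.lower v⁻¹ (v * u) ((one_le_inv₀ hv0).2 hv) (mul_pos hv0 hu)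
  rw [inv_mul_cancel_left₀ hv0.ne', Real.inv_rpow hv0.le] at this
  have hp := Real.rpow_pos_of_pos hv0 α
  have hc := h.c_pos
  calc ψ (v * u) = c⁻¹ * v ^ α * (c * (v ^ α)⁻¹ * ψ (v * u)) := by field_simp
    _ ≤ _ := by gcongr

/-- The ratio is at most `c⁻¹` for `v ≤ 1` and at most `C v^β ≤ C v²` for `v ≥ 1`. The quadratic
form is chosen because `|g|²` is Gaussian integrable. -/
lemma le_add_sq (h : HasWeakScaling α β c C ψ) {u v : ℝ} (hu : 0 < u) (hv : 0 ≤ v) :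
    ψ (v * u) ≤ (c⁻¹ + C * v ^ 2) * ψ u := by
  have hc := h.c_pos
  have hC := h.C_pos
  have := h.pos u hu
  rcases hv.eq_or_lt with rfl | hv
  · rw [zero_mul, h.zero]; positivity
  rcases le_total v 1 with h1 | h1
  · refine (h.le_of_le_one hu hv h1).trans ?_
    have : v ^ α ≤ 1 := Real.rpow_le_one hv.le h1 h.alpha_pos.le
    gcongr
    calc c⁻¹ * v ^ α ≤ c⁻¹ * 1 := by gcongr
      _ ≤ _ := by rw [mul_one]; linarith [show 0 ≤ C * v ^ 2 by positivity]
  · refine (h.le_of_one_le hu h1).trans ?_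
    have : v ^ β ≤ v ^ 2 := by
      rw [← Real.rpow_natCast]
      exact Real.rpow_le_rpow_of_exponent_le h1 (by simpa using h.beta_lt.le)
    gcongr
    calc C * v ^ β ≤ C * v ^ 2 := by gcongr
      _ ≤ _ := by linarith [show 0 < c⁻¹ by positivity]

/-- Rescaling the argument by a fixed factor changes `ψ` by at most a bounded factor. -/
lemma exists_mul_bounds (h : HasWeakScaling α β c C ψ) {v : ℝ} (hv : 0 < v) :
    ∃ K, 0 < K ∧ ∀ u, 0 < u → ψ (v * u) ≤ K * ψ u ∧ ψ u ≤ K * ψ (v * u) := by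
  have hc := h.c_pos
  have hC := h.C_pos
  refine ⟨(c⁻¹ + C * v ^ 2) + (c⁻¹ + C * v⁻¹ ^ 2), by positivity, fun u hu => ⟨?_, ?_⟩⟩
  · refine (h.le_add_sq hu hv.le).trans ?_
    have : 0 ≤ c⁻¹ + C * v⁻¹ ^ 2 := by positivity
    exact mul_le_mul_of_nonneg_right (by linarith) (h.pos u hu).le
  · have h1 := h.le_add_sq (mul_pos hv hu) (inv_pos.2 hv).le
    rw [inv_mul_cancel_left₀ hv.ne'] at h1
    refine h1.trans ?_
    have : 0 ≤ c⁻¹ + C * v ^ 2 := by positivity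
    exact mul_le_mul_of_nonneg_right (by linarith) (h.pos _ (mul_pos hv hu)).le

/-- A substitute for monotonicity of `ψ`, which is not available: lower scaling makes `ψ` increasing
up to a constant. -/
lemma le_of_le (h : HasWeakScaling α β c C ψ) {u v : ℝ} (hu : 0 ≤ u) (hv : 0 < v) (huv : u ≤ v) :
    ψ u ≤ c⁻¹ * ψ v := by
  have hc := h.c_pos
  have := h.pos v hv
  rcases hu.eq_or_lt with rfl | hu
  · rw [h.zero]; positivity
  have h1 := h.le_of_le_one (u := v) (v := u / v) hv (by positivity) ((div_le_one hv).2 huv)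
  rw [div_mul_cancel₀ _ hv.ne'] at h1
  refine h1.trans ?_
  have : (u / v) ^ α ≤ 1 :=
    Real.rpow_le_one (by positivity) ((div_le_one hv).2 huv) h.alpha_pos.le
  calc c⁻¹ * (u / v) ^ α * ψ v ≤ c⁻¹ * 1 * ψ v := by gcongr
    _ = _ := by ring

lemma continuous_comp_norm (h : HasWeakScaling α β c C ψ) {X E : Type*} [TopologicalSpace X]
    [NormedAddCommGroup E] {g : X → E} (hg : Continuous g) : Continuous fun x => ψ ‖g x‖ :=
  h.cont.comp_continuous (by fun_prop) fun _ => norm_nonneg _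

lemma tendsto_atTop (h : HasWeakScaling α β c C ψ) : Tendsto ψ atTop atTop := by
  have h1 : Tendsto (fun v : ℝ => c * v ^ α * ψ 1) atTop atTop :=
    ((tendsto_rpow_atTop h.alpha_pos).const_mul_atTop h.c_pos).atTop_mul_const (h.pos 1 one_pos)
  refine tendsto_atTop_mono' _ ?_ h1
  filter_upwards [eventually_ge_atTop 1] with v hv
  simpa using h.ge_of_one_le one_pos hv

lemma exists_eq (h : HasWeakScaling α β c C ψ) {y : ℝ} (hy : 0 < y) : ∃ u, 0 < u ∧ ψ u = y := by
  obtain ⟨b, hb, hb0⟩ :=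
    ((h.tendsto_atTop.eventually_ge_atTop y).and (eventually_ge_atTop 0)).exists
  obtain ⟨u, hu, rfl⟩ := intermediate_value_Icc hb0 (h.cont.mono Icc_subset_Ici_self)
    (show y ∈ Icc (ψ 0) (ψ b) from ⟨by rw [h.zero]; exact hy.le, hb⟩)
  refine ⟨u, hu.1.lt_of_ne fun h0 => ?_, rfl⟩
  rw [← h0, h.zero] at hy
  exact lt_irrefl _ hy

end HasWeakScaling

/-- If `ψ₂` is comparable with `ψ₁`, it inherits weak scaling. -/
lemma HasWeakScaling.of_comparable {α β c C K : ℝ} {ψ₁ ψ₂ : ℝ → ℝ}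
    (h : HasWeakScaling α β c C ψ₁) (hK : 0 < K) (hzero : ψ₂ 0 = 0)
    (hcont : ContinuousOn ψ₂ (Ici 0))
    (h1 : ∀ u, 0 < u → K⁻¹ * ψ₁ u ≤ ψ₂ u) (h2 : ∀ u, 0 < u → ψ₂ u ≤ K * ψ₁ u) :
    HasWeakScaling α β (K⁻¹ * c * K⁻¹) (K * C * K) ψ₂ where
  alpha_pos := h.alpha_pos
  beta_pos := h.beta_pos
  beta_lt := h.beta_lt
  c_pos := by have := h.c_pos; positivity
  C_pos := by have := h.C_pos; positivity
  zero := hzero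
  pos u hu := lt_of_lt_of_le (by have := h.pos u hu; positivity) (h1 u hu)
  lower l u hl hu := by
    have hlu : 0 < l * u := by positivity
    have hc := h.c_pos
    calc K⁻¹ * c * K⁻¹ * l ^ α * ψ₂ u ≤ K⁻¹ * c * K⁻¹ * l ^ α * (K * ψ₁ u) := by
          gcongr; exact h2 u hu
      _ = K⁻¹ * (c * l ^ α * ψ₁ u) := by field_simp
      _ ≤ K⁻¹ * ψ₁ (l * u) := by gcongr; exact h.ge_of_one_le hu hl
      _ ≤ _ := h1 _ hlu
  upper l u hl hu := by
    have hlu : 0 < l * u := by positivity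
    have hC := h.C_pos
    calc ψ₂ (l * u) ≤ K * ψ₁ (l * u) := h2 _ hlu
      _ ≤ K * (C * l ^ β * ψ₁ u) := by gcongr; exact h.le_of_one_le hu hl
      _ = K * C * K * l ^ β * (K⁻¹ * ψ₁ u) := by field_simp
      _ ≤ _ := by gcongr; exact h1 u hu
  cont := hcont

/-! ### Gaussian laws -/

section Gaussian

variable {d : ℕ}

/-- The Gaussian density of `heatMeasure d s` as a function of the distance to the origin. -/
noncomputable def heatKernel (d : ℕ) (s r : ℝ) : ℝ :=
  ((Real.pi / (1 / (4 * s))) ^ ((d : ℝ) / 2))⁻¹ * Real.exp (-(1 / (4 * s)) * r ^ 2)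

lemma heatKernel_nonneg {s : ℝ} (hs : 0 ≤ s) (r : ℝ) : 0 ≤ heatKernel d s r := by
  unfold heatKernel; positivity

lemma heatKernel_pos {s : ℝ} (hs : 0 < s) (r : ℝ) : 0 < heatKernel d s r := by
  unfold heatKernel; positivity

lemma heatKernel_le {s r r' : ℝ} (hs : 0 ≤ s) (hr : 0 ≤ r) (h : r ≤ r') :
    heatKernel d s r' ≤ heatKernel d s r := by
  unfold heatKernel
  have : r ^ 2 ≤ r' ^ 2 := by gcongr
  have h1 : 0 ≤ 1 / (4 * s) := by positivity
  gcongr _ * Real.exp ?_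
  nlinarith

lemma measurable_heatKernel : Measurable (fun z : ℝ × ℝ => heatKernel d z.1 z.2) := by
  unfold heatKernel; fun_prop

instance isProbabilityMeasure_heatMeasure (s : ℝ) : IsProbabilityMeasure (heatMeasure d s) :=
  Measure.isProbabilityMeasure_map (by fun_prop)

lemma charFun_heatMeasure {s : ℝ} (hs : 0 ≤ s) (ξ : EuclideanSpace ℝ (Fin d)) :
    charFun (heatMeasure d s) ξ = Complex.exp (-((s * ‖ξ‖ ^ 2 : ℝ) : ℂ)) := by
  rw [heatMeasure, charFun_map_smul, charFun_stdGaussian, norm_smul]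
  congr 1
  rw [← Complex.ofReal_pow, mul_pow, Real.norm_eq_abs, sq_abs, Real.sq_sqrt (by positivity)]
  push_cast
  ring

/-- The real square root vanishes on nonpositive arguments, so negative times degenerate to the
point mass. -/
lemma heatMeasure_of_nonpos {s : ℝ} (hs : s ≤ 0) :
    heatMeasure d s = Measure.dirac 0 := by
  have : √(2 * s) = 0 := Real.sqrt_eq_zero'.2 (by linarith)
  simp [heatMeasure, this, Measure.map_const]

lemma heatMeasure_eq_withDensity {s : ℝ} (hs : 0 < s) :
    heatMeasure d s = volume.withDensity (fun x => ENNReal.ofReal (heatKernel d s ‖x‖)) := by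
  have hb : 0 < 1 / (4 * s) := by positivity
  have hint : Integrable (fun x : EuclideanSpace ℝ (Fin d) => heatKernel d s ‖x‖) := by
    have := (GaussianFourier.integrable_cexp_neg_mul_sq_norm_add (V := EuclideanSpace ℝ (Fin d))
      (b := (1 / (4 * s) : ℝ)) (by simpa using hs) 0 0).norm
    simp only [zero_mul, add_zero, Complex.norm_exp] at this
    unfold heatKernel
    refine (this.congr (ae_of_all _ fun x => ?_)).const_mul _
    simp only [← Complex.ofReal_pow, ← Complex.ofReal_neg, ← Complex.ofReal_mul, Complex.ofReal_re]
  have hfin : IsFiniteMeasure ((volume : Measure (EuclideanSpace ℝ (Fin d))).withDensity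
      (fun x => ENNReal.ofReal (heatKernel d s ‖x‖))) :=
    isFiniteMeasure_withDensity_ofReal hint.2
  refine Measure.ext_of_charFun (funext fun ξ => ?_)
  rw [charFun_heatMeasure hs.le, charFun_apply,
    integral_withDensity_eq_integral_toReal_smul₀ hint.aemeasurable.ennreal_ofReal (by simp)]
  have hpi : (0 : ℝ) ≤ Real.pi / (1 / (4 * s)) := by positivity
  have key := GaussianFourier.integral_cexp_neg_mul_sq_norm_add (V := EuclideanSpace ℝ (Fin d))
      (b := (1 / (4 * s) : ℝ)) (by simpa using hs) Complex.I ξ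
  have h1 : (((Real.pi : ℂ) / ((1 / (4 * s) : ℝ) : ℂ)) ^
      ((Module.finrank ℝ (EuclideanSpace ℝ (Fin d)) : ℂ) / 2)) =
      (((Real.pi / (1 / (4 * s))) ^ ((d : ℝ) / 2) : ℝ) : ℂ) := by
    rw [Complex.ofReal_cpow hpi]
    simp
  rw [h1] at key
  have h2 : ((Real.pi / (1 / (4 * s))) ^ ((d : ℝ) / 2) : ℝ) ≠ 0 := by positivity
  calc Complex.exp (-((s * ‖ξ‖ ^ 2 : ℝ) : ℂ))
      = ((((Real.pi / (1 / (4 * s))) ^ ((d : ℝ) / 2))⁻¹ : ℝ) : ℂ) *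
        ∫ v : EuclideanSpace ℝ (Fin d), Complex.exp (-((1 / (4 * s) : ℝ) : ℂ) * ‖v‖ ^ 2 +
          Complex.I * ⟪ξ, v⟫) := by
        rw [key, ← mul_assoc, ← Complex.ofReal_mul, inv_mul_cancel₀ h2, Complex.ofReal_one,
          one_mul]
        congr 1
        rw [Complex.I_sq]
        push_cast
        have : (s : ℂ) ≠ 0 := by exact_mod_cast hs.ne'
        field_simp
    _ = _ := by
        rw [← integral_const_mul]
        refine integral_congr_ae (ae_of_all _ fun v => ?_)
        simp only [ENNReal.toReal_ofReal (heatKernel_nonneg hs.le _)]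
        simp only [heatKernel, Complex.real_smul, Complex.exp_add, real_inner_comm ξ v]
        push_cast
        ring_nf

lemma heatMeasure_half : heatMeasure d (1 / 2) = stdGaussian (EuclideanSpace ℝ (Fin d)) := by
  simp [heatMeasure]

instance isOpenPosMeasure_stdGaussian :
    (stdGaussian (EuclideanSpace ℝ (Fin d))).IsOpenPosMeasure := by
  rw [← heatMeasure_half, heatMeasure_eq_withDensity (by norm_num)]
  refine Measure.IsOpenPosMeasure.mk fun U hU hne h0 => ?_
  rw [withDensity_apply _ hU.measurableSet, lintegral_eq_zero_iff (by
    have := measurable_heatKernel (d := d); fun_prop)] at h0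
  have : ∀ᵐ x ∂(volume.restrict U : Measure (EuclideanSpace ℝ (Fin d))), False := by
    filter_upwards [h0] with x hx
    simp only [Pi.zero_apply, ENNReal.ofReal_eq_zero] at hx
    exact (heatKernel_pos (by norm_num) _).not_ge hx
  rw [ae_iff] at this
  simp only [not_false_eq_true, ofPred_true, Measure.restrict_apply_univ] at this
  exact hU.measure_ne_zero _ hne this

lemma integrable_norm_sq_stdGaussian :
    Integrable (fun x => ‖x‖ ^ 2) (stdGaussian (EuclideanSpace ℝ (Fin d))) :=
  (IsGaussian.memLp_two_id (μ := stdGaussian (EuclideanSpace ℝ (Fin d)))).integrable_norm_pow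
    (by norm_num)

lemma integral_cos_inner_stdGaussian (x : EuclideanSpace ℝ (Fin d)) :
    ∫ g, Real.cos ⟪g, x⟫ ∂(stdGaussian (EuclideanSpace ℝ (Fin d))) = Real.exp (-‖x‖ ^ 2 / 2) := by
  have h := congrArg Complex.re (charFun_stdGaussian x)
  rw [charFun_apply] at h
  have hint : Integrable (fun g : EuclideanSpace ℝ (Fin d) => Complex.exp (⟪g, x⟫ * Complex.I))
      (stdGaussian (EuclideanSpace ℝ (Fin d))) :=
    (integrable_const (1 : ℝ)).mono (by fun_prop)
      (ae_of_all _ fun g => by simp [Complex.norm_exp_ofReal_mul_I])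
  have h2 := integral_re hint
  simp only [RCLike.re_eq_complex_re, Complex.exp_ofReal_mul_I_re] at h2
  rw [h2, h, show (-(‖x‖ : ℂ) ^ 2 / 2) = ((-‖x‖ ^ 2 / 2 : ℝ) : ℂ) by push_cast; ring,
    Complex.exp_ofReal_re]

end Gaussian

/-! ### Measures with a radial symbol -/

section Symbol

variable {d : ℕ}

/-- `Ψ` is the radial symbol of `μ`: `∫ (1 - cos ⟪ξ, x⟫) μ(dx) = Ψ(‖ξ‖)`. -/
def HasSymbol (μ : Measure (EuclideanSpace ℝ (Fin d))) (Ψ : ℝ → ℝ) : Prop :=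
  ∀ ξ : EuclideanSpace ℝ (Fin d),
    ∫⁻ x, ENNReal.ofReal (1 - Real.cos ⟪ξ, x⟫) ∂μ = ENNReal.ofReal (Ψ ‖ξ‖)

lemma lintegral_one_sub_cos_stdGaussian (x : EuclideanSpace ℝ (Fin d)) :
    ∫⁻ g, ENNReal.ofReal (1 - Real.cos ⟪g, x⟫) ∂(stdGaussian (EuclideanSpace ℝ (Fin d))) =
      ENNReal.ofReal (1 - Real.exp (-‖x‖ ^ 2 / 2)) := by
  have hint : Integrable (fun g : EuclideanSpace ℝ (Fin d) => Real.cos ⟪g, x⟫)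
      (stdGaussian (EuclideanSpace ℝ (Fin d))) :=
    (integrable_const (1 : ℝ)).mono (by fun_prop)
      (ae_of_all _ fun g => by simpa using Real.abs_cos_le_one _)
  rw [← ofReal_integral_eq_lintegral_ofReal (f := fun g => 1 - Real.cos ⟪g, x⟫)
    ((integrable_const _).sub hint) (ae_of_all _ fun g => sub_nonneg.2 (Real.cos_le_one _)), integral_sub (integrable_const _) hint,
    integral_cos_inner_stdGaussian]
  simp

/-- Integrate the symbol at `ξ = g/r` over a standard Gaussian `g` and exchange the integrals: the
Gaussian characteristic function turns `1 - cos` into `1 - exp`. This converts information on the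
symbol into information on the mass of `μ` at scale `r`. -/
lemma HasSymbol.lintegral_one_sub_exp {μ : Measure (EuclideanSpace ℝ (Fin d))} [SFinite μ]
    {Ψ : ℝ → ℝ} (h : HasSymbol μ Ψ) {r : ℝ} (hr : 0 < r) :
    ∫⁻ x, ENNReal.ofReal (1 - Real.exp (-(‖x‖ / r) ^ 2 / 2)) ∂μ =
      ∫⁻ g, ENNReal.ofReal (Ψ (‖g‖ * (1 / r))) ∂(stdGaussian (EuclideanSpace ℝ (Fin d))) := by
  have h1 (x : EuclideanSpace ℝ (Fin d)) :
      ENNReal.ofReal (1 - Real.exp (-(‖x‖ / r) ^ 2 / 2)) =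
      ∫⁻ g, ENNReal.ofReal (1 - Real.cos ⟪(1 / r) • g, x⟫)
        ∂(stdGaussian (EuclideanSpace ℝ (Fin d))) := by
    have := lintegral_one_sub_cos_stdGaussian ((1 / r) • x)
    rw [norm_smul, Real.norm_of_nonneg (by positivity), one_div_mul_eq_div] at this
    rw [← this]
    simp_rw [real_inner_smul_left, real_inner_smul_right]
  simp_rw [h1]
  rw [lintegral_lintegral_swap (by fun_prop)]
  refine lintegral_congr fun g => ?_
  rw [h, norm_smul, Real.norm_of_nonneg (by positivity), mul_comm]

end Symbol

/-! ### Two-sided bounds for unimodal measures -/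

section Bounds

variable {d : ℕ} {α β c C : ℝ} {ψ : ℝ → ℝ}

/-- The quadratic growth bound `le_add_sq` is integrated against the Gaussian, whose second moment
is finite. The constant does not depend on `μ`. -/
lemma exists_lintegral_one_sub_exp_le (hψ : HasWeakScaling α β c C ψ) :
    ∃ A, 0 < A ∧ ∀ (μ : Measure (EuclideanSpace ℝ (Fin d))) [SFinite μ] (Ψ : ℝ → ℝ) (κ : ℝ),
      0 < κ → HasSymbol μ Ψ → (∀ u, 0 ≤ u → Ψ u ≤ κ * ψ u) → ∀ r, 0 < r →
      ∫⁻ x, ENNReal.ofReal (1 - Real.exp (-(‖x‖ / r) ^ 2 / 2)) ∂μ ≤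
        ENNReal.ofReal (A * (κ * ψ (1 / r))) := by
  set γ := stdGaussian (EuclideanSpace ℝ (Fin d))
  have hc := hψ.c_pos
  have hC := hψ.C_pos
  have hint : Integrable (fun g : EuclideanSpace ℝ (Fin d) => c⁻¹ + C * ‖g‖ ^ 2) γ :=
    (integrable_const _).add (integrable_norm_sq_stdGaussian.const_mul _)
  refine ⟨c⁻¹ + C * ∫ g, ‖g‖ ^ 2 ∂γ, by positivity, fun μ _ Ψ κ hκ h hle r hr => ?_⟩
  have hpos := hψ.pos (1 / r) (by positivity)
  rw [h.lintegral_one_sub_exp hr]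
  calc ∫⁻ g, ENNReal.ofReal (Ψ (‖g‖ * (1 / r))) ∂γ
      ≤ ∫⁻ g, ENNReal.ofReal ((c⁻¹ + C * ‖g‖ ^ 2) * (κ * ψ (1 / r))) ∂γ := by
        refine lintegral_mono fun g => ENNReal.ofReal_le_ofReal ?_
        refine (hle _ (by positivity)).trans ?_
        calc κ * ψ (‖g‖ * (1 / r)) ≤ κ * ((c⁻¹ + C * ‖g‖ ^ 2) * ψ (1 / r)) := by
              gcongr
              exact hψ.le_add_sq (by positivity) (norm_nonneg _)
          _ = _ := by ring
    _ = ENNReal.ofReal ((c⁻¹ + C * ∫ g, ‖g‖ ^ 2 ∂γ) * (κ * ψ (1 / r))) := by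
        rw [← ofReal_integral_eq_lintegral_ofReal (hint.mul_const _)
          (ae_of_all _ fun g => by positivity), integral_mul_const, integral_add
          (integrable_const _) (integrable_norm_sq_stdGaussian.const_mul _), integral_const_mul]
        simp [γ]

/-- Only Gaussian values with `1 < |g| < 2` are kept, so the lower bound on `Ψ` is needed only up to
`2/r`. This matters for `Ψ = 1 - exp(-tψ)`, which is bounded and cannot dominate a multiple of `tψ`
at high frequencies. -/
lemma exists_le_lintegral_one_sub_exp (hd : 1 ≤ d) (hψ : HasWeakScaling α β c C ψ)
    {b : ℝ} (hb : 0 < b) :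
    ∃ A, 0 < A ∧ ∀ (μ : Measure (EuclideanSpace ℝ (Fin d))) [SFinite μ] (Ψ : ℝ → ℝ) (κ : ℝ),
      0 < κ → HasSymbol μ Ψ → ∀ r, 0 < r → (∀ u, 0 < u → u ≤ 2 / r → b * κ * ψ u ≤ Ψ u) →
      ENNReal.ofReal (A * (κ * ψ (1 / r))) ≤
        ∫⁻ x, ENNReal.ofReal (1 - Real.exp (-(‖x‖ / r) ^ 2 / 2)) ∂μ := by
  have : Nonempty (Fin d) := ⟨⟨0, hd⟩⟩
  set γ := stdGaussian (EuclideanSpace ℝ (Fin d))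
  set S : Set (EuclideanSpace ℝ (Fin d)) := {g | 1 < ‖g‖ ∧ ‖g‖ < 2}
  have hSo : IsOpen S := (isOpen_lt continuous_const continuous_norm).inter
    (isOpen_lt continuous_norm continuous_const)
  have hS : 0 < γ S := by
    refine hSo.measure_pos γ ?_
    obtain ⟨x, hx⟩ := exists_norm_eq (EuclideanSpace ℝ (Fin d)) (show (0 : ℝ) ≤ 3 / 2 by norm_num)
    exact ⟨x, by rw [hx]; norm_num, by rw [hx]; norm_num⟩
  have hc := hψ.c_pos
  have hS' : 0 < γ.real S := ENNReal.toReal_pos hS.ne' (measure_ne_top _ _)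
  refine ⟨b * c * γ.real S, by positivity, fun μ _ Ψ κ hκ h r hr hle => ?_⟩
  have hpos := hψ.pos (1 / r) (by positivity)
  rw [h.lintegral_one_sub_exp hr]
  calc ENNReal.ofReal (b * c * γ.real S * (κ * ψ (1 / r)))
      = ∫⁻ g in S, ENNReal.ofReal (b * c * (κ * ψ (1 / r))) ∂γ := by
        rw [setLIntegral_const, ← ofReal_measureReal, ← ENNReal.ofReal_mul (by positivity)]
        ring_nf
    _ ≤ ∫⁻ g in S, ENNReal.ofReal (Ψ (‖g‖ * (1 / r))) ∂γ := by
        refine setLIntegral_mono' hSo.measurableSet fun g hg => ENNReal.ofReal_le_ofReal ?_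
        have hg0 : 0 < ‖g‖ := one_pos.trans hg.1
        refine le_trans ?_ (hle (‖g‖ * (1 / r)) (by positivity) ?_)
        · have h1 := hψ.ge_of_one_le (u := 1 / r) (by positivity) hg.1.le
          have h2 : 1 ≤ ‖g‖ ^ α := Real.one_le_rpow hg.1.le hψ.alpha_pos.le
          calc b * c * (κ * ψ (1 / r)) = b * κ * (c * 1 * ψ (1 / r)) := by ring
            _ ≤ b * κ * (c * ‖g‖ ^ α * ψ (1 / r)) := by gcongr
            _ ≤ _ := by gcongr
        · rw [mul_one_div]; gcongr; exact hg.2.le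
    _ ≤ _ := setLIntegral_le_lintegral _ _

/-- A Markov inequality: for `|x| ≥ r` the integrand is at least `1 - exp(-1/2) ≥ 1/3`. -/
lemma measure_norm_ge_le {μ : Measure (EuclideanSpace ℝ (Fin d))} {r : ℝ} (hr : 0 < r) :
    μ {x | r ≤ ‖x‖} ≤
      ENNReal.ofReal 3 * ∫⁻ x, ENNReal.ofReal (1 - Real.exp (-(‖x‖ / r) ^ 2 / 2)) ∂μ := by
  have hS : MeasurableSet {x : EuclideanSpace ℝ (Fin d) | r ≤ ‖x‖} :=
    measurableSet_le measurable_const measurable_norm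
  have he : Real.exp (-1 / 2) ≤ 2 / 3 := by
    rw [neg_div, Real.exp_neg]
    have := Real.add_one_le_exp (1 / 2 : ℝ)
    rw [inv_le_comm₀ (Real.exp_pos _) (by norm_num)]
    linarith
  rw [← lintegral_const_mul _ (by fun_prop), ← one_mul (μ _), ← setLIntegral_const]
  refine (setLIntegral_mono' hS fun x hx => ?_).trans (setLIntegral_le_lintegral _ _)
  rw [← ENNReal.ofReal_mul (by norm_num), ← ENNReal.ofReal_one]
  refine ENNReal.ofReal_le_ofReal ?_
  have h1 : 1 ≤ ‖x‖ / r := (one_le_div hr).2 hx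
  have h2 : Real.exp (-(‖x‖ / r) ^ 2 / 2) ≤ Real.exp (-1 / 2) := by
    gcongr; nlinarith
  linarith

end Bounds

/-! ### Pointwise density bounds from the symbol -/

section DensityBounds

variable {d : ℕ} {α β c C : ℝ} {ψ : ℝ → ℝ}

lemma IsRadialNonincreasingDensity.measure_eq {f : ℝ → ℝ}
    {μ : Measure (EuclideanSpace ℝ (Fin d))} (h : IsRadialNonincreasingDensity f μ)
    {S : Set (EuclideanSpace ℝ (Fin d))} (hS : MeasurableSet S) (h0 : S ⊆ {0}ᶜ) :
    μ S = ∫⁻ x in S, ENNReal.ofReal (f ‖x‖) := by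
  rw [← Measure.restrict_eq_self μ h0, h.2.2, withDensity_apply _ hS, Measure.restrict_restrict hS,
    inter_eq_left.2 h0]

lemma exists_mul_rpow_le {K ε s : ℝ} (hK : 0 < K) (hε : 0 < ε) (hs : 0 < s) :
    ∃ δ : ℝ, 0 < δ ∧ δ ≤ 1 ∧ K * δ ^ s ≤ ε := by
  have hp : 0 < (ε / K) ^ s⁻¹ := by positivity
  refine ⟨min 1 ((ε / K) ^ s⁻¹), lt_min one_pos hp, min_le_left _ _, ?_⟩
  calc K * (min 1 ((ε / K) ^ s⁻¹)) ^ s ≤ K * ((ε / K) ^ s⁻¹) ^ s := by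
        gcongr; exact min_le_right _ _
    _ = ε := by
        rw [← Real.rpow_mul (by positivity), inv_mul_cancel₀ hs.ne', Real.rpow_one]
        field_simp

lemma volume_real_ball (hd : 1 ≤ d) {r : ℝ} (hr : 0 ≤ r) :
    volume (Metric.ball (0 : EuclideanSpace ℝ (Fin d)) r) =
      ENNReal.ofReal (r ^ d * volume.real (Metric.ball (0 : EuclideanSpace ℝ (Fin d)) 1)) := by
  have : Nonempty (Fin d) := ⟨⟨0, hd⟩⟩
  rw [Measure.addHaar_ball _ _ hr, ENNReal.ofReal_mul (by positivity), ofReal_measureReal]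
  simp

/-- Near the origin `1 - exp(-s²/2)` is quadratic, so enlarging the scale from `r` to `r/δ` gains a
factor `δ²` on `|x| ≤ r`. This gain beats the loss `δ^(-β)` from scaling. -/
lemma one_sub_exp_le_mul {δ s : ℝ} (hs0 : 0 ≤ s) (hs : s ≤ 1) :
    1 - Real.exp (-(δ * s) ^ 2 / 2) ≤ 2 * δ ^ 2 * (1 - Real.exp (-s ^ 2 / 2)) := by
  have h1 := Real.add_one_le_exp (-(δ * s) ^ 2 / 2)
  have h2 : s ^ 2 / 4 ≤ 1 - Real.exp (-s ^ 2 / 2) := by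
    have h3 : Real.exp (-s ^ 2 / 2) ≤ (1 + s ^ 2 / 2)⁻¹ := by
      rw [neg_div, Real.exp_neg]
      have := Real.add_one_le_exp (s ^ 2 / 2)
      gcongr; linarith
    have h4 : (1 + s ^ 2 / 2)⁻¹ ≤ 1 - s ^ 2 / 4 := by
      rw [inv_le_iff_one_le_mul₀ (by positivity)]
      nlinarith [sq_nonneg s, mul_nonneg (sq_nonneg s) (show 0 ≤ 1 - s ^ 2 by nlinarith)]
    linarith
  nlinarith [mul_le_mul_of_nonneg_left h2 (sq_nonneg δ)]

/-- Upper bound for the density of a unimodal measure in terms of its symbol. -/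
lemma exists_density_le (hd : 1 ≤ d) (hψ : HasWeakScaling α β c C ψ) :
    ∃ K, 0 < K ∧ ∀ (μ : Measure (EuclideanSpace ℝ (Fin d))) [SFinite μ] (f Ψ : ℝ → ℝ) (κ : ℝ),
      0 < κ → IsRadialNonincreasingDensity f μ → HasSymbol μ Ψ → (∀ u, 0 ≤ u → Ψ u ≤ κ * ψ u) →
      ∀ r, 0 < r → f r ≤ K * (κ * ψ (1 / r) / r ^ d) := by
  have : Nonempty (Fin d) := ⟨⟨0, hd⟩⟩
  obtain ⟨A, hA, hL⟩ := exists_lintegral_one_sub_exp_le (d := d) hψ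
  obtain ⟨K, hK, hK2⟩ := hψ.exists_mul_bounds (v := 2) (by norm_num)
  set V := volume.real (Metric.ball (0 : EuclideanSpace ℝ (Fin d)) 1)
  have hV : 0 < V := ENNReal.toReal_pos (Metric.measure_ball_pos _ _ one_pos).ne'
    measure_ball_lt_top.ne
  refine ⟨6 * A * K / V, by positivity, fun μ _ f Ψ κ hκ hf hs hle r hr => ?_⟩
  -- On this annulus the density is at least `f r`, and the volume is at least half of that of the
  -- ball because `d ≥ 1`. Its mass is bounded by the tail beyond `r/2`.
  set S := Metric.ball (0 : EuclideanSpace ℝ (Fin d)) r \ Metric.ball 0 (r / 2)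
  have hSm : MeasurableSet S := measurableSet_ball.diff measurableSet_ball
  have hS (x) (hx : x ∈ S) : r / 2 ≤ ‖x‖ ∧ ‖x‖ < r := by
    simp only [S, Set.mem_sdiff, mem_ball_zero_iff, not_lt] at hx
    exact ⟨hx.2, hx.1⟩
  have hS0 : S ⊆ {0}ᶜ := fun x hx h0 => by
    rw [mem_singleton_iff] at h0
    have := (hS x hx).1
    rw [h0, norm_zero] at this
    linarith
  have hvol : ENNReal.ofReal (V * r ^ d / 2) ≤ volume S := by
    rw [measure_sdiff (Metric.ball_subset_ball (by linarith)) measurableSet_ball.nullMeasurableSet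
      measure_ball_lt_top.ne, volume_real_ball hd hr.le, volume_real_ball hd (by positivity),
      ← ENNReal.ofReal_sub _ (by positivity)]
    refine ENNReal.ofReal_le_ofReal ?_
    have h2 : (r / 2) ^ d ≤ r ^ d / 2 := by
      rw [div_pow]
      gcongr
      exact le_self_pow₀ (by norm_num) (by lia)
    nlinarith [mul_le_mul_of_nonneg_right h2 hV.le]
  have h1 : ENNReal.ofReal (f r * (V * r ^ d / 2)) ≤ ENNReal.ofReal (3 * (A * (κ * ψ (2 / r)))) :=
    calc ENNReal.ofReal (f r * (V * r ^ d / 2)) ≤ ENNReal.ofReal (f r) * volume S := by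
          rw [ENNReal.ofReal_mul (hf.1 r hr)]; gcongr
      _ = ∫⁻ x in S, ENNReal.ofReal (f r) := (setLIntegral_const _ _).symm
      _ ≤ ∫⁻ x in S, ENNReal.ofReal (f ‖x‖) := by
          refine setLIntegral_mono' hSm fun x hx => ENNReal.ofReal_le_ofReal ?_
          exact hf.2.1 (mem_Ioi.2 (by linarith [(hS x hx).1])) hr (hS x hx).2.le
      _ = μ S := (hf.measure_eq hSm hS0).symm
      _ ≤ μ {x | r / 2 ≤ ‖x‖} := measure_mono fun x hx => (hS x hx).1
      _ ≤ _ := by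
          refine (measure_norm_ge_le (by positivity)).trans ?_
          rw [ENNReal.ofReal_mul (by norm_num)]
          gcongr
          have := hL μ Ψ κ hκ hs hle (r / 2) (by positivity)
          rwa [one_div_div] at this
  have hpos := hψ.pos (2 / r) (by positivity)
  have hpos1 := hψ.pos (1 / r) (by positivity)
  rw [ENNReal.ofReal_le_ofReal_iff (by positivity)] at h1
  have h3 : ψ (2 / r) ≤ K * ψ (1 / r) := by
    have := (hK2 (1 / r) (by positivity)).1
    rwa [mul_one_div] at this
  calc f r = f r * (V * r ^ d / 2) * (2 / (V * r ^ d)) := by field_simp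
    _ ≤ 3 * (A * (κ * (K * ψ (1 / r)))) * (2 / (V * r ^ d)) := by
        refine mul_le_mul_of_nonneg_right (h1.trans ?_) (by positivity)
        gcongr
    _ = _ := by field_simp; ring

/-- Lower bound for the density of a unimodal measure in terms of its symbol. -/
lemma exists_le_density (hd : 1 ≤ d) (hψ : HasWeakScaling α β c C ψ) {b : ℝ} (hb : 0 < b) :
    ∃ K, 0 < K ∧ ∀ (μ : Measure (EuclideanSpace ℝ (Fin d))) [SFinite μ] (f Ψ : ℝ → ℝ) (κ : ℝ),
      0 < κ → IsRadialNonincreasingDensity f μ → HasSymbol μ Ψ → (∀ u, 0 ≤ u → Ψ u ≤ κ * ψ u) →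
      ∀ r, 0 < r → (∀ u, 0 < u → u ≤ 2 / r → b * κ * ψ u ≤ Ψ u) →
      K * (κ * ψ (1 / r) / r ^ d) ≤ f r := by
  have : Nonempty (Fin d) := ⟨⟨0, hd⟩⟩
  obtain ⟨A₁, hA₁, hL₁⟩ := exists_lintegral_one_sub_exp_le (d := d) hψ
  obtain ⟨A₀, hA₀, hL₀⟩ := exists_le_lintegral_one_sub_exp hd hψ hb
  have hc := hψ.c_pos
  have hC := hψ.C_pos
  set V := volume.real (Metric.ball (0 : EuclideanSpace ℝ (Fin d)) 1)
  have hV : 0 < V := ENNReal.toReal_pos (Metric.measure_ball_pos _ _ one_pos).ne'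
    measure_ball_lt_top.ne
  -- `δ` makes the part `|x| < r` at most a quarter of the total lower bound, using `β < 2`; `η`
  -- does the same for the tail beyond `R/η`, using `α > 0`. Half of the lower bound is left for the
  -- annulus in between.
  obtain ⟨δ, hδ0, hδ1, hδ⟩ := exists_mul_rpow_le (K := 2 * A₁ * C) (ε := A₀ / 4) (s := 2 - β)
    (by positivity) (by positivity) (by linarith [hψ.beta_lt])
  obtain ⟨η, hη0, hη1, hη⟩ := exists_mul_rpow_le (K := 3 * A₁ * c⁻¹) (ε := A₀ / 4) (s := α)
    (by positivity) (by positivity) hψ.alpha_pos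
  obtain ⟨K, hK, hK2⟩ := hψ.exists_mul_bounds (v := δ) hδ0
  refine ⟨A₀ / 2 * (δ * η) ^ d / (K * V), by positivity,
    fun μ _ f Ψ κ hκ hf hs hle r hr hge => ?_⟩
  set R := r / δ
  have hR : 0 < R := by positivity
  have hδR : δ * R = r := by simp only [R]; field_simp
  set S := Metric.ball (0 : EuclideanSpace ℝ (Fin d)) (R / η) \ Metric.ball 0 r
  have hSm : MeasurableSet S := measurableSet_ball.diff measurableSet_ball
  have hS (x) (hx : x ∈ S) : r ≤ ‖x‖ := by
    simp only [S, Set.mem_sdiff, mem_ball_zero_iff, not_lt] at hx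
    exact hx.2
  have hS0 : S ⊆ {0}ᶜ := fun x hx h0 => by
    rw [mem_singleton_iff] at h0
    have := hS x hx
    rw [h0, norm_zero] at this
    linarith
  set L := fun r => ∫⁻ x, ENNReal.ofReal (1 - Real.exp (-(‖x‖ / r) ^ 2 / 2)) ∂μ
  set T : Set (EuclideanSpace ℝ (Fin d)) := {x | R / η ≤ ‖x‖}
  have hT : MeasurableSet T := measurableSet_le measurable_const measurable_norm
  -- The smoothed mass at scale `R = r/δ` is split over `|x| < r`, the annulus `S` and the tail `T`.
  -- On `S` and `T` the integrand is simply bounded by `1`.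
  have hsplit : L R ≤ ENNReal.ofReal (2 * δ ^ 2) * L r + μ S + μ T := by
    simp only [L]
    rw [← lintegral_const_mul _ (by fun_prop), ← lintegral_indicator_one hSm,
      ← lintegral_add_left (by fun_prop), ← lintegral_indicator_one hT,
      ← lintegral_add_right _ (measurable_one.indicator hT)]
    refine lintegral_mono fun x => ?_
    rcases lt_or_ge ‖x‖ r with h1 | h1
    · refine le_trans ?_ (le_add_right (le_add_right le_rfl))
      rw [← ENNReal.ofReal_mul (by positivity)]
      refine ENNReal.ofReal_le_ofReal ?_
      have := one_sub_exp_le_mul (δ := δ) (s := ‖x‖ / r) (by positivity) ((div_le_one hr).2 h1.le)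
      convert this using 6
      simp only [R]
      field_simp
    · have hle1 : ENNReal.ofReal (1 - Real.exp (-(‖x‖ / R) ^ 2 / 2)) ≤ 1 := by
        rw [← ENNReal.ofReal_one]
        exact ENNReal.ofReal_le_ofReal (by linarith [Real.exp_pos (-(‖x‖ / R) ^ 2 / 2)])
      refine hle1.trans ?_
      rcases lt_or_ge ‖x‖ (R / η) with h2 | h2
      · have : x ∈ S := by simp [S, h1, h2]
        rw [indicator_of_mem this, Pi.one_apply]
        exact le_add_right (le_add_left le_rfl)
      · have : x ∈ T := h2
        rw [indicator_of_mem this, Pi.one_apply]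
        exact le_add_left le_rfl
  have hψR := hψ.pos (1 / R) (by positivity)
  have h1 : L r ≤ ENNReal.ofReal (A₁ * (κ * (C * δ⁻¹ ^ β * ψ (1 / R)))) := by
    refine (hL₁ μ Ψ κ hκ hs hle r hr).trans (ENNReal.ofReal_le_ofReal ?_)
    gcongr
    have := hψ.le_of_one_le (u := 1 / R) (by positivity) ((one_le_inv₀ hδ0).2 hδ1)
    rwa [show δ⁻¹ * (1 / R) = 1 / r by rw [← hδR]; field_simp] at this
  have h2 : μ T ≤ ENNReal.ofReal (3 * (A₁ * (κ * (c⁻¹ * η ^ α * ψ (1 / R))))) := by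
    refine (measure_norm_ge_le (by positivity)).trans ?_
    rw [ENNReal.ofReal_mul (by norm_num)]
    gcongr
    refine (hL₁ μ Ψ κ hκ hs hle (R / η) (by positivity)).trans (ENNReal.ofReal_le_ofReal ?_)
    gcongr
    have := hψ.le_of_le_one (u := 1 / R) (by positivity) hη0 hη1
    rwa [mul_one_div, ← one_div_div] at this
  -- The inner radius of `S` is `r`, so by monotonicity `f r` bounds the density on all of `S`.
  have h3 : μ S ≤ ENNReal.ofReal (f r * ((R / η) ^ d * V)) := by
    rw [hf.measure_eq hSm hS0, ENNReal.ofReal_mul (hf.1 r hr),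
      ← volume_real_ball hd (by positivity)]
    refine (setLIntegral_mono' (g := fun _ => ENNReal.ofReal (f r)) hSm fun x hx =>
      ENNReal.ofReal_le_ofReal (hf.2.1 hr (hr.trans_le (hS x hx)) (hS x hx))).trans ?_
    rw [setLIntegral_const]
    gcongr
    exact sdiff_subset
  have h4 : ENNReal.ofReal (A₀ * (κ * ψ (1 / R))) ≤ L R :=
    hL₀ μ Ψ κ hκ hs R hR fun u hu hu2 => hge u hu (hu2.trans (by
      gcongr; rw [← hδR]; exact mul_le_of_le_one_left hR.le hδ1))
  have hfr := hf.1 r hr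
  have h5 : A₀ * (κ * ψ (1 / R)) ≤ 2 * δ ^ 2 * (A₁ * (κ * (C * δ⁻¹ ^ β * ψ (1 / R)))) +
      f r * ((R / η) ^ d * V) + 3 * (A₁ * (κ * (c⁻¹ * η ^ α * ψ (1 / R)))) := by
    rw [← ENNReal.ofReal_le_ofReal_iff (by positivity), ENNReal.ofReal_add (by positivity)
      (by positivity), ENNReal.ofReal_add (by positivity) (by positivity),
      ENNReal.ofReal_mul (p := 2 * δ ^ 2) (by positivity)]
    refine h4.trans (hsplit.trans ?_)
    gcongr
  have h6 : δ ^ 2 * δ⁻¹ ^ β = δ ^ (2 - β) := by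
    rw [Real.rpow_sub hδ0, Real.inv_rpow hδ0.le, Real.rpow_two]; rfl
  have hκψ : 0 < κ * ψ (1 / R) := by positivity
  have h7 : A₀ / 2 * (κ * ψ (1 / R)) ≤ f r * ((R / η) ^ d * V) := by
    have e1 : 2 * δ ^ 2 * (A₁ * (κ * (C * δ⁻¹ ^ β * ψ (1 / R)))) =
        2 * A₁ * C * δ ^ (2 - β) * (κ * ψ (1 / R)) := by rw [← h6]; ring
    have e2 : 3 * (A₁ * (κ * (c⁻¹ * η ^ α * ψ (1 / R)))) =
        3 * A₁ * c⁻¹ * η ^ α * (κ * ψ (1 / R)) := by ring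
    rw [e1, e2] at h5
    nlinarith [mul_le_mul_of_nonneg_right hδ hκψ.le, mul_le_mul_of_nonneg_right hη hκψ.le]
  have h8 : ψ (1 / r) ≤ K * ψ (1 / R) := by
    have := (hK2 (1 / r) (by positivity)).2
    rwa [show δ * (1 / r) = 1 / R by simp only [R]; field_simp] at this
  calc A₀ / 2 * (δ * η) ^ d / (K * V) * (κ * ψ (1 / r) / r ^ d)
      ≤ A₀ / 2 * (δ * η) ^ d / (K * V) * (κ * (K * ψ (1 / R)) / r ^ d) := by gcongr
    _ = A₀ / 2 * (κ * ψ (1 / R)) * ((δ * η) ^ d / (V * r ^ d)) := by field_simp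
    _ ≤ f r * ((R / η) ^ d * V) * ((δ * η) ^ d / (V * r ^ d)) := by gcongr
    _ = f r := by
        have : (R / η) ^ d * (δ * η) ^ d = r ^ d := by
          rw [← mul_pow, ← hδR]; congr 1; field_simp
        calc f r * ((R / η) ^ d * V) * ((δ * η) ^ d / (V * r ^ d))
            = f r * ((R / η) ^ d * (δ * η) ^ d) * V / (V * r ^ d) := by ring
          _ = f r := by rw [this]; field_simp

end DensityBounds

/-! ### Radial monotone densities -/

section Radial

variable {d : ℕ}

lemma volume_restrict_compl_zero (hd : 1 ≤ d) :
    volume.restrict ({0}ᶜ : Set (EuclideanSpace ℝ (Fin d))) = volume := by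
  have : Nonempty (Fin d) := ⟨⟨0, hd⟩⟩
  exact Measure.restrict_eq_self_of_ae_mem (compl_mem_ae_iff.2 (by simp))

/-- Monotonicity is known on `(0, ∞)` only, so measurability is transported from the image of
Lebesgue measure under the norm; the origin is null because `d ≥ 1`. -/
lemma AntitoneOn.aemeasurable_comp_norm (hd : 1 ≤ d) {f : ℝ → ℝ} (hf : AntitoneOn f (Ioi 0)) :
    AEMeasurable (fun x : EuclideanSpace ℝ (Fin d) => f ‖x‖) := by
  have h1 : AEMeasurable f ((Measure.map norm
      (volume : Measure (EuclideanSpace ℝ (Fin d)))).restrict (Ioi 0)) :=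
    aemeasurable_restrict_of_antitoneOn measurableSet_Ioi hf
  rw [Measure.restrict_map measurable_norm measurableSet_Ioi] at h1
  have h2 : norm ⁻¹' Ioi 0 = ({0}ᶜ : Set (EuclideanSpace ℝ (Fin d))) := by
    ext x; simp
  have h3 := h1.comp_measurable measurable_norm
  rwa [h2, volume_restrict_compl_zero hd] at h3

/-- The positive continuity points of a function. -/
def continuityRadii (f : ℝ → ℝ) : Set ℝ := {r | 0 < r ∧ ContinuousAt f r}

lemma AntitoneOn.countable_compl_continuityRadii {f : ℝ → ℝ} (hf : AntitoneOn f (Ioi 0)) :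
    (Ioi 0 \ continuityRadii f).Countable := by
  refine hf.countable_not_continuousWithinAt.mono ?_
  exact fun r hr => ⟨hr.1, fun h => hr.2 ⟨hr.1, h.continuousAt (Ioi_mem_nhds hr.1)⟩⟩

/-- The exceptional set consists of countably many spheres and the origin, all null. -/
lemma AntitoneOn.ae_norm_mem_continuityRadii (hd : 1 ≤ d) {f : ℝ → ℝ}
    (hf : AntitoneOn f (Ioi 0)) :
    ∀ᵐ x : EuclideanSpace ℝ (Fin d), ‖x‖ ∈ continuityRadii f := by
  have : Nonempty (Fin d) := ⟨⟨0, hd⟩⟩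
  have h0 : volume ((⋃ r ∈ Ioi 0 \ continuityRadii f,
      Metric.sphere (0 : EuclideanSpace ℝ (Fin d)) r) ∪ {0}) = 0 :=
    measure_union_null ((measure_biUnion_null_iff hf.countable_compl_continuityRadii).2
      fun r _ => Measure.addHaar_sphere _ _ _) (by simp)
  refine measure_mono_null (fun x hx => ?_) h0
  rcases (norm_nonneg x).eq_or_lt with h | h
  · right; exact norm_eq_zero.1 h.symm
  · left; simp only [mem_iUnion]; exact ⟨‖x‖, ⟨h, hx⟩, by simp⟩

lemma AntitoneOn.mem_closure_continuityRadii {f : ℝ → ℝ} (hf : AntitoneOn f (Ioi 0)) {a : ℝ}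
    (ha : 0 ≤ a) : a ∈ closure (continuityRadii f) := by
  have h1 : Dense (Ioi 0 \ continuityRadii f)ᶜ := hf.countable_compl_continuityRadii.dense_compl ℝ
  have h2 := h1.open_subset_closure_inter (isOpen_Ioi (a := (0 : ℝ)))
  have h3 : a ∈ closure (Ioi (0 : ℝ)) := by rw [closure_Ioi]; exact ha
  refine closure_mono ?_ (closure_minimal h2 isClosed_closure h3)
  rintro r ⟨h4, h5⟩
  by_contra h6
  exact h5 ⟨h4, h6⟩

/-- A continuous function on `ℝ^d` which agrees with a radial nonincreasing function at its
continuity radii is itself radial and nonincreasing. -/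
lemma antitone_norm_of_eq_on_continuityRadii (hd : 1 ≤ d) {f : ℝ → ℝ} (hf : AntitoneOn f (Ioi 0))
    {G : EuclideanSpace ℝ (Fin d) → ℝ} (hG : Continuous G)
    (h : ∀ x, ‖x‖ ∈ continuityRadii f → G x = f ‖x‖) {x y : EuclideanSpace ℝ (Fin d)}
    (hxy : ‖x‖ ≤ ‖y‖) : G y ≤ G x := by
  have : Nonempty (Fin d) := ⟨⟨0, hd⟩⟩
  -- With `a < b`, continuity radii tending to `a` and `b` are eventually ordered, so monotonicity
  -- of `f` passes to the limit. Equal radii in different directions are handled below by moving `y`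
  -- slightly outwards, which also yields radiality.
  have key (u v : EuclideanSpace ℝ (Fin d)) (hu : ‖u‖ = 1) (hv : ‖v‖ = 1) (a b : ℝ)
      (ha : 0 ≤ a) (hab : a < b) : G (b • v) ≤ G (a • u) := by
    obtain ⟨s, hs, hsa⟩ := mem_closure_iff_seq_limit.1 (hf.mem_closure_continuityRadii ha)
    obtain ⟨s', hs', hsb⟩ :=
      mem_closure_iff_seq_limit.1 (hf.mem_closure_continuityRadii (ha.trans hab.le))
    have hnorm (w : EuclideanSpace ℝ (Fin d)) (hw : ‖w‖ = 1) (r : ℝ) (hr : 0 < r) :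
        ‖r • w‖ = r := by rw [norm_smul, hw, mul_one, Real.norm_of_nonneg hr.le]
    refine le_of_tendsto_of_tendsto ((hG.tendsto _).comp (hsb.smul_const v))
      ((hG.tendsto _).comp (hsa.smul_const u)) ?_
    filter_upwards [hsa.eventually_lt hsb hab] with n hn
    have h1 := hnorm v hv _ (hs' n).1
    have h2 := hnorm u hu _ (hs n).1
    simp only [Function.comp]
    rw [h _ (h1.symm ▸ hs' n), h _ (h2.symm ▸ hs n), h1, h2]
    exact hf (hs n).1 (hs' n).1 hn.le
  obtain ⟨e, he⟩ := exists_norm_eq (EuclideanSpace ℝ (Fin d)) zero_le_one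
  have hrep (w : EuclideanSpace ℝ (Fin d)) :
      ∃ u : EuclideanSpace ℝ (Fin d), ‖u‖ = 1 ∧ w = ‖w‖ • u := by
    by_cases hw : w = 0
    · exact ⟨e, he, by simp [hw]⟩
    · exact ⟨‖w‖⁻¹ • w, by simp [norm_smul, hw],
        by rw [smul_inv_smul₀ (norm_ne_zero_iff.2 hw)]⟩
  obtain ⟨u, hu, hxu⟩ := hrep x
  obtain ⟨v, hv, hyv⟩ := hrep y
  have hlim : Tendsto (fun n : ℕ => G ((‖y‖ + 1 / (n + 1 : ℝ)) • v)) atTop (𝓝 (G y)) := by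
    have h1 : Tendsto (fun n : ℕ => (‖y‖ + 1 / (n + 1 : ℝ)) • v) atTop (𝓝 ((‖y‖ + 0) • v)) :=
      (tendsto_one_div_add_atTop_nhds_zero_nat.const_add _).smul_const v
    rw [add_zero, ← hyv] at h1
    exact (hG.tendsto y).comp h1
  refine le_of_tendsto' hlim fun n => ?_
  rw [hxu]
  exact key u v hu hv _ _ (norm_nonneg _) (hxy.trans_lt (lt_add_of_pos_right _ (by positivity)))

/-- A unimodal law with integrable characteristic function vanishing at infinity has a continuous
radial nonincreasing density, bounded by the integral of its characteristic function. -/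
lemma exists_continuous_radial_density (hd : 1 ≤ d) {μ : Measure (EuclideanSpace ℝ (Fin d))}
    [IsProbabilityMeasure μ] (hμ : IsIsotropicUnimodal μ) (hint : Integrable (charFun μ))
    (hlim : Tendsto (charFun μ) (cocompact _) (𝓝 0)) :
    ∃ g : ℝ → ℝ, IsRadialNonincreasingDensity g μ ∧ AntitoneOn g (Ici 0) ∧ (∀ r, 0 ≤ r → 0 ≤ g r) ∧
      Continuous (fun x : EuclideanSpace ℝ (Fin d) => g ‖x‖) ∧
      μ = volume.withDensity (fun x => ENNReal.ofReal (g ‖x‖)) ∧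
      ∀ r, 0 ≤ r → g r ≤ ∫ ξ, ‖charFun μ ξ‖ := by
  have : Nonempty (Fin d) := ⟨⟨0, hd⟩⟩
  obtain ⟨f, hf⟩ := hμ
  have hmeas := hf.2.1.aemeasurable_comp_norm hd
  have hres := hf.2.2
  rw [volume_restrict_compl_zero hd] at hres
  have hF0 : ∀ᵐ x : EuclideanSpace ℝ (Fin d), 0 ≤ f ‖x‖ := by
    filter_upwards [hf.2.1.ae_norm_mem_continuityRadii hd] with x hx using hf.1 _ hx.1
  have hFint : Integrable (fun x : EuclideanSpace ℝ (Fin d) => f ‖x‖) := by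
    refine ⟨hmeas.aestronglyMeasurable, ?_⟩
    rw [hasFiniteIntegral_iff_ofReal hF0, ← setLIntegral_univ, ← withDensity_apply _ .univ, ← hres]
    exact measure_lt_top _ _
  set F : EuclideanSpace ℝ (Fin d) → ℂ := fun x => (f ‖x‖ : ℂ)
  have hFi : Integrable F := hFint.ofReal
  -- The possible atom at the origin contributes a constant; the rest is the Fourier transform of
  -- the density.
  have hchar (ξ : EuclideanSpace ℝ (Fin d)) :
      charFun μ ξ = μ.real {0} + ∫ x, Complex.exp (⟪x, ξ⟫ * Complex.I) * F x := by
    have hi : Integrable (fun x => Complex.exp (⟪x, ξ⟫ * Complex.I)) μ :=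
      (integrable_const (1 : ℝ)).mono (by fun_prop)
        (ae_of_all _ fun g => by simp [Complex.norm_exp_ofReal_mul_I])
    rw [charFun_apply, ← integral_add_compl (measurableSet_singleton 0) hi, hres,
      integral_withDensity_eq_integral_toReal_smul₀ hmeas.ennreal_ofReal (by simp),
      integral_singleton]
    simp only [inner_zero_left, Complex.ofReal_zero, zero_mul, Complex.exp_zero]
    congr 1
    · simp
    · refine integral_congr_ae ?_
      filter_upwards [hF0] with x hx
      rw [ENNReal.toReal_ofReal hx, Complex.real_smul, mul_comm]
  have hfour (w : EuclideanSpace ℝ (Fin d)) :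
      charFun μ ((-(2 * Real.pi)) • w) = μ.real {0} + FourierTransform.fourier F w := by
    rw [hchar, Real.fourier_eq']
    congr 2
    ext x
    rw [smul_eq_mul, real_inner_smul_right]
    congr 4
    ring
  have hpi : -(2 * Real.pi) ≠ 0 := neg_ne_zero.2 (by positivity)
  -- At infinity the Fourier transform vanishes by Riemann–Lebesgue and the characteristic function
  -- by hypothesis, so the constant between them is zero.
  have hatom : μ.real {0} = 0 := by
    have h1 : Tendsto (fun w => charFun μ ((-(2 * Real.pi)) • w)) (cocompact _) (𝓝 0) :=
      hlim.comp ((Homeomorph.smulOfNeZero _ hpi).isClosedEmbedding.tendsto_cocompact)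
    have h2 := (tendsto_integral_exp_inner_smul_cocompact F).const_add (μ.real {0} : ℂ)
    simp_rw [hfour] at h1
    have := tendsto_nhds_unique h1 h2
    simpa using this.symm
  have hfour' : FourierTransform.fourier F = fun w => charFun μ ((-(2 * Real.pi)) • w) := by
    ext w; rw [hfour, hatom]; simp
  have hFFi : Integrable (FourierTransform.fourier F) := by
    rw [hfour']; exact (integrable_comp_smul_iff volume (charFun μ) hpi).2 hint
  -- Fourier inversion gives a continuous function equal to the density wherever the latter is
  -- continuous. It inherits radial monotonicity from there.
  set G : EuclideanSpace ℝ (Fin d) → ℝ :=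
    fun x => (FourierTransformInv.fourierInv (FourierTransform.fourier F) x).re
  have hGc : Continuous G := by
    refine Complex.continuous_re.comp ?_
    have h1 : Continuous (FourierTransform.fourier (FourierTransform.fourier F)) :=
      VectorFourier.fourierIntegral_continuous Real.continuous_fourierChar
        (by exact continuous_inner) hFFi
    refine (h1.comp continuous_neg).congr fun x => ?_
    rw [Real.fourierInv_eq_fourier_neg]; rfl
  have hGf (x) (hx : ‖x‖ ∈ continuityRadii f) : G x = f ‖x‖ := by
    have hc : ContinuousAt F x :=
      Complex.continuous_ofReal.continuousAt.comp
        (ContinuousAt.comp (g := f) hx.2 continuous_norm.continuousAt)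
    simp only [G]
    rw [hFi.fourierInv_fourier_eq hFFi hc, Complex.ofReal_re]
  have hGanti {x y : EuclideanSpace ℝ (Fin d)} (hxy : ‖x‖ ≤ ‖y‖) : G y ≤ G x :=
    antitone_norm_of_eq_on_continuityRadii hd hf.2.1 hGc hGf hxy
  obtain ⟨e, he⟩ := exists_norm_eq (EuclideanSpace ℝ (Fin d)) zero_le_one
  have hnorm {r : ℝ} (hr : 0 ≤ r) : ‖r • e‖ = r := by
    rw [norm_smul, he, mul_one, Real.norm_of_nonneg hr]
  have hgG (x : EuclideanSpace ℝ (Fin d)) : G (‖x‖ • e) = G x :=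
    le_antisymm (hGanti (hnorm (norm_nonneg x)).ge) (hGanti (hnorm (norm_nonneg x)).le)
  have hanti : AntitoneOn (fun r : ℝ => G (r • e)) (Ici 0) := fun a ha b hb hab =>
    hGanti (by rwa [hnorm ha, hnorm hb])
  have hGae : (fun x => f ‖x‖) =ᵐ[volume] G := by
    filter_upwards [hf.2.1.ae_norm_mem_continuityRadii hd] with x hx using (hGf x hx).symm
  have hG0 (x) : 0 ≤ G x := by
    have hd : Dense {x | 0 ≤ G x} := by
      refine Measure.dense_of_ae (μ := volume) ?_
      filter_upwards [hGae, hF0] with x h1 h2 using h1 ▸ h2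
    have hc : IsClosed {x | 0 ≤ G x} := isClosed_le continuous_const hGc
    have := hd.closure_eq
    rw [hc.closure_eq] at this
    exact this.ge (mem_univ x)
  have hμG : μ = volume.withDensity (fun x => ENNReal.ofReal (G x)) := by
    have h1 : μ.restrict {0}ᶜ = μ := Measure.restrict_eq_self_of_ae_mem
      (compl_mem_ae_iff.2 ((measureReal_eq_zero_iff).1 hatom))
    rw [← h1, hres]
    refine withDensity_congr_ae ?_
    filter_upwards [hGae] with x hx
    rw [hx]
  refine ⟨fun r : ℝ => G (r • e), ⟨fun r hr => hG0 _, hanti.mono Ioi_subset_Ici_self, ?_⟩, hanti,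
    fun r hr => hG0 _, ?_, ?_, fun r hr => ?_⟩
  · simp only [hgG]
    conv_lhs => rw [hμG, restrict_withDensity (measurableSet_singleton 0).compl]
  · simpa only [hgG] using hGc
  · simpa only [hgG] using hμG
  · calc G (r • e) ≤ ‖FourierTransformInv.fourierInv (FourierTransform.fourier F) (r • e)‖ :=
        Complex.re_le_norm _
      _ ≤ ∫ w, ‖FourierTransform.fourier F w‖ := by
        rw [Real.fourierInv_eq]
        refine (norm_integral_le_integral_norm _).trans (le_of_eq ?_)
        simp
      _ = |((-(2 * Real.pi)) ^ d)⁻¹| * ∫ ξ, ‖charFun μ ξ‖ := by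
        rw [hfour', Measure.integral_comp_smul volume (fun ξ => ‖charFun μ ξ‖)]
        simp
      -- The Jacobian `(2π)^(-d)` is at most `1`; the sharp constant is not needed.
      _ ≤ 1 * ∫ ξ, ‖charFun μ ξ‖ := by
        have : 0 ≤ ∫ ξ, ‖charFun μ ξ‖ := integral_nonneg fun _ => norm_nonneg _
        gcongr
        rw [abs_inv, abs_pow, abs_neg, abs_of_pos (by positivity)]
        exact inv_le_one_of_one_le₀ (one_le_pow₀ (by linarith [Real.pi_gt_three]))
      _ = _ := one_mul _

end Radial

/-! ### Transition densities -/

section Transition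

variable {d : ℕ} {α β c C : ℝ} {ψ : ℝ → ℝ}

lemma lintegral_one_sub_cos_of_charFun {E : Type*} [NormedAddCommGroup E] [InnerProductSpace ℝ E]
    [MeasurableSpace E] [BorelSpace E] [SecondCountableTopology E]
    {μ : Measure E} [IsProbabilityMeasure μ] {ξ : E} {a : ℝ} (h : charFun μ ξ = a) :
    ∫⁻ x, ENNReal.ofReal (1 - Real.cos ⟪ξ, x⟫) ∂μ = ENNReal.ofReal (1 - a) := by
  have hint : Integrable (fun x => Complex.exp (⟪x, ξ⟫ * Complex.I)) μ :=
    (integrable_const (1 : ℝ)).mono (by fun_prop)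
      (ae_of_all _ fun g => by simp [Complex.norm_exp_ofReal_mul_I])
  have h1 := integral_re hint
  rw [← charFun_apply, h] at h1
  simp only [RCLike.re_eq_complex_re, Complex.exp_ofReal_mul_I_re, Complex.ofReal_re,
    real_inner_comm ξ] at h1
  have hint2 : Integrable (fun x => Real.cos ⟪ξ, x⟫) μ :=
    (integrable_const (1 : ℝ)).mono (by fun_prop)
      (ae_of_all _ fun g => by simpa using Real.abs_cos_le_one _)
  rw [← ofReal_integral_eq_lintegral_ofReal (f := fun x => 1 - Real.cos ⟪ξ, x⟫)
    ((integrable_const _).sub hint2) (ae_of_all _ fun g => sub_nonneg.2 (Real.cos_le_one _)),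
    integral_sub (integrable_const _) hint2, h1]
  simp

lemma IsCharExponent.hasSymbol {p : ℝ≥0 → Measure (EuclideanSpace ℝ (Fin d))}
    (hp : IsConvolutionSemigroup p) (hψ : IsCharExponent p (fun ξ => ψ ‖ξ‖)) (t : ℝ≥0) :
    HasSymbol (p t) (fun u => 1 - Real.exp (-(t * ψ u))) := fun ξ => by
  have := hp.prob t
  refine lintegral_one_sub_cos_of_charFun ?_
  rw [hψ t ξ]
  push_cast
  rfl

lemma integrable_exp_neg_mul_norm_rpow (hd : 1 ≤ d) {a s : ℝ} (ha : 0 < a) (hs : 0 < s) :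
    Integrable (fun x : EuclideanSpace ℝ (Fin d) => Real.exp (-a * ‖x‖ ^ s)) := by
  have : Nonempty (Fin d) := ⟨⟨0, hd⟩⟩
  rw [integrable_fun_norm_addHaar volume (f := fun y : ℝ => Real.exp (-a * y ^ s))]
  have := integrableOn_rpow_mul_exp_neg_mul_rpow (s := (d - 1 : ℕ)) (p := s) (b := a)
    (by linarith [Nat.cast_nonneg (α := ℝ) (d - 1)]) hs ha
  refine this.congr_fun (fun y hy => ?_) measurableSet_Ioi
  simp

/-- `∫ exp (-t ψ(|ξ|)) dξ` is at most of order `h ^ d` if `t ψ(h)` is bounded below. -/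
lemma exists_integral_exp_neg_le (hd : 1 ≤ d) (hψ : HasWeakScaling α β c C ψ) {b : ℝ}
    (hb : 0 < b) :
    ∃ A, 0 < A ∧ ∀ t h : ℝ, 0 < t → 0 < h → b ≤ t * ψ h →
      Integrable (fun ξ : EuclideanSpace ℝ (Fin d) => Real.exp (-(t * ψ ‖ξ‖))) ∧
      ∫ ξ : EuclideanSpace ℝ (Fin d), Real.exp (-(t * ψ ‖ξ‖)) ≤ A * h ^ d := by
  have hc := hψ.c_pos
  set a := c * b
  have ha : 0 < a := by positivity
  set J := fun x : EuclideanSpace ℝ (Fin d) => Real.exp (-a * ‖x‖ ^ α)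
  have hJ : Integrable J := integrable_exp_neg_mul_norm_rpow hd ha hψ.alpha_pos
  have hJpos : 0 < ∫ x, J x := integral_exp_pos hJ
  refine ⟨Real.exp a * ∫ x, J x, by positivity, fun t h ht hh hth => ?_⟩
  have hle (ξ : EuclideanSpace ℝ (Fin d)) :
      Real.exp (-(t * ψ ‖ξ‖)) ≤ Real.exp a * J (h⁻¹ • ξ) := by
    simp only [J]
    rw [← Real.exp_add, norm_smul, Real.norm_of_nonneg (by positivity), Real.exp_le_exp,
      inv_mul_eq_div]
    -- Below `h` the factor `exp a` makes the right side at least `1`; above `h` lower scaling gives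
    -- `tψ(|ξ|) ≥ a(|ξ|/h)^α`.
    rcases le_total ‖ξ‖ h with h1 | h1
    · have h2 : (‖ξ‖ / h) ^ α ≤ 1 :=
        Real.rpow_le_one (by positivity) ((div_le_one hh).2 h1) hψ.alpha_pos.le
      have h3 : 0 ≤ t * ψ ‖ξ‖ := mul_nonneg ht.le (hψ.nonneg (norm_nonneg _))
      nlinarith
    · have h2 := hψ.ge_of_one_le hh ((one_le_div hh).2 h1)
      rw [div_mul_cancel₀ _ hh.ne'] at h2
      have h3 : a * (‖ξ‖ / h) ^ α ≤ t * ψ ‖ξ‖ :=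
        calc a * (‖ξ‖ / h) ^ α = c * (‖ξ‖ / h) ^ α * b := by ring
          _ ≤ c * (‖ξ‖ / h) ^ α * (t * ψ h) := by gcongr
          _ = t * (c * (‖ξ‖ / h) ^ α * ψ h) := by ring
          _ ≤ _ := by gcongr
      linarith
  have hcont : Continuous (fun ξ : EuclideanSpace ℝ (Fin d) => Real.exp (-(t * ψ ‖ξ‖))) := by
    have := hψ.continuous_comp_norm (g := (id : EuclideanSpace ℝ (Fin d) → _)) continuous_id
    exact Real.continuous_exp.comp (continuous_const.mul this).neg
  have hJ2 : Integrable (fun ξ : EuclideanSpace ℝ (Fin d) => Real.exp a * J (h⁻¹ • ξ)) :=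
    ((integrable_comp_smul_iff volume J (inv_pos.2 hh).ne').2 hJ).const_mul _
  have hint : Integrable (fun ξ : EuclideanSpace ℝ (Fin d) => Real.exp (-(t * ψ ‖ξ‖))) :=
    hJ2.mono' hcont.aestronglyMeasurable (ae_of_all _ fun ξ => by
      rw [Real.norm_of_nonneg (Real.exp_pos _).le]; exact hle ξ)
  refine ⟨hint, (integral_mono hint hJ2 hle).trans (le_of_eq ?_)⟩
  rw [integral_const_mul, Measure.integral_comp_smul volume J]
  simp only [finrank_euclideanSpace, Fintype.card_fin, smul_eq_mul, inv_pow, inv_inv]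
  rw [abs_of_pos (by positivity)]
  ring

/-- From `1 - exp(-s) ≥ s exp(-s)`. It makes the symbol `1 - exp(-tψ)` of `p_t` comparable with `tψ`
as long as `tψ` stays bounded. -/
lemma mul_exp_neg_le_one_sub_exp_neg {s B : ℝ} (hs : 0 ≤ s) (hB : s ≤ B) :
    Real.exp (-B) * s ≤ 1 - Real.exp (-s) := by
  have h1 : Real.exp (-B) ≤ Real.exp (-s) := by gcongr
  have h2 := Real.add_one_le_exp s
  have h3 : Real.exp s * Real.exp (-s) = 1 := by rw [← Real.exp_add]; simp
  nlinarith [Real.exp_pos (-s), mul_le_mul_of_nonneg_right h1 hs]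

/-- Sharp two-sided bounds for the transition density of a unimodal Lévy process whose
characteristic exponent has global weak scaling: `p_t(x)` is comparable with `h ^ d` for
`|x| ≤ 1 / h`, and with `t ψ(1 / |x|) / |x| ^ d` for `|x| ≥ 1 / h`, where `t ψ(h) ≈ 1`. -/
theorem exists_transition_density_bounds (hd : 1 ≤ d) (hψ : HasWeakScaling α β c C ψ) {B : ℝ}
    (hB : 0 < B) :
    ∃ K, 0 < K ∧ ∀ p : ℝ≥0 → Measure (EuclideanSpace ℝ (Fin d)),
      IsConvolutionSemigroup p → (∀ t, IsIsotropicUnimodal (p t)) →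
      IsCharExponent p (fun ξ => ψ ‖ξ‖) →
      ∃ k : ℝ≥0 → EuclideanSpace ℝ (Fin d) → ℝ, IsContinuousTransitionDensity p k ∧
        ∀ (t : ℝ≥0) (h : ℝ), 0 < t → 0 < h → B⁻¹ ≤ t * ψ h → t * ψ h ≤ B →
          (∀ x, k t x ≤ K * h ^ d) ∧
          (∀ x, x ≠ 0 → k t x ≤ K * (t * ψ (1 / ‖x‖) / ‖x‖ ^ d)) ∧
          (∀ x, ‖x‖ ≤ 1 / h → h ^ d ≤ K * k t x) ∧
          (∀ x, 1 / h ≤ ‖x‖ → t * ψ (1 / ‖x‖) / ‖x‖ ^ d ≤ K * k t x) := by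
  have hc := hψ.c_pos
  obtain ⟨A, hA, hAint⟩ := exists_integral_exp_neg_le hd hψ (inv_pos.2 hB)
  obtain ⟨K₁, hK₁, hup⟩ := exists_density_le hd hψ
  obtain ⟨K₂, hK₂, hK₂'⟩ := hψ.exists_mul_bounds (v := 2) two_pos
  -- The exponent bounds `tψ(u)` for all `u ≤ 2h`: almost monotonicity costs `c⁻¹` and doubling the
  -- argument costs `K₂`.
  set b := Real.exp (-(c⁻¹ * (K₂ * B)))
  obtain ⟨K₃, hK₃, hlow⟩ := exists_le_density hd hψ (b := b) (Real.exp_pos _)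
  refine ⟨A + K₁ + K₃⁻¹ + K₃⁻¹ * B, by positivity, fun p hp huni hchar => ?_⟩
  have hcharFun (t : ℝ≥0) (ξ) : ‖charFun (p t) ξ‖ = Real.exp (-(t * ψ ‖ξ‖)) := by
    rw [hchar t ξ, ← Complex.ofReal_neg, Complex.norm_exp_ofReal]
  have hex (t : ℝ≥0) (ht : 0 < t) : ∃ g : ℝ → ℝ, IsRadialNonincreasingDensity g (p t) ∧
      AntitoneOn g (Ici 0) ∧ (∀ r, 0 ≤ r → 0 ≤ g r) ∧
      Continuous (fun x : EuclideanSpace ℝ (Fin d) => g ‖x‖) ∧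
      p t = volume.withDensity (fun x => ENNReal.ofReal (g ‖x‖)) ∧
      ∀ r, 0 ≤ r → g r ≤ ∫ ξ, ‖charFun (p t) ξ‖ := by
    have := hp.prob t
    have ht' : (0 : ℝ) < t := ht
    obtain ⟨h, hh, hth⟩ := hψ.exists_eq (inv_pos.2 ht')
    obtain ⟨A₂, -, hA₂⟩ := exists_integral_exp_neg_le hd hψ one_pos
    have hi := (hA₂ t h ht' hh (by rw [hth, mul_inv_cancel₀ ht'.ne'])).1
    have hi' : Integrable (charFun (p t)) := by
      rw [← integrable_norm_iff (measurable_charFun).aestronglyMeasurable]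
      simpa only [hcharFun] using hi
    refine exists_continuous_radial_density hd (huni t) hi' ?_
    rw [tendsto_zero_iff_norm_tendsto_zero]
    simp_rw [hcharFun]
    refine Real.tendsto_exp_atBot.comp (tendsto_neg_atTop_atBot.comp ?_)
    exact (hψ.tendsto_atTop.comp (tendsto_norm_cocompact_atTop)).const_mul_atTop ht'
  choose! g hg hanti hg0 hgc hgp hgle using hex
  refine ⟨fun t x => g t ‖x‖, fun t ht => ⟨hgc t ht, fun x => hg0 t ht _ (norm_nonneg _),
    hgp t ht⟩, fun t h ht hh hth1 hth2 => ?_⟩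
  have ht' : (0 : ℝ) < t := ht
  have := hp.prob t
  have hsym := hchar.hasSymbol hp t
  have hle (u : ℝ) (_ : 0 ≤ u) : 1 - Real.exp (-(t * ψ u)) ≤ t * ψ u := by
    linarith [Real.add_one_le_exp (-(t * ψ u))]
  -- For `r ≥ 1/h` the relevant frequencies `u ≤ 2/r` are at most `2h`, where `1 - exp(-tψ) ≥ b tψ`.
  have hlo (r : ℝ) (hr : 1 / h ≤ r) : K₃ * (t * ψ (1 / r) / r ^ d) ≤ g t r := by
    have hr0 : 0 < r := lt_of_lt_of_le (by positivity) hr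
    refine hlow (p t) (g t) _ t ht' (hg t ht) hsym hle r hr0 fun u hu hur => ?_
    have hu2 : u ≤ 2 * h := by
      refine hur.trans ?_
      rw [div_le_iff₀ hr0]
      rw [div_le_iff₀ hh] at hr
      linarith
    have h1 : t * ψ u ≤ c⁻¹ * (K₂ * B) :=
      calc t * ψ u ≤ t * (c⁻¹ * (K₂ * ψ h)) := by
            gcongr
            refine (hψ.le_of_le hu.le (by positivity) hu2).trans ?_
            gcongr
            exact (hK₂' h hh).1
        _ = c⁻¹ * (K₂ * (t * ψ h)) := by ring
        _ ≤ _ := by gcongr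
    have := mul_exp_neg_le_one_sub_exp_neg (mul_nonneg ht'.le (hψ.nonneg hu.le)) h1
    rwa [mul_assoc]
  have hψh := hψ.pos h hh
  have hgpos (x : EuclideanSpace ℝ (Fin d)) := hg0 t ht _ (norm_nonneg x)
  refine ⟨fun x => ?_, fun x hx => ?_, fun x hx => ?_, fun x hx => ?_⟩
  · refine (hgle t ht _ (norm_nonneg x)).trans ?_
    simp_rw [hcharFun]
    refine (hAint t h ht' hh hth1).2.trans ?_
    gcongr
    have : 0 < K₁ + K₃⁻¹ + K₃⁻¹ * B := by positivity
    linarith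
  · have hx' := norm_pos_iff.2 hx
    refine (hup (p t) (g t) _ t ht' (hg t ht) hsym hle ‖x‖ hx').trans ?_
    have := hψ.pos (1 / ‖x‖) (by positivity)
    gcongr
    have : 0 < A + K₃⁻¹ + K₃⁻¹ * B := by positivity
    linarith
  -- Inside the ball the density is at least its value at radius `1/h`, where the lower bound reads
  -- `tψ(h) h^d` and `tψ(h) ≥ B⁻¹`.
  · have h1 := hlo (1 / h) le_rfl
    have h2 := hanti t ht (norm_nonneg x) (show (0 : ℝ) ≤ 1 / h by positivity) hx
    rw [one_div_one_div, one_div, inv_pow, div_inv_eq_mul] at h1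
    calc h ^ d = K₃⁻¹ * B * (K₃ * (B⁻¹ * h ^ d)) := by field_simp
      _ ≤ K₃⁻¹ * B * (K₃ * (t * ψ h * h ^ d)) := by gcongr
      _ ≤ K₃⁻¹ * B * g t ‖x‖ := by gcongr; rw [one_div] at h2; exact h1.trans h2
      _ ≤ _ := by
        refine mul_le_mul_of_nonneg_right ?_ (hgpos x)
        have : 0 < A + K₁ + K₃⁻¹ := by positivity
        linarith
  · calc t * ψ (1 / ‖x‖) / ‖x‖ ^ d = K₃⁻¹ * (K₃ * (t * ψ (1 / ‖x‖) / ‖x‖ ^ d)) := by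
          field_simp
      _ ≤ K₃⁻¹ * g t ‖x‖ := by gcongr; exact hlo _ hx
      _ ≤ _ := by
        refine mul_le_mul_of_nonneg_right ?_ (hgpos x)
        have : 0 < A + K₁ + K₃⁻¹ * B := by positivity
        linarith

end Transition

/-! ### Uniqueness of the Lévy measure -/

section Uniqueness

variable {d : ℕ} {α β c C : ℝ} {ψ : ℝ → ℝ}

lemma integral_cos_inner_add_stdGaussian (ξ x : EuclideanSpace ℝ (Fin d)) :
    ∫ g, Real.cos ⟪ξ + g, x⟫ ∂(stdGaussian (EuclideanSpace ℝ (Fin d))) =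
      Real.cos ⟪ξ, x⟫ * Real.exp (-‖x‖ ^ 2 / 2) := by
  have hint (y : EuclideanSpace ℝ (Fin d)) :
      Integrable (fun g : EuclideanSpace ℝ (Fin d) => Complex.exp (⟪y + g, x⟫ * Complex.I))
      (stdGaussian (EuclideanSpace ℝ (Fin d))) :=
    (integrable_const (1 : ℝ)).mono (by fun_prop)
      (ae_of_all _ fun g => by simp [Complex.norm_exp_ofReal_mul_I])
  have h2 := integral_re (hint ξ)
  simp only [RCLike.re_eq_complex_re, Complex.exp_ofReal_mul_I_re] at h2
  have h3 : ∫ g, Complex.exp (⟪ξ + g, x⟫ * Complex.I) ∂(stdGaussian (EuclideanSpace ℝ (Fin d))) =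
      Complex.exp (⟪ξ, x⟫ * Complex.I) * ((Real.exp (-‖x‖ ^ 2 / 2) : ℝ) : ℂ) := by
    simp_rw [inner_add_left, Complex.ofReal_add, add_mul, Complex.exp_add]
    rw [integral_const_mul, ← charFun_apply, charFun_stdGaussian]
    push_cast
    rfl
  rw [h2, h3, Complex.re_mul_ofReal, Complex.exp_ofReal_mul_I_re]

/-- Pointwise form of a second difference: it expresses the symbol of the measure with weight `1 -
exp(-|x|²/2)` through `ψ` and its Gaussian averages. The identity is stated additively to avoid
truncated subtraction. -/
lemma lintegral_one_sub_cos_add_stdGaussian (ξ x : EuclideanSpace ℝ (Fin d)) :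
    ENNReal.ofReal ((1 - Real.cos ⟪ξ, x⟫) * (1 - Real.exp (-‖x‖ ^ 2 / 2))) +
      ∫⁻ g, ENNReal.ofReal (1 - Real.cos ⟪ξ + g, x⟫) ∂(stdGaussian (EuclideanSpace ℝ (Fin d))) =
      ENNReal.ofReal (1 - Real.cos ⟪ξ, x⟫) + ENNReal.ofReal (1 - Real.exp (-‖x‖ ^ 2 / 2)) := by
  have hint : Integrable (fun g : EuclideanSpace ℝ (Fin d) => Real.cos ⟪ξ + g, x⟫)
      (stdGaussian (EuclideanSpace ℝ (Fin d))) :=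
    (integrable_const (1 : ℝ)).mono (by fun_prop)
      (ae_of_all _ fun g => by simpa using Real.abs_cos_le_one _)
  have h1 := sub_nonneg.2 (Real.cos_le_one ⟪ξ, x⟫)
  have h2 : 0 ≤ 1 - Real.exp (-‖x‖ ^ 2 / 2) :=
    sub_nonneg.2 (Real.exp_le_one_iff.2 (by nlinarith [sq_nonneg ‖x‖]))
  have h3 : 0 ≤ 1 - Real.cos ⟪ξ, x⟫ * Real.exp (-‖x‖ ^ 2 / 2) := by
    have h4 := Real.exp_pos (-‖x‖ ^ 2 / 2)
    nlinarith [Real.cos_le_one ⟪ξ, x⟫]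
  rw [← ofReal_integral_eq_lintegral_ofReal (f := fun g => 1 - Real.cos ⟪ξ + g, x⟫)
    ((integrable_const _).sub hint) (ae_of_all _ fun g => sub_nonneg.2 (Real.cos_le_one _)),
    integral_sub (integrable_const _) hint, integral_cos_inner_add_stdGaussian, integral_const,
    probReal_univ, one_smul, ← ENNReal.ofReal_add (mul_nonneg h1 h2) h3, ← ENNReal.ofReal_add h1 h2]
  ring_nf

lemma HasSymbol.lintegral_one_sub_exp_lt_top (hψ : HasWeakScaling α β c C ψ)
    {μ : Measure (EuclideanSpace ℝ (Fin d))} [SFinite μ] (h : HasSymbol μ ψ) :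
    ∫⁻ x, ENNReal.ofReal (1 - Real.exp (-‖x‖ ^ 2 / 2)) ∂μ < ⊤ := by
  obtain ⟨A, -, hA⟩ := exists_lintegral_one_sub_exp_le (d := d) hψ
  have := hA μ ψ 1 one_pos h (fun u _ => by simp) 1 one_pos
  simp only [div_one] at this
  exact this.trans_lt ENNReal.ofReal_lt_top

/-- A symmetric measure is determined off the origin by its symbol. -/
theorem HasSymbol.restrict_unique (hψ : HasWeakScaling α β c C ψ)
    {μ₁ μ₂ : Measure (EuclideanSpace ℝ (Fin d))} [SFinite μ₁] [SFinite μ₂] (h₁ : HasSymbol μ₁ ψ)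
    (h₂ : HasSymbol μ₂ ψ) (hs₁ : μ₁.map (fun x => -x) = μ₁) (hs₂ : μ₂.map (fun x => -x) = μ₂) :
    μ₁.restrict {0}ᶜ = μ₂.restrict {0}ᶜ := by
  set γ := stdGaussian (EuclideanSpace ℝ (Fin d))
  -- This weight makes both measures finite and is positive off the origin, so equality of the
  -- weighted measures, seen from characteristic functions, can be divided by it.
  set w : EuclideanSpace ℝ (Fin d) → ℝ := fun x => 1 - Real.exp (-‖x‖ ^ 2 / 2)
  have hw0 (x) : 0 ≤ w x :=
    sub_nonneg.2 (Real.exp_le_one_iff.2 (by nlinarith [sq_nonneg ‖x‖]))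
  have hwm : Measurable w := by simp only [w]; fun_prop
  have hwe : Measurable fun x => ENNReal.ofReal (w x) := hwm.ennreal_ofReal
  have hfin (μ : Measure (EuclideanSpace ℝ (Fin d))) [SFinite μ] (h : HasSymbol μ ψ) :
      ∫⁻ x, ENNReal.ofReal (w x) ∂μ < ⊤ := h.lintegral_one_sub_exp_lt_top hψ
  have hw (μ : Measure (EuclideanSpace ℝ (Fin d))) [SFinite μ] (h : HasSymbol μ ψ) :
      ∫⁻ x, ENNReal.ofReal (w x) ∂μ = ∫⁻ g, ENNReal.ofReal (ψ ‖g‖) ∂γ := by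
    have := h.lintegral_one_sub_exp one_pos
    simpa [w] using this
  have hA (μ : Measure (EuclideanSpace ℝ (Fin d))) [SFinite μ] (h : HasSymbol μ ψ) (ξ) :
      ∫⁻ x, ENNReal.ofReal ((1 - Real.cos ⟪ξ, x⟫) * w x) ∂μ +
        ∫⁻ g, ENNReal.ofReal (ψ ‖ξ + g‖) ∂γ =
      ENNReal.ofReal (ψ ‖ξ‖) + ∫⁻ g, ENNReal.ofReal (ψ ‖g‖) ∂γ := by
    rw [← hw μ h, ← h ξ, ← lintegral_add_left (by fun_prop)]
    simp_rw [← h (ξ + _)]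
    rw [lintegral_lintegral_swap (by fun_prop), ← lintegral_add_left (by fun_prop)]
    exact lintegral_congr fun x => lintegral_one_sub_cos_add_stdGaussian ξ x
  have hA' (ξ) : ∫⁻ x, ENNReal.ofReal ((1 - Real.cos ⟪ξ, x⟫) * w x) ∂μ₁ =
      ∫⁻ x, ENNReal.ofReal ((1 - Real.cos ⟪ξ, x⟫) * w x) ∂μ₂ := by
    refine (ENNReal.add_left_inj ?_).1 ((hA μ₁ h₁ ξ).trans (hA μ₂ h₂ ξ).symm)
    -- The common Gaussian average must be finite before it can be cancelled.
    have h3 : ENNReal.ofReal (ψ ‖ξ‖) + ∫⁻ g, ENNReal.ofReal (ψ ‖g‖) ∂γ < ⊤ :=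
      ENNReal.add_lt_top.2 ⟨ENNReal.ofReal_lt_top, hw μ₁ h₁ ▸ hfin μ₁ h₁⟩
    rw [← hA μ₁ h₁ ξ] at h3
    exact (le_add_left le_rfl).trans_lt h3 |>.ne
  have hwint (μ : Measure (EuclideanSpace ℝ (Fin d))) [SFinite μ] (h : HasSymbol μ ψ) :
      Integrable w μ :=
    ⟨hwm.aestronglyMeasurable, by
      rw [hasFiniteIntegral_iff_ofReal (ae_of_all _ hw0)]; exact hfin μ h⟩
  have hcosint (μ : Measure (EuclideanSpace ℝ (Fin d))) [SFinite μ] (h : HasSymbol μ ψ) (ξ) :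
      Integrable (fun x => (1 - Real.cos ⟪ξ, x⟫) * w x) μ :=
    (hwint μ h).bdd_mul (c := 2) (by fun_prop) (ae_of_all _ fun x => by
      rw [Real.norm_eq_abs, abs_le]
      constructor <;> linarith [Real.cos_le_one ⟪ξ, x⟫, Real.neg_one_le_cos ⟪ξ, x⟫])
  have hchar (μ : Measure (EuclideanSpace ℝ (Fin d))) (ξ) :
      charFun (μ.withDensity fun x => ENNReal.ofReal (w x)) ξ =
        ∫ x, w x • Complex.exp (⟪x, ξ⟫ * Complex.I) ∂μ := by
    rw [charFun_apply, integral_withDensity_eq_integral_toReal_smul hwe (by simp)]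
    simp_rw [ENNReal.toReal_ofReal (hw0 _)]
  have hre (μ : Measure (EuclideanSpace ℝ (Fin d))) [SFinite μ] (h : HasSymbol μ ψ)
      (hs : μ.map (fun x => -x) = μ) (ξ) :
      charFun (μ.withDensity fun x => ENNReal.ofReal (w x)) ξ =
        (((∫⁻ x, ENNReal.ofReal (w x) ∂μ).toReal -
          (∫⁻ x, ENNReal.ofReal ((1 - Real.cos ⟪ξ, x⟫) * w x) ∂μ).toReal : ℝ) : ℂ) := by
    have hi : Integrable (fun x => w x • Complex.exp (⟪x, ξ⟫ * Complex.I)) μ :=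
      (hwint μ h).mono (by fun_prop) (ae_of_all _ fun x => by
        rw [norm_smul, Complex.norm_exp_ofReal_mul_I, mul_one])
    apply Complex.ext
    · rw [hchar, Complex.ofReal_re, ← RCLike.re_eq_complex_re, ← integral_re hi,
        ← integral_eq_lintegral_of_nonneg_ae (ae_of_all _ hw0) hwm.aestronglyMeasurable,
        ← integral_eq_lintegral_of_nonneg_ae (ae_of_all _ fun x =>
          mul_nonneg (sub_nonneg.2 (Real.cos_le_one _)) (hw0 x)) (hcosint μ h ξ).1,
        ← integral_sub (hwint μ h) (hcosint μ h ξ)]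
      refine integral_congr_ae (ae_of_all _ fun x => ?_)
      simp only [RCLike.re_eq_complex_re, Complex.real_smul, Complex.re_ofReal_mul,
        Complex.exp_ofReal_mul_I_re, real_inner_comm ξ x]
      ring
    -- Symmetry of the measure makes the characteristic function real; the symbol only sees its real
    -- part.
    · rw [Complex.ofReal_im, ← Complex.conj_eq_iff_im, ← charFun_neg, hchar, hchar]
      conv_rhs => rw [← hs]
      rw [integral_map (by fun_prop) (by fun_prop)]
      simp [w]
  have hf₁ : IsFiniteMeasure (μ₁.withDensity fun x => ENNReal.ofReal (w x)) :=
    isFiniteMeasure_withDensity (hfin μ₁ h₁).ne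
  have hf₂ : IsFiniteMeasure (μ₂.withDensity fun x => ENNReal.ofReal (w x)) :=
    isFiniteMeasure_withDensity (hfin μ₂ h₂).ne
  have heq : μ₁.withDensity (fun x => ENNReal.ofReal (w x)) =
      μ₂.withDensity (fun x => ENNReal.ofReal (w x)) := by
    refine Measure.ext_of_charFun (funext fun ξ => ?_)
    rw [hre μ₁ h₁ hs₁, hre μ₂ h₂ hs₂, hA', hw μ₁ h₁, hw μ₂ h₂]
  have hinv (μ : Measure (EuclideanSpace ℝ (Fin d))) :
      ((μ.withDensity fun x => ENNReal.ofReal (w x)).restrict {0}ᶜ).withDensity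
        (fun x => (ENNReal.ofReal (w x))⁻¹) = μ.restrict {0}ᶜ := by
    rw [restrict_withDensity (measurableSet_singleton 0).compl]
    refine withDensity_inv_same hwe ?_ (ae_of_all _ fun x => by simp)
    filter_upwards [ae_restrict_mem (measurableSet_singleton 0).compl] with x hx
    have : 0 < ‖x‖ := norm_pos_iff.2 hx
    simp only [w, ne_eq, ENNReal.ofReal_eq_zero, not_le, sub_pos, Real.exp_lt_one_iff]
    have : 0 < ‖x‖ ^ 2 := by positivity
    linarith
  rw [← hinv μ₁, ← hinv μ₂, heq]

end Uniqueness

/-! ### The density of the Lévy measure -/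

/-- Helly's selection theorem for locally bounded sequences of nonincreasing functions. -/
lemma exists_subseq_tendsto_of_antitoneOn {f : ℕ → ℝ → ℝ} {M : ℝ → ℝ}
    (hf : ∀ n, AntitoneOn (f n) (Ioi 0)) (h0 : ∀ n r, 0 < r → 0 ≤ f n r)
    (hM : ∀ n r, 0 < r → f n r ≤ M r) :
    ∃ (g : ℝ → ℝ) (φ : ℕ → ℕ), StrictMono φ ∧ AntitoneOn g (Ioi 0) ∧ (∀ r, 0 < r → 0 ≤ g r) ∧
      ∀ r ∈ continuityRadii g, Tendsto (fun n => f (φ n) r) atTop (𝓝 (g r)) := by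
  have hpos (q : {q : ℚ // 0 < q}) : (0 : ℝ) < q := by exact_mod_cast q.2
  -- Compactness of a countable product replaces the diagonal argument and yields convergence at all
  -- positive rationals.
  have hK : IsCompact (Set.pi univ fun q : {q : ℚ // 0 < q} => Icc (0 : ℝ) (M q)) :=
    isCompact_univ_pi fun _ => isCompact_Icc
  obtain ⟨F, -, φ, hφ, hlim⟩ := hK.tendsto_subseq (x := fun n (q : {q : ℚ // 0 < q}) => f n (q : ℝ))
    fun n q _ => ⟨h0 n q (hpos q), hM n q (hpos q)⟩
  rw [tendsto_pi_nhds] at hlim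
  have hF0 (q) : 0 ≤ F q := ge_of_tendsto' (hlim q) fun n => h0 _ _ (hpos q)
  have hFanti {q q' : {q : ℚ // 0 < q}} (h : (q : ℝ) ≤ q') : F q' ≤ F q :=
    le_of_tendsto_of_tendsto' (hlim q') (hlim q) fun n => hf _ (hpos q) (hpos q') h
  -- The limit function is the infimum of rational limits to the left of `r`. At its continuity
  -- points, the values at rationals on either side squeeze the sequence.
  set S : ℝ → Set ℝ := fun r => F '' {q | (q : ℝ) < r}
  have hSne {r : ℝ} (hr : 0 < r) : (S r).Nonempty := by
    obtain ⟨q, hq0, hqr⟩ := exists_rat_btwn hr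
    exact ⟨_, ⟨⟨q, by exact_mod_cast hq0⟩, hqr, rfl⟩⟩
  have hSb (r : ℝ) : BddBelow (S r) := ⟨0, by rintro _ ⟨q, -, rfl⟩; exact hF0 q⟩
  have hle {r : ℝ} {q : {q : ℚ // 0 < q}} (h : (q : ℝ) < r) : sInf (S r) ≤ F q :=
    csInf_le (hSb r) ⟨q, h, rfl⟩
  have hge {r : ℝ} (hr : 0 < r) {q : {q : ℚ // 0 < q}} (h : r ≤ q) : F q ≤ sInf (S r) :=
    le_csInf (hSne hr) (by rintro _ ⟨q', hq', rfl⟩; exact hFanti (hq'.le.trans h))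
  refine ⟨fun r => sInf (S r), φ, hφ, fun a ha b hb hab => ?_, fun r hr => ?_, fun r hr => ?_⟩
  · exact csInf_le_csInf (hSb b) (hSne ha) (image_mono fun q hq => lt_of_lt_of_le hq hab)
  · exact le_csInf (hSne hr) (by rintro _ ⟨q, -, rfl⟩; exact hF0 q)
  · refine tendsto_order.2 ⟨fun a ha => ?_, fun a ha => ?_⟩
    · have h1 : ∀ᶠ s in 𝓝[>] r, a < sInf (S s) :=
        (hr.2.eventually_const_lt ha).filter_mono nhdsWithin_le_nhds
      obtain ⟨s, hs, hrs⟩ := (h1.and self_mem_nhdsWithin).exists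
      obtain ⟨q, hq1, hq2⟩ := exists_rat_btwn (show r < s from hrs)
      set q' : {q : ℚ // 0 < q} := ⟨q, by exact_mod_cast hr.1.trans hq1⟩
      have h2 : a < F q' := hs.trans_le (hle hq2)
      filter_upwards [(hlim q').eventually_const_lt h2] with n hn
      exact hn.trans_le (hf _ hr.1 (hpos q') hq1.le)
    · obtain ⟨_, ⟨q, hq, rfl⟩, hqa⟩ := exists_lt_of_csInf_lt (hSne hr.1) ha
      filter_upwards [(hlim q).eventually_lt_const hqa] with n hn
      exact (hf _ (hpos q) hr.1 (le_of_lt hq)).trans_lt hn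

section LevyDensity

variable {d : ℕ} {α β c C : ℝ} {ψ : ℝ → ℝ}

/-- The integrand vanishes at the origin, so a possible atom there plays no role. -/
lemma IsRadialNonincreasingDensity.lintegral_eq (hd : 1 ≤ d) {f : ℝ → ℝ}
    {μ : Measure (EuclideanSpace ℝ (Fin d))} (hf : IsRadialNonincreasingDensity f μ)
    {u : EuclideanSpace ℝ (Fin d) → ℝ≥0∞} (hu : Measurable u) (hu0 : u 0 = 0) :
    ∫⁻ x, u x ∂μ = ∫⁻ x, ENNReal.ofReal (f ‖x‖) * u x := by
  have h1 : ∫⁻ x, u x ∂μ = ∫⁻ x in {0}ᶜ, u x ∂μ := by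
    rw [← lintegral_indicator (measurableSet_singleton 0).compl]
    refine lintegral_congr fun x => ?_
    by_cases hx : x = 0 <;> simp [hx, hu0]
  rw [h1, hf.2.2, volume_restrict_compl_zero hd, lintegral_withDensity_eq_lintegral_mul₀
    (hf.2.1.aemeasurable_comp_norm hd).ennreal_ofReal hu.aemeasurable]
  rfl

lemma IsRadialNonincreasingDensity.withDensity {f : ℝ → ℝ} (h0 : ∀ r, 0 < r → 0 ≤ f r)
    (hf : AntitoneOn f (Ioi 0)) : IsRadialNonincreasingDensity f
      ((volume : Measure (EuclideanSpace ℝ (Fin d))).withDensity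
        (fun x => ENNReal.ofReal (f ‖x‖))) :=
  ⟨h0, hf, restrict_withDensity (measurableSet_singleton 0).compl _⟩

lemma map_neg_withDensity_norm (F : ℝ → ℝ≥0∞) :
    ((volume : Measure (EuclideanSpace ℝ (Fin d))).withDensity (fun x => F ‖x‖)).map
      (fun x => -x) = volume.withDensity (fun x => F ‖x‖) := by
  ext A hA
  rw [Measure.map_apply measurable_neg hA, withDensity_apply _ hA,
    withDensity_apply _ (measurable_neg hA),
    ← (Measure.measurePreserving_neg (volume : Measure (EuclideanSpace ℝ (Fin d)))
      ).setLIntegral_comp_preimage_emb (MeasurableEquiv.neg _).measurableEmbedding]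
  simp

/-- The Lévy measure of a unimodal Lévy process with weakly scaling exponent has a radial
nonincreasing density. -/
theorem exists_isRadialNonincreasingDensity_levyMeasure (hd : 1 ≤ d) (hψ : HasWeakScaling α β c C ψ)
    {p : ℝ≥0 → Measure (EuclideanSpace ℝ (Fin d))} (hp : IsConvolutionSemigroup p)
    (huni : ∀ t, IsIsotropicUnimodal (p t)) (hchar : IsCharExponent p (fun ξ => ψ ‖ξ‖))
    {ν : Measure (EuclideanSpace ℝ (Fin d))} [SFinite ν] (hν : HasSymbol ν ψ)
    (hneg : ν.map (fun x => -x) = ν) :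
    ∃ f : ℝ → ℝ, IsRadialNonincreasingDensity f ν := by
  obtain ⟨K₁, hK₁, hup⟩ := exists_density_le hd hψ
  obtain ⟨K₂, hK₂, hlow⟩ := exists_le_density hd hψ (b := Real.exp (-1)) (Real.exp_pos _)
  have hc := hψ.c_pos
  set t : ℕ → ℝ≥0 := fun n => 1 / (n + 1)
  have ht (n) : (0 : ℝ) < t n := by simp only [t]; positivity
  have httop : Tendsto (fun n => (t n : ℝ)) atTop (𝓝 0) := by
    simpa [t] using tendsto_one_div_add_atTop_nhds_zero_nat (𝕜 := ℝ)
  have hsym (n) := hchar.hasSymbol hp (t n)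
  have hle (s : ℝ≥0) (u : ℝ) (_ : 0 ≤ u) : 1 - Real.exp (-(s * ψ u)) ≤ s * ψ u := by
    linarith [Real.add_one_le_exp (-(s * ψ u))]
  choose g hg using fun n => huni (t n)
  -- The densities of `p_t/t`, which should approach the Lévy density as `t → 0`. The general bounds
  -- with `κ = t` place them between multiples of `M`, the lower bound only for small `t`.
  set f : ℕ → ℝ → ℝ := fun n r => (t n : ℝ)⁻¹ * g n r
  set M : ℝ → ℝ := fun r => ψ (1 / r) / r ^ d
  have hfM (n r) (hr : 0 < r) : f n r ≤ K₁ * M r := by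
    have := hp.prob (t n)
    have := hup (p (t n)) (g n) _ (t n) (ht n) (hg n) (hsym n) (hle _) r hr
    calc f n r ≤ (t n : ℝ)⁻¹ * (K₁ * (t n * ψ (1 / r) / r ^ d)) := by
          have := ht n
          simp only [f]; gcongr
      _ = _ := by have := (ht n).ne'; simp only [M]; field_simp
  have hMf (r) (hr : 0 < r) : ∀ᶠ n in atTop, K₂ * M r ≤ f n r := by
    have h1 : Tendsto (fun n => (t n : ℝ) * (c⁻¹ * ψ (2 / r))) atTop (𝓝 0) := by
      simpa using httop.mul_const (c⁻¹ * ψ (2 / r))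
    filter_upwards [h1.eventually_le_const one_pos] with n hn
    have := hp.prob (t n)
    have := hlow (p (t n)) (g n) _ (t n) (ht n) (hg n) (hsym n) (hle _) r hr fun u hu hur => by
      have h2 : t n * ψ u ≤ 1 := by
        refine le_trans ?_ hn
        have := ht n
        gcongr
        exact hψ.le_of_le hu.le (by positivity) hur
      rw [mul_assoc]
      exact mul_exp_neg_le_one_sub_exp_neg (mul_nonneg (ht n).le (hψ.nonneg hu.le)) h2
    calc K₂ * M r = (t n : ℝ)⁻¹ * (K₂ * (t n * ψ (1 / r) / r ^ d)) := by
          have := (ht n).ne'; simp only [M]; field_simp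
      _ ≤ _ := by have := ht n; simp only [f]; gcongr
  have hf0 (n r) (hr : 0 < r) : 0 ≤ f n r := mul_nonneg (inv_pos.2 (ht n)).le ((hg n).1 r hr)
  have hfanti (n) : AntitoneOn (f n) (Ioi 0) := fun a ha b hb hab =>
    mul_le_mul_of_nonneg_left ((hg n).2.1 ha hb hab) (inv_pos.2 (ht n)).le
  obtain ⟨F, φ, hφ, hFanti, hF0, hlim⟩ := exists_subseq_tendsto_of_antitoneOn hfanti hf0 hfM
  have hae := hFanti.ae_norm_mem_continuityRadii hd
  have hφt := hφ.tendsto_atTop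
  -- the integrals of `1 - cos` against the approximating densities
  set k : EuclideanSpace ℝ (Fin d) → EuclideanSpace ℝ (Fin d) → ℝ≥0∞ :=
    fun ξ x => ENNReal.ofReal (1 - Real.cos ⟪ξ, x⟫)
  have hkm (ξ) : Measurable (k ξ) := by simp only [k]; fun_prop
  have hk0 (ξ) : k ξ 0 = 0 := by simp [k]
  have hI (ξ) (n) : ∫⁻ x, ENNReal.ofReal (f n ‖x‖) * k ξ x =
      ENNReal.ofReal ((t n : ℝ)⁻¹ * (1 - Real.exp (-(t n * ψ ‖ξ‖)))) := by
    have hm : AEMeasurable fun x => ENNReal.ofReal (g n ‖x‖) * k ξ x :=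
      ((hg n).2.1.aemeasurable_comp_norm hd).ennreal_ofReal.mul (hkm ξ).aemeasurable
    have h1 := (hg n).lintegral_eq hd (hkm ξ) (hk0 ξ)
    have h2 : ∫⁻ x, k ξ x ∂(p (t n)) = _ := hsym n ξ
    rw [ENNReal.ofReal_mul (inv_pos.2 (ht n)).le, ← h2, h1, ← lintegral_const_mul'' _ hm]
    refine lintegral_congr fun x => ?_
    rw [← mul_assoc, ← ENNReal.ofReal_mul (inv_pos.2 (ht n)).le]
  -- The symbol of `p_t/t` is `(1 - exp(-tψ))/t`, a difference quotient with limit `ψ`.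
  have hIlim (ξ) : Tendsto (fun n => ∫⁻ x, ENNReal.ofReal (f (φ n) ‖x‖) * k ξ x) atTop
      (𝓝 (ENNReal.ofReal (ψ ‖ξ‖))) := by
    simp_rw [hI]
    refine (ENNReal.continuous_ofReal.tendsto _).comp ?_
    have h1 : HasDerivAt (fun s : ℝ => 1 - Real.exp (-(s * ψ ‖ξ‖))) (ψ ‖ξ‖) 0 := by
      have := (((hasDerivAt_id (0 : ℝ)).mul_const (ψ ‖ξ‖)).neg.exp).const_sub 1
      simpa using this
    have h2 := h1.tendsto_slope_zero
    have h3 : Tendsto (fun n => (t (φ n) : ℝ)) atTop (𝓝[≠] 0) :=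
      tendsto_nhdsWithin_iff.2 ⟨httop.comp hφt, Eventually.of_forall fun n => (ht _).ne'⟩
    have h4 := h2.comp h3
    refine h4.congr fun n => ?_
    simp
  have hmeas (n) : AEMeasurable fun x : EuclideanSpace ℝ (Fin d) => ENNReal.ofReal (f n ‖x‖) :=
    ((hfanti n).aemeasurable_comp_norm hd).ennreal_ofReal
  have hFlim : ∀ᵐ x : EuclideanSpace ℝ (Fin d), ∀ ξ,
      Tendsto (fun n => ENNReal.ofReal (f (φ n) ‖x‖) * k ξ x) atTop
        (𝓝 (ENNReal.ofReal (F ‖x‖) * k ξ x)) := by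
    filter_upwards [hae] with x hx ξ
    exact ENNReal.Tendsto.mul_const ((ENNReal.continuous_ofReal.tendsto _).comp (hlim _ hx))
      (Or.inr ENNReal.ofReal_ne_top)
  have hFfin (ξ) : ∫⁻ x, ENNReal.ofReal (F ‖x‖) * k ξ x ≤ ENNReal.ofReal (ψ ‖ξ‖) := by
    calc ∫⁻ x, ENNReal.ofReal (F ‖x‖) * k ξ x
        = ∫⁻ x, liminf (fun n => ENNReal.ofReal (f (φ n) ‖x‖) * k ξ x) atTop := by
          refine lintegral_congr_ae ?_
          filter_upwards [hFlim] with x hx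
          exact (hx ξ).liminf_eq.symm
      _ ≤ liminf (fun n => ∫⁻ x, ENNReal.ofReal (f (φ n) ‖x‖) * k ξ x) atTop :=
          lintegral_liminf_le' fun n => (hmeas _).mul (hkm ξ).aemeasurable
      _ = _ := (hIlim ξ).liminf_eq
  have hMF : ∀ᵐ x : EuclideanSpace ℝ (Fin d), K₂ * M ‖x‖ ≤ F ‖x‖ := by
    filter_upwards [hae] with x hx
    exact ge_of_tendsto (hlim _ hx) (hφt.eventually (hMf _ hx.1))
  -- The lower bound supplies the dominating function: `M` is at most a multiple of `F`, and `F` is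
  -- integrable against `1 - cos` by Fatou. Dominated convergence then upgrades Fatou's inequality
  -- to equality.
  have hdom (ξ) : ∫⁻ x, ENNReal.ofReal (K₁ * M ‖x‖) * k ξ x ≠ ⊤ := by
    refine ne_top_of_le_ne_top (b := ENNReal.ofReal (K₁ * K₂⁻¹) * ENNReal.ofReal (ψ ‖ξ‖))
      (by finiteness) ?_
    refine le_trans ?_ (mul_le_mul_right (hFfin ξ) _)
    have hm : AEMeasurable fun x => ENNReal.ofReal (F ‖x‖) * k ξ x :=
      (hFanti.aemeasurable_comp_norm hd).ennreal_ofReal.mul (hkm ξ).aemeasurable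
    rw [← lintegral_const_mul'' _ hm]
    refine lintegral_mono_ae ?_
    filter_upwards [hMF] with x hx
    rw [← mul_assoc (ENNReal.ofReal _), ← ENNReal.ofReal_mul (p := K₁ * K₂⁻¹) (by positivity)]
    refine mul_le_mul' (ENNReal.ofReal_le_ofReal ?_) le_rfl
    calc K₁ * M ‖x‖ = K₁ * K₂⁻¹ * (K₂ * M ‖x‖) := by field_simp
      _ ≤ _ := by gcongr
  set ν' : Measure (EuclideanSpace ℝ (Fin d)) :=
    volume.withDensity (fun x => ENNReal.ofReal (F ‖x‖))
  have hFν' : IsRadialNonincreasingDensity F ν' :=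
    IsRadialNonincreasingDensity.withDensity hF0 hFanti
  have hν' : HasSymbol ν' ψ := fun ξ => by
    refine (hFν'.lintegral_eq hd (hkm ξ) (hk0 ξ)).trans (tendsto_nhds_unique ?_ (hIlim ξ))
    refine tendsto_lintegral_of_dominated_convergence' _
      (fun n => (hmeas _).mul (hkm ξ).aemeasurable) (fun n => ?_) (hdom ξ)
      (by filter_upwards [hFlim] with x hx using hx ξ)
    filter_upwards [hae] with x hx
    gcongr
    exact hfM _ _ hx.1
  have hneg' : ν'.map (fun x => -x) = ν' := map_neg_withDensity_norm fun r => ENNReal.ofReal (F r)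
  exact ⟨F, hF0, hFanti, (HasSymbol.restrict_unique hψ hν hν' hneg hneg').trans hFν'.2.2⟩

/-- The radial nonincreasing density of a measure with symbol `ψ` is comparable with
`ψ(1 / r) / r ^ d`. -/
theorem exists_levy_density_bounds (hd : 1 ≤ d) (hψ : HasWeakScaling α β c C ψ) :
    ∃ K, 0 < K ∧ ∀ (ν : Measure (EuclideanSpace ℝ (Fin d))) [SFinite ν] (f : ℝ → ℝ),
      HasSymbol ν ψ → IsRadialNonincreasingDensity f ν →
      ∀ r, 0 < r → f r ≤ K * (ψ (1 / r) / r ^ d) ∧ ψ (1 / r) / r ^ d ≤ K * f r := by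
  obtain ⟨K₁, hK₁, hup⟩ := exists_density_le hd hψ
  obtain ⟨K₂, hK₂, hlow⟩ := exists_le_density hd hψ one_pos
  refine ⟨K₁ + K₂⁻¹, by positivity, fun ν _ F hν hF r hr => ?_⟩
  have h1 := hup ν F ψ 1 one_pos hF hν (fun u _ => by simp) r hr
  have h2 := hlow ν F ψ 1 one_pos hF hν (fun u _ => by simp) r hr (fun u _ _ => by simp)
  rw [one_mul] at h1 h2
  have hψr := hψ.pos (1 / r) (by positivity)
  have hFr := hF.1 r hr
  constructor
  · refine h1.trans ?_
    gcongr
    linarith [inv_pos.2 hK₂]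
  · calc ψ (1 / r) / r ^ d = K₂⁻¹ * (K₂ * (ψ (1 / r) / r ^ d)) := by field_simp
      _ ≤ K₂⁻¹ * F r := by gcongr
      _ ≤ _ := by gcongr; linarith

end LevyDensity

/-! ### Convolution semigroups from characteristic exponents -/

/-- Uniqueness of characteristic functions gives the convolution identity, and Lévy's continuity
theorem along sequences gives weak continuity at zero. -/
theorem isConvolutionSemigroup_of_charFun {E : Type*} [NormedAddCommGroup E]
    [InnerProductSpace ℝ E] [FiniteDimensional ℝ E] [MeasurableSpace E] [BorelSpace E]
    {p : ℝ≥0 → Measure E} (hp : ∀ t, IsProbabilityMeasure (p t)) {Φ : E → ℂ}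
    (h : ∀ t ξ, charFun (p t) ξ = Complex.exp (t * Φ ξ)) : IsConvolutionSemigroup p := by
  have hzero : p 0 = Measure.dirac 0 :=
    Measure.ext_of_charFun (funext fun ξ => by rw [h]; simp [charFun_dirac])
  refine ⟨hp, hzero, fun s t => ?_, fun f => ?_⟩
  · refine Measure.ext_of_charFun (funext fun ξ => ?_)
    rw [charFun_conv, h, h, h, ← Complex.exp_add]
    push_cast
    ring_nf
  · refine tendsto_of_seq_tendsto fun u hu => ?_
    let P : ℝ≥0 → ProbabilityMeasure E := fun t => ⟨p t, hp t⟩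
    have h1 : Tendsto (fun n => P (u n)) atTop (𝓝 (P 0)) := by
      refine ProbabilityMeasure.tendsto_of_tendsto_charFun fun ξ => ?_
      simp only [P, ProbabilityMeasure.coe_mk, h]
      have hu' : Tendsto (fun n => ((u n : ℝ) : ℂ)) atTop (𝓝 (((0 : ℝ≥0) : ℝ) : ℂ)) :=
        (Complex.continuous_ofReal.comp NNReal.continuous_coe).continuousAt.tendsto.comp hu
      exact (Complex.continuous_exp.tendsto _).comp (hu'.mul_const _)
    have h2 := (ProbabilityMeasure.tendsto_iff_forall_integral_tendsto.1 h1) f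
    simpa [P, hzero, Function.comp_def] using h2

/-! ### Compound Poisson laws -/

/-- The `n`-fold convolution power of a measure. -/
noncomputable def convPow (m : Measure ℝ) : ℕ → Measure ℝ
  | 0 => Measure.dirac 0
  | n + 1 => convPow m n ∗ m

/-- The compound Poisson law at time `t` with jump measure `m`. -/
noncomputable def compoundPoisson (m : Measure ℝ) (t : ℝ≥0) : Measure ℝ :=
  Measure.sum fun n : ℕ =>
    ENNReal.ofReal (Real.exp (-(t * m.real univ)) * (t ^ n / n.factorial)) • convPow m n

section CompoundPoisson

variable {m : Measure ℝ} [IsFiniteMeasure m]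

instance isFiniteMeasure_convPow (n : ℕ) : IsFiniteMeasure (convPow m n) := by
  induction n with
  | zero => unfold convPow; infer_instance
  | succ n ih => unfold convPow; infer_instance

lemma convPow_Iio_zero (hm : m (Iio 0) = 0) (n : ℕ) : convPow m n (Iio 0) = 0 := by
  induction n with
  | zero => simp [convPow]
  | succ n ih =>
    rw [convPow, Measure.conv, Measure.map_apply measurable_add measurableSet_Iio]
    refine measure_mono_null (t := Iio 0 ×ˢ univ ∪ univ ×ˢ Iio 0) (fun x hx => ?_)
      (measure_union_null ?_ ?_)
    · simp only [mem_preimage, mem_Iio] at hx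
      simp only [mem_union, mem_prod, mem_Iio, mem_univ, and_true, true_and]
      by_contra! h
      linarith
    · rw [Measure.prod_prod, ih, zero_mul]
    · rw [Measure.prod_prod, hm, mul_zero]

lemma ae_nonneg_of_Iio {μ : Measure ℝ} (h : μ (Iio 0) = 0) : ∀ᵐ x ∂μ, 0 ≤ x := by
  rw [ae_iff]
  simp only [not_le]
  exact h

/-- Stated for a general multiplicative `χ` so as to cover both Fourier characters and `exp(-lx)`.
The latter is bounded only on the half-line, hence the support condition. -/
lemma integral_convPow (hm : m (Iio 0) = 0) {χ : ℝ → ℂ} (hχ : Measurable χ) (h0 : χ 0 = 1)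
    (hadd : ∀ x y, χ (x + y) = χ x * χ y) (hle : ∀ x, 0 ≤ x → ‖χ x‖ ≤ 1) (n : ℕ) :
    ∫ x, χ x ∂(convPow m n) = (∫ x, χ x ∂m) ^ n := by
  have hint (μ : Measure ℝ) [IsFiniteMeasure μ] (h : μ (Iio 0) = 0) : Integrable χ μ :=
    (integrable_const (1 : ℝ)).mono hχ.aestronglyMeasurable (by
      filter_upwards [ae_nonneg_of_Iio h] with x hx
      simpa using hle x hx)
  induction n with
  | zero => simp [convPow, h0]
  | succ n ih =>
    have h1 := hint _ (convPow_Iio_zero hm (n + 1))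
    rw [convPow] at h1 ⊢
    rw [integral_conv h1]
    simp_rw [hadd, integral_const_mul, integral_mul_const]
    rw [ih, pow_succ]

lemma compoundPoisson_Iio_zero (hm : m (Iio 0) = 0) (t : ℝ≥0) :
    compoundPoisson m t (Iio 0) = 0 := by
  rw [compoundPoisson, Measure.sum_apply _ measurableSet_Iio]
  simp [convPow_Iio_zero hm]

lemma convPow_univ (n : ℕ) : convPow m n univ = ENNReal.ofReal (m.real univ ^ n) := by
  induction n with
  | zero => simp [convPow]
  | succ n ih =>
    rw [convPow, Measure.conv, Measure.map_apply measurable_add .univ, preimage_univ,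
      ← univ_prod_univ, Measure.prod_prod, ih, pow_succ, ENNReal.ofReal_mul (by positivity),
      ofReal_measureReal]

instance isProbabilityMeasure_compoundPoisson (t : ℝ≥0) :
    IsProbabilityMeasure (compoundPoisson m t) := by
  constructor
  rw [compoundPoisson, Measure.sum_apply _ .univ]
  simp only [Measure.smul_apply, convPow_univ, smul_eq_mul]
  have h1 (n : ℕ) : ENNReal.ofReal (Real.exp (-(t * m.real univ)) * (t ^ n / n.factorial)) *
      ENNReal.ofReal (m.real univ ^ n) =
      ENNReal.ofReal (Real.exp (-(t * m.real univ)) * ((t * m.real univ) ^ n / n.factorial)) := by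
    rw [← ENNReal.ofReal_mul (by positivity), mul_pow]
    ring_nf
  have h2 : HasSum (fun n : ℕ => Real.exp (-(t * m.real univ)) *
      ((t * m.real univ) ^ n / n.factorial)) 1 := by
    have := (NormedSpace.expSeries_div_hasSum_exp ((t : ℝ) * m.real univ)).mul_left
      (Real.exp (-(t * m.real univ)))
    rwa [← Real.exp_eq_exp_ℝ, ← Real.exp_add, neg_add_cancel, Real.exp_zero] at this
  simp_rw [h1]
  rw [← ENNReal.ofReal_tsum_of_nonneg (fun n => by positivity) h2.summable, h2.tsum_eq,
    ENNReal.ofReal_one]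

/-- The powers `(∫ χ dm)^n` with Poisson weights sum to an exponential series; subtracting `1` under
the integral absorbs the normalising factor. -/
lemma integral_compoundPoisson (hm : m (Iio 0) = 0) {χ : ℝ → ℂ} (hχ : Measurable χ)
    (h0 : χ 0 = 1) (hadd : ∀ x y, χ (x + y) = χ x * χ y) (hle : ∀ x, 0 ≤ x → ‖χ x‖ ≤ 1)
    (t : ℝ≥0) :
    ∫ x, χ x ∂(compoundPoisson m t) = Complex.exp (t * ∫ x, (χ x - 1) ∂m) := by
  have hint (μ : Measure ℝ) [IsFiniteMeasure μ] (h : μ (Iio 0) = 0) : Integrable χ μ :=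
    (integrable_const (1 : ℝ)).mono hχ.aestronglyMeasurable (by
      filter_upwards [ae_nonneg_of_Iio h] with x hx
      simpa using hle x hx)
  have h1 := hint _ (compoundPoisson_Iio_zero hm t)
  rw [integral_sub (hint m hm) (integrable_const _), integral_const]
  rw [compoundPoisson] at h1 ⊢
  rw [integral_sum_measure h1]
  simp_rw [integral_smul_measure, integral_convPow hm hχ h0 hadd hle]
  have h2 := (NormedSpace.expSeries_div_hasSum_exp ((t : ℂ) * ∫ x, χ x ∂m)).mul_left
    (Complex.exp (-(t * m.real univ)))
  rw [← Complex.exp_eq_exp_ℂ, ← Complex.exp_add] at h2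
  rw [show (t : ℂ) * ((∫ x, χ x ∂m) - m.real univ • 1) =
    -(t * m.real univ) + t * ∫ x, χ x ∂m by simp; ring, ← h2.tsum_eq]
  refine tsum_congr fun n => ?_
  rw [ENNReal.toReal_ofReal (by positivity), Complex.real_smul]
  push_cast
  rw [mul_pow]
  ring

end CompoundPoisson

/-! ### Existence of subordinators -/

section Subordinator

variable {ρ : Measure ℝ}

/-- A tight-limit version of Lévy's continuity theorem: if the characteristic functions of
probability measures converge pointwise to a function continuous at the origin, this function is
the characteristic function of a probability measure. -/
lemma exists_tendsto_of_tendsto_charFun {E : Type*} [NormedAddCommGroup E]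
    [InnerProductSpace ℝ E] [FiniteDimensional ℝ E] [MeasurableSpace E] [BorelSpace E]
    {μ : ℕ → ProbabilityMeasure E} {f : E → ℂ} (hf : ContinuousAt f 0)
    (h : ∀ ξ, Tendsto (fun n => charFun (μ n : Measure E) ξ) atTop (𝓝 (f ξ))) :
    ∃ μ₀ : ProbabilityMeasure E, (∀ ξ, charFun (μ₀ : Measure E) ξ = f ξ) ∧
      Tendsto μ atTop (𝓝 μ₀) := by
  have htight : IsTightMeasureSet {((ν : ProbabilityMeasure E) : Measure E) | ν ∈ range μ} := by
    refine (isTightMeasureSet_of_tendsto_charFun hf h).subset ?_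
    rintro _ ⟨_, ⟨n, rfl⟩, rfl⟩
    exact ⟨n, rfl⟩
  have hK := isCompact_closure_of_isTightMeasureSet htight
  -- Tightness gives relative compactness, and a limit along a free ultrafilter already has
  -- characteristic function `f`. Convergence of the whole sequence follows from that of the
  -- characteristic functions.
  obtain ⟨μ₀, -, hμ₀⟩ := isCompact_iff_ultrafilter_le_nhds.1 hK ((hyperfilter ℕ).map μ) (by
    rw [le_principal_iff, Ultrafilter.coe_map, mem_map]
    exact univ_mem' fun n => subset_closure ⟨n, rfl⟩)
  have hlim : Tendsto μ (hyperfilter ℕ) (𝓝 μ₀) := hμ₀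
  have hchar (ξ) : charFun (μ₀ : Measure E) ξ = f ξ := by
    have h1 := (ProbabilityMeasure.tendsto_iff_forall_integral_rclike_tendsto ℂ).1 hlim
      (BoundedContinuousFunction.innerProbChar ξ)
    simp_rw [← charFun_eq_integral_innerProbChar] at h1
    exact tendsto_nhds_unique h1 ((h ξ).mono_left Nat.hyperfilter_le_atTop)
  exact ⟨μ₀, hchar, ProbabilityMeasure.tendsto_of_tendsto_charFun fun ξ => by
    rw [hchar]; exact h ξ⟩

lemma ae_pos_of_Iic (h0 : ρ (Iic 0) = 0) : ∀ᵐ x ∂ρ, 0 < x := by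
  rw [ae_iff]; simp only [not_lt]; exact h0

lemma integrable_min_one (h0 : ρ (Iic 0) = 0)
    (hρ : ∫⁻ u, ENNReal.ofReal (min u 1) ∂ρ < ⊤) : Integrable (fun x => min x 1) ρ := by
  refine ⟨by fun_prop, ?_⟩
  rwa [hasFiniteIntegral_iff_ofReal]
  filter_upwards [ae_pos_of_Iic h0] with x hx
  positivity

lemma integrable_sub_one (h0 : ρ (Iic 0) = 0) (hρ : ∫⁻ u, ENNReal.ofReal (min u 1) ∂ρ < ⊤)
    {χ : ℝ → ℂ} (hχ : Measurable χ) {L : ℝ} (hL : ∀ x, 0 < x → ‖χ x - 1‖ ≤ L * min x 1) :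
    Integrable (fun x => χ x - 1) ρ := by
  refine ((integrable_min_one h0 hρ).const_mul L).mono' (hχ.sub_const 1).aestronglyMeasurable ?_
  filter_upwards [ae_pos_of_Iic h0] with x hx using hL x hx

lemma norm_cexp_sub_one_le (ξ : ℝ) {x : ℝ} (hx : 0 < x) :
    ‖Complex.exp (ξ * x * Complex.I) - 1‖ ≤ (|ξ| + 2) * min x 1 := by
  have h1 := Real.norm_exp_I_mul_ofReal_sub_one_le (x := ξ * x)
  have h2 : ‖Complex.exp (ξ * x * Complex.I) - 1‖ ≤ 2 := by
    refine (norm_sub_le _ _).trans ?_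
    rw [← Complex.ofReal_mul, Complex.norm_exp_ofReal_mul_I]
    norm_num
  rw [mul_comm Complex.I, Complex.ofReal_mul, norm_mul, Real.norm_eq_abs, Real.norm_eq_abs,
    abs_of_pos hx] at h1
  rcases le_total x 1 with h | h
  · rw [min_eq_left h]; nlinarith
  · rw [min_eq_right h]; linarith [abs_nonneg ξ]

lemma continuousAt_integral_cexp_sub_one (h0 : ρ (Iic 0) = 0)
    (hρ : ∫⁻ u, ENNReal.ofReal (min u 1) ∂ρ < ⊤) :
    ContinuousAt (fun ξ : ℝ => ∫ x, (Complex.exp (ξ * x * Complex.I) - 1) ∂ρ) 0 := by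
  refine continuousAt_of_dominated (bound := fun x => 3 * min x 1)
    (Eventually.of_forall fun ξ => by fun_prop) ?_ ((integrable_min_one h0 hρ).const_mul _)
    (ae_of_all _ fun x => by fun_prop)
  filter_upwards [Metric.ball_mem_nhds (0 : ℝ) one_pos] with ξ hξ
  filter_upwards [ae_pos_of_Iic h0] with x hx
  refine (norm_cexp_sub_one_le ξ hx).trans ?_
  rw [mem_ball_zero_iff, Real.norm_eq_abs] at hξ
  gcongr
  linarith

/-- Truncation of a measure on the half-line away from the origin. -/
noncomputable def truncMeasure (ρ : Measure ℝ) (n : ℕ) : Measure ℝ :=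
  ρ.restrict (Ioi (1 / (n + 1 : ℝ)))

/-- Markov's inequality: beyond the cut-off the function `min u 1` is bounded below. -/
lemma isFiniteMeasure_truncMeasure (hρ : ∫⁻ u, ENNReal.ofReal (min u 1) ∂ρ < ⊤) (n : ℕ) :
    IsFiniteMeasure (truncMeasure ρ n) := by
  refine ⟨?_⟩
  rw [truncMeasure, Measure.restrict_apply_univ]
  have hε : (0 : ℝ) < 1 / (n + 1) := by positivity
  have h1 : (1 / (n + 1) : ℝ) ≤ 1 := by
    rw [div_le_one (by positivity)]; linarith [Nat.cast_nonneg (α := ℝ) n]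
  have hε' : ENNReal.ofReal (1 / (n + 1)) ≠ 0 := by
    simp only [ne_eq, ENNReal.ofReal_eq_zero, not_le]; exact hε
  refine lt_of_le_of_lt (measure_mono fun x hx => ?_)
    ((meas_ge_le_lintegral_div (f := fun u => ENNReal.ofReal (min u 1)) (by fun_prop) hε'
      ENNReal.ofReal_ne_top).trans_lt (ENNReal.div_lt_top hρ.ne hε'))
  exact ENNReal.ofReal_le_ofReal (le_min (le_of_lt hx) h1)

lemma tendsto_integral_truncMeasure (h0 : ρ (Iic 0) = 0)
    {g : ℝ → ℂ} (hg : Integrable g ρ) :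
    Tendsto (fun n => ∫ x, g x ∂(truncMeasure ρ n)) atTop (𝓝 (∫ x, g x ∂ρ)) := by
  have hU : (⋃ n : ℕ, Ioi (1 / (n + 1 : ℝ))) = Ioi 0 := by
    ext x
    simp only [mem_iUnion, mem_Ioi]
    exact ⟨fun ⟨n, hn⟩ => lt_trans (by positivity) hn, fun hx => exists_nat_one_div_lt hx⟩
  have h1 := tendsto_setIntegral_of_monotone (μ := ρ) (f := g)
    (s := fun n : ℕ => Ioi (1 / (n + 1 : ℝ))) (fun n => measurableSet_Ioi)
    (fun a b hab => Ioi_subset_Ioi (by gcongr)) (by rw [hU]; exact hg.integrableOn)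
  rw [hU, Measure.restrict_eq_self_of_ae_mem (s := Ioi 0)
    (by rw [ae_iff]; simp only [mem_Ioi, not_lt]; exact h0)] at h1
  exact h1

/-- There is a subordinator with any given Lévy measure `ρ` on `(0, ∞)` and no drift. -/
theorem exists_subordinator (h0 : ρ (Iic 0) = 0)
    (hρ : ∫⁻ u, ENNReal.ofReal (min u 1) ∂ρ < ⊤) :
    ∃ η : ℝ≥0 → Measure ℝ, IsSubordinator η ∧ ∀ (t : ℝ≥0) (l : ℝ), 0 < l →
      ∫ s, Real.exp (-(l * s)) ∂(η t) =
        Real.exp (-(t * ∫ u, (1 - Real.exp (-(l * u))) ∂ρ)) := by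
  have hfin := isFiniteMeasure_truncMeasure hρ
  have hm (n : ℕ) : truncMeasure ρ n (Iio 0) = 0 :=
    measure_mono_null Iio_subset_Iic_self
      (nonpos_iff_eq_zero.1 ((Measure.restrict_apply_le _ _).trans h0.le))
  set Φ : ℝ → ℂ := fun ξ => ∫ x, (Complex.exp (ξ * x * Complex.I) - 1) ∂ρ
  have hΦ : ContinuousAt Φ 0 := continuousAt_integral_cexp_sub_one h0 hρ
  let P : ℝ≥0 → ℕ → ProbabilityMeasure ℝ := fun t n =>
    ⟨compoundPoisson (truncMeasure ρ n) t, inferInstance⟩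
  -- One limit statement serves twice: Fourier characters yield the limit law, and the Laplace
  -- kernel identifies its Laplace exponent.
  have hP (t : ℝ≥0) {χ : ℝ → ℂ} (hχ : Measurable χ) (hχ0 : χ 0 = 1)
      (hadd : ∀ x y, χ (x + y) = χ x * χ y) (hle : ∀ x, 0 ≤ x → ‖χ x‖ ≤ 1) {L : ℝ}
      (hL : ∀ x, 0 < x → ‖χ x - 1‖ ≤ L * min x 1) :
      Tendsto (fun n => ∫ x, χ x ∂(P t n : Measure ℝ)) atTop
        (𝓝 (Complex.exp (t * ∫ x, (χ x - 1) ∂ρ))) := by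
    simp only [P, ProbabilityMeasure.coe_mk, integral_compoundPoisson (hm _) hχ hχ0 hadd hle]
    exact (Complex.continuous_exp.tendsto _).comp
      ((tendsto_integral_truncMeasure h0 (integrable_sub_one h0 hρ hχ hL)).const_mul _)
  have hex (t : ℝ≥0) : ∃ μ₀ : ProbabilityMeasure ℝ,
      (∀ ξ, charFun (μ₀ : Measure ℝ) ξ = Complex.exp (t * Φ ξ)) ∧
      Tendsto (P t) atTop (𝓝 μ₀) := by
    refine exists_tendsto_of_tendsto_charFun
      (Complex.continuous_exp.continuousAt.comp (hΦ.const_mul _)) fun ξ => ?_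
    simp_rw [charFun_apply_real]
    refine hP t (by fun_prop) (by simp) (fun x y => ?_) (fun x _ => ?_)
      fun x hx => norm_cexp_sub_one_le ξ hx
    · rw [← Complex.exp_add]; push_cast; ring_nf
    · rw [← Complex.ofReal_mul, Complex.norm_exp_ofReal_mul_I]
  choose η hη hηlim using hex
  -- The open half-line stays null in the weak limit, by the portmanteau inequality.
  have hη0 (t : ℝ≥0) : (η t : Measure ℝ) (Iio 0) = 0 := by
    refine nonpos_iff_eq_zero.1
      ((ProbabilityMeasure.le_liminf_measure_open_of_tendsto (hηlim t) isOpen_Iio).trans ?_)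
    simp [P, compoundPoisson_Iio_zero (hm _)]
  refine ⟨fun t => η t, ⟨isConvolutionSemigroup_of_charFun (fun t => inferInstance) hη, hη0⟩,
    fun t l hl => ?_⟩
  -- The maximum with `0` makes the Laplace kernel bounded on the whole line without changing it on
  -- the support.
  let f : ℝ →ᵇ ℝ := BoundedContinuousFunction.ofNormedAddCommGroup
    (fun x => Real.exp (-(l * max x 0))) (by fun_prop) 1 fun x => by
      rw [Real.norm_of_nonneg (Real.exp_pos _).le, Real.exp_le_one_iff]
      have : 0 ≤ l * max x 0 := by positivity
      linarith
  have hf (μ : Measure ℝ) (h : μ (Iio 0) = 0) : ∫ x, f x ∂μ = ∫ x, Real.exp (-(l * x)) ∂μ := by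
    refine integral_congr_ae ?_
    filter_upwards [ae_nonneg_of_Iio h] with x hx
    simp [f, max_eq_left hx]
  have h1 := ProbabilityMeasure.tendsto_iff_forall_integral_tendsto.1 (hηlim t) f
  rw [hf _ (hη0 t)] at h1
  simp_rw [fun n => hf (P t n : Measure ℝ) (compoundPoisson_Iio_zero (hm n) t)] at h1
  have h2 := hP t (χ := fun x => ((Real.exp (-(l * x)) : ℝ) : ℂ)) (L := l + 1) (by fun_prop)
    (by simp) (fun x y => by rw [← Complex.ofReal_mul, ← Real.exp_add]; ring_nf)
    (fun x hx => by
      rw [Complex.norm_real, Real.norm_of_nonneg (Real.exp_pos _).le, Real.exp_le_one_iff]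
      have : 0 ≤ l * x := by positivity
      linarith)
    (fun x hx => by
      have h3 := Real.add_one_le_exp (-(l * x))
      have h4 := Real.exp_pos (-(l * x))
      have h5 : Real.exp (-(l * x)) ≤ 1 := by
        rw [Real.exp_le_one_iff]
        have : 0 ≤ l * x := by positivity
        linarith
      rw [← Complex.ofReal_one, ← Complex.ofReal_sub, Complex.norm_real, Real.norm_eq_abs,
        abs_sub_comm, abs_of_nonneg (by linarith)]
      rcases le_total x 1 with h | h
      · rw [min_eq_left h]; nlinarith
      · rw [min_eq_right h]; linarith)
  simp_rw [integral_complex_ofReal] at h2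
  have h3 : ∫ x, (((Real.exp (-(l * x)) : ℝ) : ℂ) - 1) ∂ρ =
      ((-∫ u, (1 - Real.exp (-(l * u))) ∂ρ : ℝ) : ℂ) := by
    rw [← integral_neg, ← integral_complex_ofReal]
    refine integral_congr_ae (ae_of_all _ fun x => ?_)
    push_cast
    ring
  rw [h3, ← Complex.ofReal_mul, ← Complex.ofReal_exp] at h2
  have h4 := (Complex.continuous_re.tendsto _).comp h2
  simp only [Function.comp_def, Complex.ofReal_re] at h4
  rw [tendsto_nhds_unique h1 h4, mul_neg]

end Subordinator

/-! ### The complete Bernstein function of a weakly scaling function -/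

section CompleteBernstein

variable {α β c C : ℝ} {ψ : ℝ → ℝ}

/-- A mixture of the exponentials `u ↦ exp(-uv²)`: each derivative brings down a factor `-v²`, so
the signs alternate. -/
lemma isCompletelyMonotone_mgf_neg_sq {μ : Measure ℝ}
    (hμ : ∀ u, 0 < u → Integrable (fun v : ℝ => Real.exp (u * -v ^ 2)) μ) :
    IsCompletelyMonotone (mgf (fun v => -v ^ 2) μ) := by
  have hsub : Ioi (0 : ℝ) ⊆ interior (integrableExpSet (fun v : ℝ => -v ^ 2) μ) :=
    (isOpen_Ioi.subset_interior_iff).2 fun u hu => hμ u hu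
  refine ⟨(analyticOn_mgf.mono hsub).contDiffOn (uniqueDiffOn_Ioi 0), fun n u hu => ?_⟩
  rw [iteratedDerivWithin_of_isOpen isOpen_Ioi hu, iteratedDeriv_mgf (hsub hu),
    ← integral_const_mul]
  refine integral_nonneg fun v => ?_
  simp only [Pi.zero_apply]
  rw [← mul_assoc, ← mul_pow]
  simp only [neg_mul_neg, one_mul]
  positivity

/-- The measure `2 v ψ(v) dv` on the half-line. -/
noncomputable def mixingMeasure (ψ : ℝ → ℝ) : Measure ℝ :=
  (volume.restrict (Ioi 0)).withDensity (fun v => ENNReal.ofReal (2 * v * ψ v))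

lemma HasWeakScaling.aemeasurable_mixing (hψ : HasWeakScaling α β c C ψ) :
    AEMeasurable (fun v => ENNReal.ofReal (2 * v * ψ v)) (volume.restrict (Ioi 0)) := by
  have : AEMeasurable ψ (volume.restrict (Ioi (0 : ℝ))) :=
    (hψ.cont.mono Ioi_subset_Ici_self).aemeasurable measurableSet_Ioi
  fun_prop

lemma HasWeakScaling.integrable_exp_mixing (hψ : HasWeakScaling α β c C ψ) {u : ℝ} (hu : 0 < u) :
    Integrable (fun v : ℝ => Real.exp (u * -v ^ 2)) (mixingMeasure ψ) := by
  have hc := hψ.c_pos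
  have hC := hψ.C_pos
  have hmeas : AEMeasurable ψ (volume.restrict (Ioi (0 : ℝ))) :=
    (hψ.cont.mono Ioi_subset_Ici_self).aemeasurable measurableSet_Ioi
  rw [mixingMeasure, integrable_withDensity_iff_integrable_smul₀' hψ.aemeasurable_mixing
    (ae_of_all _ fun _ => ENNReal.ofReal_lt_top)]
  have h1 := integrableOn_rpow_mul_exp_neg_mul_sq hu (s := 1) (by norm_num)
  have h3 := integrableOn_rpow_mul_exp_neg_mul_sq hu (s := 3) (by norm_num)
  have hm : AEMeasurable (fun v : ℝ => (ENNReal.ofReal (2 * v * ψ v)).toReal •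
      Real.exp (u * -v ^ 2)) (volume.restrict (Ioi 0)) := by fun_prop
  refine ((h1.const_mul (2 * c⁻¹ * ψ 1)).add (h3.const_mul (2 * C * ψ 1))).mono'
    hm.aestronglyMeasurable ?_
  filter_upwards [ae_restrict_mem measurableSet_Ioi] with v hv
  have hv : 0 < v := hv
  have hψv := hψ.pos v hv
  have hb := hψ.le_add_sq one_pos hv.le
  rw [mul_one] at hb
  rw [ENNReal.toReal_ofReal (by positivity), smul_eq_mul, Real.norm_of_nonneg (by positivity)]
  calc 2 * v * ψ v * Real.exp (u * -v ^ 2)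
      ≤ 2 * v * ((c⁻¹ + C * v ^ 2) * ψ 1) * Real.exp (u * -v ^ 2) := by gcongr
    _ = _ := by
      simp only [Pi.add_apply]
      rw [show u * -v ^ 2 = -u * v ^ 2 by ring, Real.rpow_one,
        show v ^ (3 : ℝ) = v ^ 3 by norm_cast]
      ring

lemma lintegral_exp_mul_one_sub_exp {l w : ℝ} (hl : 0 < l) (hw : 0 < w) :
    ∫⁻ u in Ioi (0 : ℝ), ENNReal.ofReal (Real.exp (u * -w)) *
      ENNReal.ofReal (1 - Real.exp (-(l * u))) = ENNReal.ofReal (l / (w * (w + l))) := by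
  have h1 := integrableOn_exp_mul_Ioi (neg_neg_of_pos hw) 0
  have h2 := integrableOn_exp_mul_Ioi (neg_neg_of_pos (add_pos hw hl)) 0
  have key : ∫⁻ u in Ioi (0 : ℝ), ENNReal.ofReal (Real.exp (u * -w)) *
      ENNReal.ofReal (1 - Real.exp (-(l * u))) =
      ∫⁻ u in Ioi (0 : ℝ), ENNReal.ofReal (Real.exp (-w * u) - Real.exp (-(w + l) * u)) := by
    refine lintegral_congr fun u => ?_
    rw [← ENNReal.ofReal_mul (Real.exp_pos _).le, mul_sub, ← Real.exp_add, mul_one]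
    ring_nf
  rw [key, ← ofReal_integral_eq_lintegral_ofReal (f := fun u => Real.exp (-w * u) -
    Real.exp (-(w + l) * u)) (h1.sub h2), integral_sub h1 h2,
    integral_exp_mul_Ioi (neg_neg_of_pos hw), integral_exp_mul_Ioi (neg_neg_of_pos (add_pos hw hl))]
  · congr 1
    simp only [mul_zero, Real.exp_zero]
    field_simp
    ring
  · filter_upwards [ae_restrict_mem measurableSet_Ioi] with u hu
    have hu : 0 < u := hu
    simp only [Pi.zero_apply, sub_nonneg]
    exact Real.exp_le_exp.2 (by nlinarith)

/-- By Tonelli, each exponential of rate `w = v²` contributes `1/w - 1/(w + l)`. The density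
`2vψ(v)` of the mixing measure corresponds to the density `ψ(√w)` in the variable `w`. -/
lemma HasWeakScaling.lintegral_mgf_mul (hψ : HasWeakScaling α β c C ψ) {l : ℝ} (hl : 0 < l) :
    ∫⁻ u in Ioi (0 : ℝ), ENNReal.ofReal (mgf (fun v => -v ^ 2) (mixingMeasure ψ) u) *
      ENNReal.ofReal (1 - Real.exp (-(l * u))) =
    ∫⁻ v in Ioi (0 : ℝ), ENNReal.ofReal (2 * ψ v * l / (v * (v ^ 2 + l))) := by
  have hs : SFinite (mixingMeasure ψ) := by unfold mixingMeasure; infer_instance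
  calc _ = ∫⁻ u in Ioi (0 : ℝ), ∫⁻ v, ENNReal.ofReal (Real.exp (u * -v ^ 2)) *
        ENNReal.ofReal (1 - Real.exp (-(l * u))) ∂(mixingMeasure ψ) := by
        refine setLIntegral_congr_fun measurableSet_Ioi fun u hu => ?_
        rw [lintegral_mul_const _ (by fun_prop), mgf,
          ofReal_integral_eq_lintegral_ofReal (hψ.integrable_exp_mixing hu)
            (ae_of_all _ fun v => (Real.exp_pos _).le)]
    _ = ∫⁻ v, (∫⁻ u in Ioi (0 : ℝ), ENNReal.ofReal (Real.exp (u * -v ^ 2)) *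
        ENNReal.ofReal (1 - Real.exp (-(l * u)))) ∂(mixingMeasure ψ) :=
        lintegral_lintegral_swap (by fun_prop)
    _ = _ := by
        have hm : Measurable (fun v : ℝ => ∫⁻ u in Ioi (0 : ℝ),
            ENNReal.ofReal (Real.exp (u * -v ^ 2)) * ENNReal.ofReal (1 - Real.exp (-(l * u)))) :=
          Measurable.lintegral_prod_right' (f := fun z : ℝ × ℝ =>
            ENNReal.ofReal (Real.exp (z.2 * -z.1 ^ 2)) *
              ENNReal.ofReal (1 - Real.exp (-(l * z.2)))) (by fun_prop)
        rw [mixingMeasure, lintegral_withDensity_eq_lintegral_mul₀ hψ.aemeasurable_mixing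
          hm.aemeasurable]
        refine setLIntegral_congr_fun measurableSet_Ioi fun v hv => ?_
        have hv : 0 < v := hv
        have := hψ.pos v hv
        simp only [Pi.mul_apply]
        rw [lintegral_exp_mul_one_sub_exp hl (by positivity),
          ← ENNReal.ofReal_mul (by positivity)]
        congr 1
        field_simp

/-- The kernel is at most `1/v` below `s` and at most `s²/v³` above. Against the scaling bounds for
`ψ(v)/ψ(s)` these integrate because `α > 0` and `β < 2` respectively. -/
lemma HasWeakScaling.lintegral_transform_le (hψ : HasWeakScaling α β c C ψ) {s : ℝ}
    (hs : 0 < s) :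
    ∫⁻ v in Ioi (0 : ℝ), ENNReal.ofReal (2 * ψ v * s ^ 2 / (v * (v ^ 2 + s ^ 2))) ≤
      ENNReal.ofReal ((2 * c⁻¹ / α + 2 * C / (2 - β)) * ψ s) := by
  have hα := hψ.alpha_pos
  have hβ := hψ.beta_lt
  have hc := hψ.c_pos
  have hC := hψ.C_pos
  have hψs := hψ.pos s hs
  have hsα := Real.rpow_pos_of_pos hs α
  have hsβ := Real.rpow_pos_of_pos hs β
  have hβ' : 0 < 2 - β := by linarith
  rw [← Ioc_union_Ioi_eq_Ioi hs.le, lintegral_union measurableSet_Ioi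
    (Ioc_disjoint_Ioi le_rfl), add_mul, ENNReal.ofReal_add (by positivity) (by positivity)]
  gcongr
  · have hint : IntegrableOn (fun v : ℝ => v ^ (α - 1)) (Ioc 0 s) := by
      rw [← intervalIntegrable_iff_integrableOn_Ioc_of_le hs.le]
      exact intervalIntegral.intervalIntegrable_rpow' (by linarith)
    have hI : ∫ v in Ioc 0 s, v ^ (α - 1) = s ^ α / α := by
      rw [← intervalIntegral.integral_of_le hs.le, integral_rpow (Or.inl (by linarith))]
      simp [Real.zero_rpow hα.ne']
    calc _ ≤ ∫⁻ v in Ioc 0 s, ENNReal.ofReal (2 * c⁻¹ * (s ^ α)⁻¹ * ψ s * v ^ (α - 1)) := by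
          refine setLIntegral_mono' measurableSet_Ioc fun v hv => ENNReal.ofReal_le_ofReal ?_
          have hv0 : 0 < v := hv.1
          have hb := hψ.le_of_le_one hs (div_pos hv0 hs) ((div_le_one hs).2 hv.2)
          rw [div_mul_cancel₀ _ hs.ne', Real.div_rpow hv0.le hs.le] at hb
          have hψv := hψ.pos v hv0
          calc 2 * ψ v * s ^ 2 / (v * (v ^ 2 + s ^ 2)) ≤ 2 * ψ v * s ^ 2 / (v * s ^ 2) := by
                gcongr; nlinarith
            _ = 2 * ψ v / v := by field_simp
            _ ≤ 2 * (c⁻¹ * (v ^ α / s ^ α) * ψ s) / v := by gcongr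
            _ = _ := by rw [Real.rpow_sub_one hv0.ne']; field_simp
      _ = ENNReal.ofReal (2 * c⁻¹ / α * ψ s) := by
          rw [← ofReal_integral_eq_lintegral_ofReal (hint.const_mul _), integral_const_mul, hI]
          · congr 1; field_simp
          · filter_upwards [ae_restrict_mem measurableSet_Ioc] with v hv
            have := Real.rpow_nonneg hv.1.le (α - 1)
            simp only [Pi.zero_apply]; positivity
      _ ≤ _ := le_rfl
  · have hint : IntegrableOn (fun v : ℝ => v ^ (β - 3)) (Ioi s) :=
      integrableOn_Ioi_rpow_of_lt (by linarith) hs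
    have hI : ∫ v in Ioi s, v ^ (β - 3) = s ^ β / (s ^ 2 * (2 - β)) := by
      rw [integral_Ioi_rpow_of_lt (by linarith) hs, show β - 3 + 1 = β - (2 : ℕ) by
        push_cast; ring, Real.rpow_sub_natCast hs.ne', ← neg_div_neg_eq, neg_neg, div_div]
      push_cast
      ring_nf
    calc _ ≤ ∫⁻ v in Ioi s, ENNReal.ofReal (2 * C * s ^ 2 * (s ^ β)⁻¹ * ψ s * v ^ (β - 3)) := by
          refine setLIntegral_mono' measurableSet_Ioi fun v hv => ENNReal.ofReal_le_ofReal ?_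
          have hv : s < v := hv
          have hv0 : 0 < v := hs.trans hv
          have hb := hψ.le_of_one_le hs ((one_le_div hs).2 hv.le)
          rw [div_mul_cancel₀ _ hs.ne', Real.div_rpow hv0.le hs.le] at hb
          have hψv := hψ.pos v hv0
          calc 2 * ψ v * s ^ 2 / (v * (v ^ 2 + s ^ 2)) ≤ 2 * ψ v * s ^ 2 / (v * v ^ 2) := by
                gcongr; nlinarith
            _ ≤ 2 * (C * (v ^ β / s ^ β) * ψ s) * s ^ 2 / (v * v ^ 2) := by gcongr
            _ = _ := by
                rw [show β - 3 = β - (3 : ℕ) by push_cast; ring, Real.rpow_sub_natCast hv0.ne']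
                field_simp
      _ = ENNReal.ofReal (2 * C / (2 - β) * ψ s) := by
          rw [← ofReal_integral_eq_lintegral_ofReal (hint.const_mul _), integral_const_mul, hI]
          · congr 1; field_simp
          · filter_upwards [ae_restrict_mem measurableSet_Ioi] with v hv
            have := Real.rpow_nonneg (hs.trans hv).le (β - 3)
            simp only [Pi.zero_apply]; positivity

/-- The interval `(s, 2s]` suffices: there `ψ(v) ≥ cψ(s)` and `v(v² + s²) ≤ 10s³`. -/
lemma HasWeakScaling.le_lintegral_transform (hψ : HasWeakScaling α β c C ψ) {s : ℝ}
    (hs : 0 < s) :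
    ENNReal.ofReal (c / 5 * ψ s) ≤
      ∫⁻ v in Ioi (0 : ℝ), ENNReal.ofReal (2 * ψ v * s ^ 2 / (v * (v ^ 2 + s ^ 2))) := by
  have hc := hψ.c_pos
  have hψs := hψ.pos s hs
  calc ENNReal.ofReal (c / 5 * ψ s) = ∫⁻ v in Ioc s (2 * s), ENNReal.ofReal (c * ψ s / (5 * s)) := by
        rw [setLIntegral_const, Real.volume_Ioc, ← ENNReal.ofReal_mul (by positivity)]
        congr 1; field_simp; ring
    _ ≤ ∫⁻ v in Ioc s (2 * s), ENNReal.ofReal (2 * ψ v * s ^ 2 / (v * (v ^ 2 + s ^ 2))) := by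
        refine setLIntegral_mono' measurableSet_Ioc fun v hv => ENNReal.ofReal_le_ofReal ?_
        have hv0 : 0 < v := hs.trans hv.1
        have h2 : v ≤ 2 * s := hv.2
        have hb : c * ψ s ≤ ψ v := by
          have := hψ.ge_of_one_le hs ((one_le_div hs).2 hv.1.le)
          rw [div_mul_cancel₀ _ hs.ne'] at this
          refine le_trans ?_ this
          have := Real.one_le_rpow ((one_le_div hs).2 hv.1.le) hψ.alpha_pos.le
          gcongr
          nlinarith
        calc c * ψ s / (5 * s) = 2 * (c * ψ s) * s ^ 2 / (2 * s * ((2 * s) ^ 2 + s ^ 2)) := by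
              field_simp; ring
          _ ≤ _ := by
              have := hψ.pos v hv0
              gcongr
    _ ≤ _ := lintegral_mono_set fun v hv => hs.trans hv.1

lemma min_one_le_two_mul_one_sub_exp {u : ℝ} (hu : 0 ≤ u) :
    min u 1 ≤ 2 * (1 - Real.exp (-u)) := by
  have h1 : Real.exp (-u) ≤ (1 + u)⁻¹ := by
    rw [Real.exp_neg]
    gcongr
    linarith [Real.add_one_le_exp u]
  have h2 : min u 1 ≤ 2 * (1 - (1 + u)⁻¹) := by
    have : 2 * (1 - (1 + u)⁻¹) = 2 * u / (1 + u) := by field_simp; ring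
    rw [this, le_div_iff₀ (by linarith)]
    rcases le_total u 1 with h | h
    · rw [min_eq_left h]; nlinarith
    · rw [min_eq_right h]; linarith
  linarith

/-- A weakly scaling function is comparable with `u ↦ φ (u ^ 2)` for a complete Bernstein function
`φ` without drift and killing. -/
theorem exists_isCompletelyMonotone_comparable (hψ : HasWeakScaling α β c C ψ) :
    ∃ m : ℝ → ℝ, IsCompletelyMonotone m ∧ (∀ u, 0 ≤ m u) ∧
      (∫⁻ u in Ioi (0 : ℝ), ENNReal.ofReal (m u) * ENNReal.ofReal (min u 1) < ⊤) ∧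
      ∃ K, 0 < K ∧ ∀ s, 0 < s →
        ENNReal.ofReal (K⁻¹ * ψ s) ≤ ∫⁻ u in Ioi (0 : ℝ), ENNReal.ofReal (m u) *
          ENNReal.ofReal (1 - Real.exp (-(s ^ 2 * u))) ∧
        ∫⁻ u in Ioi (0 : ℝ), ENNReal.ofReal (m u) *
          ENNReal.ofReal (1 - Real.exp (-(s ^ 2 * u))) ≤ ENNReal.ofReal (K * ψ s) := by
  have hα := hψ.alpha_pos
  have hβ : 0 < 2 - β := sub_pos.2 hψ.beta_lt
  have hc := hψ.c_pos
  have hC := hψ.C_pos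
  refine ⟨mgf (fun v => -v ^ 2) (mixingMeasure ψ), isCompletelyMonotone_mgf_neg_sq fun u hu =>
    hψ.integrable_exp_mixing hu, fun u => mgf_nonneg, ?_,
    max (2 * c⁻¹ / α + 2 * C / (2 - β)) (5 / c), by positivity, fun s hs => ?_⟩
  -- Finiteness of the transform at `l = 1` is the Lévy condition, since `min u 1 ≤ 2(1 - exp(-u))`.
  · have h1 := hψ.lintegral_transform_le one_pos
    rw [← hψ.lintegral_mgf_mul (by norm_num)] at h1
    refine lt_of_le_of_lt (b := 2 * ENNReal.ofReal ((2 * c⁻¹ / α + 2 * C / (2 - β)) * ψ 1)) ?_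
      (ENNReal.mul_lt_top (by simp) ENNReal.ofReal_lt_top)
    refine le_trans ?_ (mul_le_mul_right h1 2)
    rw [← lintegral_const_mul' _ _ (by simp)]
    refine setLIntegral_mono' measurableSet_Ioi fun u hu => ?_
    rw [mul_left_comm]
    gcongr
    rw [← ENNReal.ofReal_ofNat 2, ← ENNReal.ofReal_mul zero_le_two]
    refine ENNReal.ofReal_le_ofReal ?_
    simpa using min_one_le_two_mul_one_sub_exp (le_of_lt hu)
  · have hψs := hψ.pos s hs
    rw [hψ.lintegral_mgf_mul (by positivity)]
    refine ⟨(ENNReal.ofReal_le_ofReal ?_).trans (hψ.le_lintegral_transform hs),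
      (hψ.lintegral_transform_le hs).trans (ENNReal.ofReal_le_ofReal ?_)⟩
    · gcongr
      rw [← inv_div 5 c]
      gcongr
      exact le_max_right _ _
    · gcongr
      exact le_max_left _ _

end CompleteBernstein

/-! ### Radial characteristic exponents -/

section CharExponent

variable {d : ℕ} {p : ℝ≥0 → Measure (EuclideanSpace ℝ (Fin d))} {ψ : ℝ → ℝ}

lemma IsCharExponent.norm_charFun_one (hψ : IsCharExponent p (fun ξ => ψ ‖ξ‖))
    (ξ : EuclideanSpace ℝ (Fin d)) : ‖charFun (p 1) ξ‖ = Real.exp (-ψ ‖ξ‖) := by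
  rw [hψ 1 ξ, Complex.norm_exp]
  simp

/-- Evaluation along a coordinate axis recovers `ψ` on `[0, ∞)` from a single law, which gives its
sign and continuity. -/
lemma IsCharExponent.eq_neg_log (hd : 1 ≤ d) (hψ : IsCharExponent p (fun ξ => ψ ‖ξ‖)) {u : ℝ}
    (hu : 0 ≤ u) :
    ψ u = -Real.log ‖charFun (p 1) (u • EuclideanSpace.single (⟨0, hd⟩ : Fin d) (1 : ℝ))‖ := by
  rw [hψ.norm_charFun_one, Real.log_exp, neg_neg, norm_smul, Real.norm_of_nonneg hu]
  simp

lemma IsCharExponent.apply_zero (hp : ∀ t, IsProbabilityMeasure (p t))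
    (hψ : IsCharExponent p (fun ξ => ψ ‖ξ‖)) : ψ 0 = 0 := by
  have h := hψ.norm_charFun_one 0
  have := hp 1
  simp only [charFun_zero, probReal_univ, Complex.ofReal_one, norm_one, norm_zero] at h
  rw [eq_comm, Real.exp_eq_one_iff] at h
  linarith

lemma IsCharExponent.apply_nonneg (hd : 1 ≤ d) (hp : ∀ t, IsProbabilityMeasure (p t))
    (hψ : IsCharExponent p (fun ξ => ψ ‖ξ‖)) {u : ℝ} (hu : 0 ≤ u) : 0 ≤ ψ u := by
  have := hp 1
  rw [hψ.eq_neg_log hd hu, neg_nonneg]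
  exact Real.log_nonpos (norm_nonneg _) (norm_charFun_le_one _)

lemma IsCharExponent.continuousOn (hd : 1 ≤ d) (hp : ∀ t, IsProbabilityMeasure (p t))
    (hψ : IsCharExponent p (fun ξ => ψ ‖ξ‖)) : ContinuousOn ψ (Ici 0) := by
  have := hp 1
  have h : Continuous (fun u : ℝ =>
      -Real.log ‖charFun (p 1) (u • EuclideanSpace.single (⟨0, hd⟩ : Fin d) (1 : ℝ))‖) := by
    refine (Continuous.log (by fun_prop) fun u => ?_).neg
    rw [hψ.norm_charFun_one]
    exact (Real.exp_pos _).ne'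
  exact h.continuousOn.congr fun u hu => hψ.eq_neg_log hd hu

end CharExponent

/-! ### Subordination of Brownian motion -/

section Subordination

variable {d : ℕ} {μ : Measure ℝ}

/-- The mixture `∫ (heatMeasure d s) μ(ds)`. -/
noncomputable def subordinate (d : ℕ) (μ : Measure ℝ) : Measure (EuclideanSpace ℝ (Fin d)) :=
  (μ.prod (stdGaussian (EuclideanSpace ℝ (Fin d)))).map (fun z => √(2 * z.1) • z.2)

instance [SFinite μ] : SFinite (subordinate d μ) := by unfold subordinate; infer_instance

instance [IsProbabilityMeasure μ] : IsProbabilityMeasure (subordinate d μ) :=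
  Measure.isProbabilityMeasure_map (by fun_prop)

lemma lintegral_subordinate {f : EuclideanSpace ℝ (Fin d) → ℝ≥0∞} (hf : Measurable f) :
    ∫⁻ x, f x ∂(subordinate d μ) = ∫⁻ s, (∫⁻ x, f x ∂(heatMeasure d s)) ∂μ := by
  rw [subordinate, lintegral_map hf (by fun_prop), lintegral_prod _ (by fun_prop)]
  refine lintegral_congr fun s => ?_
  rw [heatMeasure, lintegral_map hf (by fun_prop)]

lemma subordinate_apply {A : Set (EuclideanSpace ℝ (Fin d))} (hA : MeasurableSet A) :
    subordinate d μ A = ∫⁻ s, heatMeasure d s A ∂μ := by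
  rw [← lintegral_indicator_one hA, lintegral_subordinate (measurable_one.indicator hA)]
  simp_rw [lintegral_indicator_one hA]

lemma map_neg_heatMeasure (s : ℝ) :
    (heatMeasure d s).map (fun x => -x) = heatMeasure d s := by
  rcases le_or_gt s 0 with hs | hs
  · rw [heatMeasure_of_nonpos hs, Measure.map_dirac' measurable_neg, neg_zero]
  · rw [heatMeasure_eq_withDensity hs]
    exact map_neg_withDensity_norm (fun r => ENNReal.ofReal (heatKernel d s r))

lemma map_neg_subordinate : (subordinate d μ).map (fun x => -x) = subordinate d μ := by
  ext A hA
  rw [Measure.map_apply measurable_neg hA, subordinate_apply hA,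
    subordinate_apply (measurable_neg hA)]
  refine lintegral_congr fun s => ?_
  rw [← Measure.map_apply measurable_neg hA]
  exact congrArg (· A) (map_neg_heatMeasure s)

lemma subordinate_singleton_zero (hd : 1 ≤ d) (h0 : μ (Iic 0) = 0) :
    subordinate d μ {0} = 0 := by
  have : Nonempty (Fin d) := ⟨⟨0, hd⟩⟩
  rw [subordinate_apply (measurableSet_singleton _), lintegral_eq_zero_iff' ?_]
  · filter_upwards [ae_pos_of_Iic h0] with s hs
    rw [heatMeasure_eq_withDensity hs]
    exact withDensity_absolutelyContinuous _ _ (by simp)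
  · refine AEMeasurable.congr (f := fun _ => 0) (by fun_prop) ?_
    filter_upwards [ae_pos_of_Iic h0] with s hs
    rw [heatMeasure_eq_withDensity hs]
    exact (withDensity_absolutelyContinuous _ _ (by simp)).symm

/-- Allows infinite `μ`: for the Lévy measure of a subordinator, the mixture is the Lévy measure of
the subordinate process. -/
lemma hasSymbol_subordinate (h0 : ∀ᵐ s ∂μ, 0 ≤ s) {Ψ : ℝ → ℝ}
    (h : ∀ u, 0 ≤ u → ∫⁻ s, ENNReal.ofReal (1 - Real.exp (-(u ^ 2 * s))) ∂μ =
      ENNReal.ofReal (Ψ u)) : HasSymbol (subordinate d μ) Ψ := by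
  intro ξ
  rw [lintegral_subordinate (by fun_prop), ← h _ (norm_nonneg _)]
  refine lintegral_congr_ae ?_
  filter_upwards [h0] with s hs
  rw [lintegral_one_sub_cos_of_charFun (a := Real.exp (-(s * ‖ξ‖ ^ 2)))
    (by rw [charFun_heatMeasure hs]; push_cast; rfl), mul_comm s]

lemma charFun_subordinate [IsProbabilityMeasure μ] (h0 : ∀ᵐ s ∂μ, 0 ≤ s)
    (ξ : EuclideanSpace ℝ (Fin d)) :
    charFun (subordinate d μ) ξ = ((∫ s, Real.exp (-(‖ξ‖ ^ 2 * s)) ∂μ : ℝ) : ℂ) := by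
  have hm : Measurable (fun z : ℝ × EuclideanSpace ℝ (Fin d) => √(2 * z.1) • z.2) := by fun_prop
  rw [charFun_apply, subordinate, integral_map hm.aemeasurable
    (by fun_prop), integral_prod, ← integral_complex_ofReal]
  · refine integral_congr_ae ?_
    filter_upwards [h0] with s hs
    have h1 := charFun_heatMeasure hs ξ
    rw [charFun_apply, heatMeasure, integral_map (by fun_prop) (by fun_prop)] at h1
    rw [h1, mul_comm s]
    push_cast
    rfl
  · refine (integrable_const (1 : ℝ)).mono' (by fun_prop) (ae_of_all _ fun z => ?_)
    rw [Complex.norm_exp_ofReal_mul_I]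

lemma subordinate_restrict_compl_zero [SFinite μ] (h0 : ∀ᵐ s ∂μ, 0 ≤ s) :
    (subordinate d μ).restrict {0}ᶜ = (volume.restrict {0}ᶜ).withDensity
      (fun x => ∫⁻ s in Ioi 0, ENNReal.ofReal (heatKernel d s ‖x‖) ∂μ) := by
  have hk : Measurable (fun z : ℝ × EuclideanSpace ℝ (Fin d) =>
      ENNReal.ofReal (heatKernel d z.1 ‖z.2‖)) :=
    (measurable_heatKernel.comp (measurable_fst.prodMk (measurable_norm.comp
      measurable_snd))).ennreal_ofReal
  ext A hA
  have hA0 : MeasurableSet (A ∩ {0}ᶜ) := hA.inter (measurableSet_singleton _).compl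
  rw [Measure.restrict_apply hA, subordinate_apply hA0, withDensity_apply _ hA,
    Measure.restrict_restrict hA, ← lintegral_lintegral_swap hk.aemeasurable,
    ← lintegral_indicator measurableSet_Ioi]
  refine lintegral_congr_ae ?_
  filter_upwards [h0] with s hs
  rcases hs.eq_or_lt with rfl | hs
  · simp [heatMeasure_of_nonpos le_rfl]
  · rw [indicator_of_mem (show s ∈ Ioi 0 from hs), heatMeasure_eq_withDensity hs,
      withDensity_apply _ hA0]

/-- Heat kernels decrease in the radius, hence so does their mixture `F`. It is finite because
`F(r)` times the volume of the ball of radius `r` is at most the total mass; time zero only produces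
an atom at the origin. -/
lemma isIsotropicUnimodal_subordinate (hd : 1 ≤ d) [IsProbabilityMeasure μ]
    (h0 : ∀ᵐ s ∂μ, 0 ≤ s) : IsIsotropicUnimodal (subordinate d μ) := by
  have : Nonempty (Fin d) := ⟨⟨0, hd⟩⟩
  set F : ℝ → ℝ≥0∞ := fun r => ∫⁻ s in Ioi 0, ENNReal.ofReal (heatKernel d s r) ∂μ
  have hres : (subordinate d μ).restrict {0}ᶜ = (volume.restrict {0}ᶜ).withDensity
    (fun x => F ‖x‖) := subordinate_restrict_compl_zero h0
  have hF : ∀ r r', 0 ≤ r → r ≤ r' → F r' ≤ F r := fun r r' hr h =>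
    setLIntegral_mono' measurableSet_Ioi fun s hs =>
      ENNReal.ofReal_le_ofReal (heatKernel_le (le_of_lt hs) hr h)
  have hfin : ∀ r, 0 < r → F r < ⊤ := fun r hr => by
    have h1 : F r * volume (Metric.ball (0 : EuclideanSpace ℝ (Fin d)) r) ≤ 1 := by
      calc F r * volume (Metric.ball (0 : EuclideanSpace ℝ (Fin d)) r)
          = ∫⁻ x in Metric.ball (0 : EuclideanSpace ℝ (Fin d)) r, F r := by
            rw [setLIntegral_const]
        _ ≤ ∫⁻ x in Metric.ball (0 : EuclideanSpace ℝ (Fin d)) r, F ‖x‖ :=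
            setLIntegral_mono' measurableSet_ball fun x hx => hF _ _ (norm_nonneg _)
              (mem_ball_zero_iff.1 hx).le
        _ = ((subordinate d μ).restrict {0}ᶜ) (Metric.ball 0 r) := by
            rw [hres, volume_restrict_compl_zero hd, withDensity_apply _ measurableSet_ball]
        _ ≤ 1 := prob_le_one.trans' (Measure.restrict_apply_le _ _)
    by_contra h
    rw [not_lt, top_le_iff] at h
    rw [h, ENNReal.top_mul (Metric.measure_ball_pos _ _ hr).ne'] at h1
    simp at h1
  refine ⟨fun r => (F r).toReal, fun r _ => ENNReal.toReal_nonneg, fun r hr r' hr' h =>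
    ENNReal.toReal_mono (hfin r hr).ne (hF _ _ (le_of_lt hr) h), ?_⟩
  rw [hres]
  refine withDensity_congr_ae ?_
  filter_upwards [ae_restrict_mem (measurableSet_singleton _).compl] with x hx
  rw [ENNReal.ofReal_toReal (hfin _ (norm_pos_iff.2 hx)).ne]

end Subordination

/-! ### A complete subordinate Brownian motion with a comparable exponent -/

section Construction

variable {d : ℕ} {α β c C : ℝ} {ψ : ℝ → ℝ}

lemma HasSymbol.isLevyMeasure (hψ : HasWeakScaling α β c C ψ)
    {ν : Measure (EuclideanSpace ℝ (Fin d))} [SFinite ν] (hν : HasSymbol ν ψ) (h0 : ν {0} = 0) :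
    IsLevyMeasure ν := by
  refine ⟨h0, ?_⟩
  have h1 := hν.lintegral_one_sub_exp_lt_top hψ
  refine lt_of_le_of_lt ?_ (ENNReal.mul_lt_top (a := 4) (by simp) h1)
  rw [← lintegral_const_mul' _ _ (by simp)]
  refine lintegral_mono fun x => ?_
  rw [← ENNReal.ofReal_ofNat 4, ← ENNReal.ofReal_mul (by norm_num)]
  refine ENNReal.ofReal_le_ofReal ?_
  have h2 := min_one_le_two_mul_one_sub_exp (u := ‖x‖ ^ 2 / 2) (by positivity)
  have h3 : min (‖x‖ ^ 2) 1 ≤ 2 * min (‖x‖ ^ 2 / 2) 1 := by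
    rw [mul_min_of_nonneg _ _ zero_le_two]
    exact min_le_min (by linarith) (by norm_num)
  rw [neg_div]
  linarith

lemma HasSymbol.integral_one_sub_cos {ν : Measure (EuclideanSpace ℝ (Fin d))}
    (hν : HasSymbol ν ψ) (hψ : ∀ u, 0 ≤ u → 0 ≤ ψ u) (ξ : EuclideanSpace ℝ (Fin d)) :
    ∫ x, (1 - Real.cos ⟪ξ, x⟫) ∂ν = ψ ‖ξ‖ := by
  rw [integral_eq_lintegral_of_nonneg_ae
    (ae_of_all _ fun x => sub_nonneg.2 (Real.cos_le_one _))
    (by fun_prop), hν, ENNReal.toReal_ofReal (hψ _ (norm_nonneg _))]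

/-- For every weakly scaling function `ψ` there is a complete subordinate Brownian motion whose
characteristic exponent is comparable with `ψ`. -/
theorem exists_completeSubordinateBrownianMotion_comparable (hd : 1 ≤ d)
    (hψ : HasWeakScaling α β c C ψ) :
    ∃ (q : ℝ≥0 → Measure (EuclideanSpace ℝ (Fin d))) (ψZ : ℝ → ℝ)
      (νZ : Measure (EuclideanSpace ℝ (Fin d))) (α' β' c' C' K : ℝ),
      IsConvolutionSemigroup q ∧ IsCompleteSubordinateBrownianMotion q ∧
      (∀ t, IsIsotropicUnimodal (q t)) ∧ IsCharExponent q (fun ξ => ψZ ‖ξ‖) ∧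
      SFinite νZ ∧ HasSymbol νZ ψZ ∧
      HasLevyMeasure (fun ξ : EuclideanSpace ℝ (Fin d) => ψZ ‖ξ‖) νZ ∧
      HasWeakScaling α' β' c' C' ψZ ∧ 0 < K ∧
      ∀ u, 0 < u → K⁻¹ * ψ u ≤ ψZ u ∧ ψZ u ≤ K * ψ u := by
  obtain ⟨m, hmono, hm0, hmin, K, hK, hbd⟩ := exists_isCompletelyMonotone_comparable hψ
  have hmeas : AEMeasurable m (volume.restrict (Ioi (0 : ℝ))) :=
    hmono.1.continuousOn.aemeasurable measurableSet_Ioi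
  have hmeas' : AEMeasurable (fun u => ENNReal.ofReal (m u)) (volume.restrict (Ioi (0 : ℝ))) :=
    hmeas.ennreal_ofReal
  set ρ : Measure ℝ := (volume.restrict (Ioi 0)).withDensity (fun u => ENNReal.ofReal (m u))
    with hρdef
  have hlint (f : ℝ → ℝ) (hf : Measurable f) : ∫⁻ u, ENNReal.ofReal (f u) ∂ρ =
      ∫⁻ u in Ioi (0 : ℝ), ENNReal.ofReal (m u) * ENNReal.ofReal (f u) :=
    lintegral_withDensity_eq_lintegral_mul₀ hmeas' (by fun_prop)
  have hint (f : ℝ → ℝ) : ∫ u, f u ∂ρ = ∫ u in Ioi (0 : ℝ), f u * m u := by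
    rw [hρdef, integral_withDensity_eq_integral_toReal_smul₀ hmeas'
      (ae_of_all _ fun _ => ENNReal.ofReal_lt_top)]
    simp_rw [ENNReal.toReal_ofReal (hm0 _), smul_eq_mul, mul_comm]
  have hρ0 : ρ (Iic 0) = 0 :=
    withDensity_absolutelyContinuous _ _ (by
      rw [Measure.restrict_apply measurableSet_Iic, Iic_inter_Ioi, Ioc_self, measure_empty])
  have hρ1 : ∫⁻ u, ENNReal.ofReal (min u 1) ∂ρ < ⊤ := by rwa [hlint _ (by fun_prop)]
  have hpos := ae_pos_of_Iic hρ0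
  have hnn : ∀ᵐ s ∂ρ, 0 ≤ s := hpos.mono fun _ => le_of_lt
  obtain ⟨η, hη, hlap⟩ := exists_subordinator hρ0 hρ1
  have hprob := hη.1.prob
  have hη0 (t : ℝ≥0) : ∀ᵐ s ∂(η t), 0 ≤ s := ae_nonneg_of_Iio (hη.2 t)
  set ψZ : ℝ → ℝ := fun u => ∫ s, (1 - Real.exp (-(u ^ 2 * s))) ∂ρ with hψZ
  have hZ0 : ψZ 0 = 0 := by simp [hψZ]
  have hZ (u : ℝ) (hu : 0 < u) :
      ∫⁻ s, ENNReal.ofReal (1 - Real.exp (-(u ^ 2 * s))) ∂ρ = ENNReal.ofReal (ψZ u) := by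
    have hn : 0 ≤ᵐ[ρ] fun s => 1 - Real.exp (-(u ^ 2 * s)) := by
      filter_upwards [hnn] with s hs
      simp only [Pi.zero_apply, sub_nonneg, Real.exp_le_one_iff]
      have := mul_nonneg (sq_nonneg u) hs
      linarith
    rw [hψZ, ofReal_integral_eq_lintegral_ofReal ⟨by fun_prop, ?_⟩ hn]
    rw [hasFiniteIntegral_iff_ofReal hn, hlint _ (by fun_prop)]
    exact (hbd u hu).2.trans_lt ENNReal.ofReal_lt_top
  have hcomp (u : ℝ) (hu : 0 < u) : K⁻¹ * ψ u ≤ ψZ u ∧ ψZ u ≤ K * ψ u := by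
    have hψu := hψ.pos u hu
    have h := hbd u hu
    rw [← hlint _ (by fun_prop), hZ u hu] at h
    have h1 : 0 < K⁻¹ * ψ u := by positivity
    refine ⟨?_, (ENNReal.ofReal_le_ofReal_iff (by positivity)).1 h.2⟩
    exact ((ENNReal.ofReal_le_ofReal_iff' ).1 h.1).resolve_right h1.not_ge
  have hZ' (u : ℝ) (hu : 0 ≤ u) :
      ∫⁻ s, ENNReal.ofReal (1 - Real.exp (-(u ^ 2 * s))) ∂ρ = ENNReal.ofReal (ψZ u) := by
    rcases hu.eq_or_lt with rfl | hu
    · simp [hZ0]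
    · exact hZ u hu
  have hsym : HasSymbol (subordinate d ρ) ψZ := hasSymbol_subordinate hnn hZ'
  have hchar : IsCharExponent (fun t => subordinate d (η t)) (fun ξ => ψZ ‖ξ‖) := by
    intro t ξ
    rw [charFun_subordinate (hη0 t), ← Complex.ofReal_neg, ← Complex.ofReal_exp]
    congr 1
    rcases (norm_nonneg ξ).eq_or_lt with h | h
    · simp [← h, hZ0]
    · exact hlap t _ (by positivity)
  have hprobq (t : ℝ≥0) : IsProbabilityMeasure (subordinate d (η t)) := inferInstance
  have hq : IsConvolutionSemigroup (fun t => subordinate d (η t)) :=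
    isConvolutionSemigroup_of_charFun hprobq (Φ := fun ξ => -(ψZ ‖ξ‖ : ℂ)) fun t ξ => by
      rw [hchar t ξ]
      push_cast
      rw [mul_neg]
  have hscal := hψ.of_comparable hK hZ0 (hchar.continuousOn hd hprobq)
    (fun u hu => (hcomp u hu).1) (fun u hu => (hcomp u hu).2)
  -- The Bernstein function has neither killing nor drift, so the Gaussian coefficient of `Z` is
  -- zero and `ψZ(u) = φ(u²)`.
  refine ⟨fun t => subordinate d (η t), ψZ, subordinate d ρ, α, β, K⁻¹ * c * K⁻¹, K * C * K, K, hq,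
    ⟨η, fun l => ∫ s, (1 - Real.exp (-(l * s))) ∂ρ, hη, hlap, ⟨0, 0, m, le_rfl, le_rfl, hmono, ?_,
      fun l _ => ?_⟩, fun t A hA => subordinate_apply hA⟩,
    fun t => isIsotropicUnimodal_subordinate hd (hη0 t), hchar, inferInstance, hsym,
    ⟨hsym.isLevyMeasure hscal (subordinate_singleton_zero hd hρ0), map_neg_subordinate, 0, le_rfl,
      fun ξ => ?_⟩, hscal, hK, hcomp⟩
  · refine ⟨(AEMeasurable.mul (by fun_prop) hmeas).aestronglyMeasurable, ?_⟩
    rw [hasFiniteIntegral_iff_ofReal]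
    · refine lt_of_eq_of_lt ?_ hmin
      refine lintegral_congr fun u => ?_
      rw [mul_comm, ENNReal.ofReal_mul (hm0 u)]
    · filter_upwards [ae_restrict_mem measurableSet_Ioi] with u hu
      have hu : 0 < u := hu
      have := hm0 u
      simp only [Pi.zero_apply]
      positivity
  · rw [zero_mul, zero_add, zero_add]
    exact hint _
  · rw [hsym.integral_one_sub_cos (fun u hu => hscal.nonneg hu)]
    simp

end Construction

/-! ### The exponent of a Lévy process with weak scaling -/

section LevyExponent

variable {d : ℕ} {α β c C : ℝ} {ψ : ℝ → ℝ} {ν : Measure (EuclideanSpace ℝ (Fin d))}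

/-- The weight `min (|x|²) 1` makes the measure finite and is almost everywhere positive, so it can
be divided out. -/
lemma IsLevyMeasure.sFinite (hν : IsLevyMeasure ν) : SFinite ν := by
  set w : EuclideanSpace ℝ (Fin d) → ℝ≥0∞ := fun x => ENNReal.ofReal (min (‖x‖ ^ 2) 1)
  have hw : Measurable w := by fun_prop
  have h0 : ∀ᵐ x ∂ν, w x ≠ 0 := by
    have h : ∀ᵐ x ∂ν, x ≠ 0 := by simpa [ae_iff] using hν.zero
    filter_upwards [h] with x hx
    have := norm_pos_iff.2 hx
    simp only [w, ne_eq, ENNReal.ofReal_eq_zero, not_le]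
    positivity
  have : IsFiniteMeasure (ν.withDensity w) := isFiniteMeasure_withDensity hν.lintegral_lt_top.ne
  rw [← withDensity_inv_same hw h0 (ae_of_all _ fun _ => ENNReal.ofReal_ne_top)]
  infer_instance

lemma IsLevyMeasure.integrable_one_sub_cos (hν : IsLevyMeasure ν)
    (ξ : EuclideanSpace ℝ (Fin d)) : Integrable (fun x => 1 - Real.cos ⟪ξ, x⟫) ν := by
  have hmin : Integrable (fun x => min (‖x‖ ^ 2) 1) ν := by
    refine ⟨by fun_prop, ?_⟩
    rw [hasFiniteIntegral_iff_ofReal (ae_of_all _ fun x => by simp only [Pi.zero_apply]; positivity)]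
    exact hν.lintegral_lt_top
  refine (hmin.const_mul (‖ξ‖ ^ 2 + 2)).mono' (by fun_prop) (ae_of_all _ fun x => ?_)
  have h1 := Real.one_sub_sq_div_two_le_cos (x := ⟪ξ, x⟫)
  have h2 := Real.neg_one_le_cos ⟪ξ, x⟫
  rw [Real.norm_of_nonneg (sub_nonneg.2 (Real.cos_le_one _))]
  rcases le_total (‖x‖ ^ 2) 1 with h | h
  · rw [min_eq_left h]
    have h3 : ⟪ξ, x⟫ ^ 2 ≤ (‖ξ‖ * ‖x‖) ^ 2 := by
      rw [← sq_abs]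
      exact pow_le_pow_left₀ (abs_nonneg _) (abs_real_inner_le_norm ξ x) 2
    nlinarith [sq_nonneg (‖ξ‖ * ‖x‖), sq_nonneg ‖x‖]
  · rw [min_eq_right h]
    nlinarith [sq_nonneg ‖ξ‖]

/-- The upper scaling with exponent less than `2` excludes a Gaussian part. -/
lemma HasLevyMeasure.hasSymbol (hd : 1 ≤ d)
    (hν : HasLevyMeasure (fun ξ : EuclideanSpace ℝ (Fin d) => ψ ‖ξ‖) ν) (hβ : β < 2)
    (hupper : WUSC β 0 C ψ) : HasSymbol ν ψ := by
  obtain ⟨hL, -, σ, hσ, hLK⟩ := hν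
  change ∀ ξ, ψ ‖ξ‖ = _ at hLK
  have hnn (ξ : EuclideanSpace ℝ (Fin d)) : 0 ≤ ∫ x, (1 - Real.cos ⟪ξ, x⟫) ∂ν :=
    integral_nonneg fun x => sub_nonneg.2 (Real.cos_le_one _)
  have hσ0 : σ = 0 := by
    by_contra hne
    have hσ : 0 < σ := lt_of_le_of_ne hσ (Ne.symm hne)
    -- For such `u` the Gaussian term alone satisfies `σu² > C u^β ψ(1)`, contradicting upper
    -- scaling from `1` to `u`.
    obtain ⟨u, hu, hu1⟩ := (((tendsto_rpow_atTop (sub_pos.2 hβ)).eventually_gt_atTop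
      (C * ψ 1 / σ)).and (eventually_ge_atTop 1)).exists
    have hu0 : 0 < u := one_pos.trans_le hu1
    have h1 := hupper u 1 hu1 one_pos
    have h2 := hLK (u • EuclideanSpace.single (⟨0, hd⟩ : Fin d) (1 : ℝ))
    have h3 := hnn (u • EuclideanSpace.single (⟨0, hd⟩ : Fin d) (1 : ℝ))
    simp only [norm_smul, Real.norm_of_nonneg hu0.le, PiLp.norm_single, norm_one, mul_one] at h1 h2
    rw [div_lt_iff₀ hσ, Real.rpow_sub hu0, div_mul_eq_mul_div,
      lt_div_iff₀ (Real.rpow_pos_of_pos hu0 _), Real.rpow_two] at hu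
    nlinarith
  intro ξ
  rw [← ofReal_integral_eq_lintegral_ofReal (hL.integrable_one_sub_cos ξ)
    (ae_of_all _ fun x => sub_nonneg.2 (Real.cos_le_one _)), hLK ξ, hσ0, zero_mul, zero_add]

/-- A nowhere positive symbol has zero Gaussian average, so `1 - exp(-|x|²/2)` vanishes almost
everywhere and `ν` lives at the origin. -/
lemma HasSymbol.exists_pos [SFinite ν] (hν : HasSymbol ν ψ) (h0 : ν {0} = 0) (hne : ν ≠ 0) :
    ∃ u, 0 ≤ u ∧ 0 < ψ u := by
  by_contra! hcon
  have h1 := hν.lintegral_one_sub_exp one_pos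
  have h2 (g : EuclideanSpace ℝ (Fin d)) : ENNReal.ofReal (ψ (‖g‖ * (1 / 1))) = 0 :=
    ENNReal.ofReal_of_nonpos (hcon _ (by positivity))
  simp_rw [h2] at h1
  rw [lintegral_zero, lintegral_eq_zero_iff (by fun_prop)] at h1
  have h3 : ∀ᵐ x ∂ν, x ≠ 0 := by simpa [ae_iff] using h0
  have h4 : ∀ᵐ x ∂ν, False := by
    filter_upwards [h1, h3] with x hx hx0
    simp only [Pi.zero_apply, ENNReal.ofReal_eq_zero, sub_nonpos, Real.one_le_exp_iff] at hx
    have : 0 < ‖x‖ := norm_pos_iff.2 hx0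
    have : 0 < (‖x‖ / 1) ^ 2 := by positivity
    linarith
  exact hne (ae_eq_bot.1 (eventually_false_iff_eq_bot.1 h4))

/-- A zero of `ψ` at some `u > 0` spreads: upwards by upper scaling, downwards by lower scaling.
Then `ψ` would vanish identically. -/
lemma WLSC.pos_of_WUSC (hlower : WLSC α 0 c ψ) (hupper : WUSC β 0 C ψ) (hc : 0 < c)
    (h0 : ψ 0 = 0) (hnn : ∀ u, 0 ≤ u → 0 ≤ ψ u) (hex : ∃ u, 0 ≤ u ∧ 0 < ψ u) :
    ∀ u, 0 < u → 0 < ψ u := by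
  obtain ⟨v, hv, hψv⟩ := hex
  have hv : 0 < v := hv.lt_of_ne (by rintro rfl; exact hψv.ne' h0)
  intro u hu
  refine (hnn u hu.le).lt_of_ne fun hu0 => ?_
  rcases le_total u v with h | h
  · have := hupper (v / u) u ((one_le_div hu).2 h) hu
    rw [div_mul_cancel₀ _ hu.ne', ← hu0, mul_zero] at this
    exact this.not_gt hψv
  · have := hlower (u / v) v ((one_le_div hv).2 h) hv
    rw [div_mul_cancel₀ _ hv.ne', ← hu0] at this
    have h2 : 0 < c * (u / v) ^ α * ψ v := by positivity
    exact this.not_gt h2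

end LevyExponent

/-! ### Comparability -/

lemma ComparableOn.of_le {ι : Type*} {S : Set ι} {f g : ι → ℝ} {M : ℝ} (hM : 0 < M)
    (hf : ∀ x ∈ S, 0 ≤ f x) (hg : ∀ x ∈ S, 0 ≤ g x) (hfg : ∀ x ∈ S, f x ≤ M * g x)
    (hgf : ∀ x ∈ S, g x ≤ M * f x) : ComparableOn S f g :=
  ⟨M, hM, fun x hx => ⟨hf x hx, hg x hx, (inv_mul_le_iff₀ hM).2 (hfg x hx), hgf x hx⟩⟩

section Comparison

variable {d : ℕ} {α β c C α' β' c' C' K : ℝ} {ψ ψ' : ℝ → ℝ}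

lemma comparableOn_levy_density (hd : 1 ≤ d) (hψ : HasWeakScaling α β c C ψ)
    (hψ' : HasWeakScaling α' β' c' C' ψ') (hK : 0 < K)
    (h1 : ∀ u, 0 < u → ψ u ≤ K * ψ' u) (h2 : ∀ u, 0 < u → ψ' u ≤ K * ψ u)
    {ν ν' : Measure (EuclideanSpace ℝ (Fin d))} [SFinite ν] [SFinite ν'] {f g : ℝ → ℝ}
    (hν : HasSymbol ν ψ) (hν' : HasSymbol ν' ψ') (hf : IsRadialNonincreasingDensity f ν)
    (hg : IsRadialNonincreasingDensity g ν') : ComparableOn (Ioi 0) f g := by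
  obtain ⟨K₁, hK₁, hb₁⟩ := exists_levy_density_bounds hd hψ
  obtain ⟨K₂, hK₂, hb₂⟩ := exists_levy_density_bounds hd hψ'
  refine ComparableOn.of_le (M := K₁ * K * K₂) (by positivity) hf.1 hg.1 (fun r hr => ?_)
    (fun r hr => ?_)
  all_goals
    have hr : 0 < r := hr
    obtain ⟨hf1, hf2⟩ := hb₁ ν f hν hf r hr
    obtain ⟨hg1, hg2⟩ := hb₂ ν' g hν' hg r hr
    have := h1 (1 / r) (by positivity)
    have := h2 (1 / r) (by positivity)
  · calc f r ≤ K₁ * (ψ (1 / r) / r ^ d) := hf1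
      _ ≤ K₁ * (K * ψ' (1 / r) / r ^ d) := by gcongr
      _ = K₁ * K * (ψ' (1 / r) / r ^ d) := by ring
      _ ≤ K₁ * K * (K₂ * g r) := by gcongr
      _ = _ := by ring
  · calc g r ≤ K₂ * (ψ' (1 / r) / r ^ d) := hg1
      _ ≤ K₂ * (K * ψ (1 / r) / r ^ d) := by gcongr
      _ = K₂ * K * (ψ (1 / r) / r ^ d) := by ring
      _ ≤ K₂ * K * (K₁ * f r) := by gcongr
      _ = _ := by ring

lemma exists_comparableOn_transition_density (hd : 1 ≤ d) (hψ : HasWeakScaling α β c C ψ)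
    (hψ' : HasWeakScaling α' β' c' C' ψ') (hK : 0 < K)
    (h1 : ∀ u, 0 < u → ψ u ≤ K * ψ' u) (h2 : ∀ u, 0 < u → ψ' u ≤ K * ψ u)
    {p q : ℝ≥0 → Measure (EuclideanSpace ℝ (Fin d))}
    (hp : IsConvolutionSemigroup p) (hpu : ∀ t, IsIsotropicUnimodal (p t))
    (hpψ : IsCharExponent p (fun ξ => ψ ‖ξ‖))
    (hq : IsConvolutionSemigroup q) (hqu : ∀ t, IsIsotropicUnimodal (q t))
    (hqψ : IsCharExponent q (fun ξ => ψ' ‖ξ‖)) :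
    ∃ k k' : ℝ≥0 → EuclideanSpace ℝ (Fin d) → ℝ,
      IsContinuousTransitionDensity p k ∧ IsContinuousTransitionDensity q k' ∧
      ComparableOn {z : ℝ≥0 × EuclideanSpace ℝ (Fin d) | 0 < z.1}
        (fun z => k z.1 z.2) (fun z => k' z.1 z.2) := by
  obtain ⟨K₁, hK₁, hb₁⟩ := exists_transition_density_bounds hd hψ one_pos
  obtain ⟨K₂, hK₂, hb₂⟩ := exists_transition_density_bounds hd hψ' hK
  obtain ⟨k, hk, hkb⟩ := hb₁ p hp hpu hpψ
  obtain ⟨k', hk', hkb'⟩ := hb₂ q hq hqu hqψ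
  have key (z : ℝ≥0 × EuclideanSpace ℝ (Fin d)) (hz : 0 < z.1) :
      k z.1 z.2 ≤ K₁ * K₂ * (K + 1) * k' z.1 z.2 ∧
      k' z.1 z.2 ≤ K₁ * K₂ * (K + 1) * k z.1 z.2 := by
    obtain ⟨t, x⟩ := z
    have ht : 0 < t := hz
    have ht' : (0 : ℝ) < t := ht
    have hkx := (hk t ht).2.1 x
    have hkx' := (hk' t ht).2.1 x
    -- The same `h` is used for both processes: `tψ(h) = 1` forces `K⁻¹ ≤ tψ'(h) ≤ K`, hence the
    -- parameters `B = 1` and `B = K` above. The two space-time regimes then coincide.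
    obtain ⟨h, hh, hψh⟩ := hψ.exists_eq (inv_pos.2 ht')
    have e1 : t * ψ h = 1 := by rw [hψh, mul_inv_cancel₀ ht'.ne']
    have e2 : K⁻¹ ≤ t * ψ' h := by
      rw [inv_le_iff_one_le_mul₀ hK, ← e1]
      nlinarith [h1 h hh]
    have e3 : t * ψ' h ≤ K := by
      calc t * ψ' h ≤ t * (K * ψ h) := by gcongr; exact h2 h hh
        _ = K * (t * ψ h) := by ring
        _ = K := by rw [e1, mul_one]
    obtain ⟨a1, a2, a3, a4⟩ := hkb t h ht hh (by simp [e1]) e1.le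
    obtain ⟨b1, b2, b3, b4⟩ := hkb' t h ht hh e2 e3
    simp only
    rcases le_total ‖x‖ (1 / h) with hx | hx
    · constructor
      · calc k t x ≤ K₁ * h ^ d := a1 x
          _ ≤ K₁ * (K₂ * k' t x) := by gcongr; exact b3 x hx
          _ = K₁ * K₂ * 1 * k' t x := by ring
          _ ≤ _ := by gcongr; linarith
      · calc k' t x ≤ K₂ * h ^ d := b1 x
          _ ≤ K₂ * (K₁ * k t x) := by gcongr; exact a3 x hx
          _ = K₁ * K₂ * 1 * k t x := by ring
          _ ≤ _ := by gcongr; linarith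
    · have hx0 : 0 < ‖x‖ := (by positivity : 0 < 1 / h).trans_le hx
      have hx0' := norm_pos_iff.1 hx0
      have := h1 (1 / ‖x‖) (by positivity)
      have := h2 (1 / ‖x‖) (by positivity)
      constructor
      · calc k t x ≤ K₁ * (t * ψ (1 / ‖x‖) / ‖x‖ ^ d) := a2 x hx0'
          _ ≤ K₁ * (t * (K * ψ' (1 / ‖x‖)) / ‖x‖ ^ d) := by gcongr
          _ = K₁ * K * (t * ψ' (1 / ‖x‖) / ‖x‖ ^ d) := by ring
          _ ≤ K₁ * K * (K₂ * k' t x) := by gcongr; exact b4 x hx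
          _ = K₁ * K₂ * K * k' t x := by ring
          _ ≤ _ := by gcongr; linarith
      · calc k' t x ≤ K₂ * (t * ψ' (1 / ‖x‖) / ‖x‖ ^ d) := b2 x hx0'
          _ ≤ K₂ * (t * (K * ψ (1 / ‖x‖)) / ‖x‖ ^ d) := by gcongr
          _ = K₂ * K * (t * ψ (1 / ‖x‖) / ‖x‖ ^ d) := by ring
          _ ≤ K₂ * K * (K₁ * k t x) := by gcongr; exact a4 x hx
          _ = K₁ * K₂ * K * k t x := by ring
          _ ≤ _ := by gcongr; linarith
  exact ⟨k, k', hk, hk', ComparableOn.of_le (by positivity) (fun z hz => (hk z.1 hz).2.1 _)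
    (fun z hz => (hk' z.1 hz).2.1 _) (fun z hz => (key z hz).1) (fun z hz => (key z hz).2)⟩

end Comparison

/-! ### The main theorem -/

theorem mainTheorem6 (d : ℕ) (hd : 1 ≤ d)
    (p : ℝ≥0 → Measure (EuclideanSpace ℝ (Fin d))) (ψ : ℝ → ℝ)
    (ν : Measure (EuclideanSpace ℝ (Fin d)))
    (hp : IsConvolutionSemigroup p) (hunimodal : ∀ t, IsIsotropicUnimodal (p t))
    (hψ : IsCharExponent p (fun ξ => ψ ‖ξ‖))
    (hν : HasLevyMeasure (fun ξ : EuclideanSpace ℝ (Fin d) => ψ ‖ξ‖) ν) (hν0 : ν ≠ 0)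
    (α β c C : ℝ) (hα : 0 < α) (hαβ : α ≤ β) (hβ : β < 2)
    (hc : 0 < c) (hc1 : c ≤ 1) (hC : 1 ≤ C)
    (hlower : WLSC α 0 c ψ) (hupper : WUSC β 0 C ψ) :
    ∃ (q : ℝ≥0 → Measure (EuclideanSpace ℝ (Fin d))) (ψZ : ℝ → ℝ)
      (νZ : Measure (EuclideanSpace ℝ (Fin d))),
      IsConvolutionSemigroup q ∧
      IsCompleteSubordinateBrownianMotion q ∧
      IsCharExponent q (fun ξ => ψZ ‖ξ‖) ∧
      HasLevyMeasure (fun ξ : EuclideanSpace ℝ (Fin d) => ψZ ‖ξ‖) νZ ∧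
      -- the characteristic exponents are comparable
      ComparableOn (Set.Ici 0) ψ ψZ ∧
      -- the Lévy measures have comparable radial nonincreasing densities
      (∃ f g : ℝ → ℝ, IsRadialNonincreasingDensity f ν ∧ IsRadialNonincreasingDensity g νZ ∧
        ComparableOn (Set.Ioi 0) f g) ∧
      -- the transition densities are comparable, uniformly in time and space
      (∃ k kZ : ℝ≥0 → EuclideanSpace ℝ (Fin d) → ℝ,
        IsContinuousTransitionDensity p k ∧ IsContinuousTransitionDensity q kZ ∧
        ComparableOn {z : ℝ≥0 × EuclideanSpace ℝ (Fin d) | 0 < z.1}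
          (fun z => k z.1 z.2) (fun z => kZ z.1 z.2)) := by
  have hprob := hp.prob
  have hsf : SFinite ν := hν.1.sFinite
  have hψ0 := hψ.apply_zero hprob
  have hsym : HasSymbol ν ψ := hν.hasSymbol hd hβ hupper
  have hscal : HasWeakScaling α β c C ψ :=
    { alpha_pos := hα
      beta_pos := hα.trans_le hαβ
      beta_lt := hβ
      c_pos := hc
      C_pos := one_pos.trans_le hC
      zero := hψ0
      -- Nontriviality of `ν` enters here, after the Gaussian part has been excluded.
      pos := hlower.pos_of_WUSC hupper hc hψ0 (fun u hu => hψ.apply_nonneg hd hprob hu)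
        (hsym.exists_pos hν.1.zero hν0)
      lower := hlower
      upper := hupper
      cont := hψ.continuousOn hd hprob }
  obtain ⟨q, ψZ, νZ, α', β', c', C', K, hq, hqZ, hqu, hqψ, hsfZ, hsymZ, hνZ, hscalZ, hK, hcomp⟩ :=
    exists_completeSubordinateBrownianMotion_comparable hd hscal
  have h1 (u : ℝ) (hu : 0 < u) : ψ u ≤ K * ψZ u := (inv_mul_le_iff₀ hK).1 (hcomp u hu).1
  have h2 (u : ℝ) (hu : 0 < u) : ψZ u ≤ K * ψ u := (hcomp u hu).2
  obtain ⟨f, hf⟩ := exists_isRadialNonincreasingDensity_levyMeasure hd hscal hp hunimodal hψ hsym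
    hν.2.1
  obtain ⟨g, hg⟩ := exists_isRadialNonincreasingDensity_levyMeasure hd hscalZ hq hqu hqψ hsymZ
    hνZ.2.1
  refine ⟨q, ψZ, νZ, hq, hqZ, hqψ, hνZ, ?_, ⟨f, g, hf, hg,
    comparableOn_levy_density hd hscal hscalZ hK h1 h2 hsym hsymZ hf hg⟩,
    exists_comparableOn_transition_density hd hscal hscalZ hK h1 h2 hp hunimodal hψ hq hqu hqψ⟩
  refine ComparableOn.of_le hK (fun u hu => hscal.nonneg hu) (fun u hu => hscalZ.nonneg hu)
    (fun u hu => ?_) (fun u hu => ?_)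
  · rcases (mem_Ici.1 hu).eq_or_lt with rfl | hu
    · simp [hscal.zero, hscalZ.zero]
    · exact h1 u hu
  · rcases (mem_Ici.1 hu).eq_or_lt with rfl | hu
    · simp [hscal.zero, hscalZ.zero]
    · exact h2 u hu
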